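/- **Problem.** Let $f_0:\mathbb R^d\to\mathbb R$ be differentiable with $L_f$-Lipschitz gradient, let $g:\mathbb R^{\bar n}\to\mathbb R\cup\{+\infty\}$ be proper, lower semicontinuous, convex and $l_g$-Lipschitz on $\operatorname{dom} g$ ($l_g>0$), let $A\in\mathbb R^{n\times d}$ have full row rank, $\bar A\in\mathbb R^{\bar n\times d}$, $b\in\mathbb R^n$, $\bar b\in\mathbb R^{\bar n}$. Put $F_0(x)=f_0(x)+g(\bar Ax+\bar b)$, $F(x,y)=f_0(x)+g(y)$, $H=[\bar A;A]\neq 0$. Assume $\inf F_0>-\infty$ and that some $x$ with $Ax+b=0$ has $\bar Ax+\bar b\in\operatorname{ri}(\operatorname{dom} g)$. The split problem (SP) is $\min F(x,y)$ s.t. $Ax+b=0$, $y=\bar Ax+\bar b$. A pair $(x,y)$ is an $\varepsilon$-KKT point of (SP) if for some $\gamma_1,\gamma_2$ the four quantities $\operatorname{dist}(0,\partial g(y)-\gamma_1)$, $\|\nabla f_0(x)+\bar A^\top\gamma_1+A^\top\gamma_2\|$, $\|y-\bar Ax-\bar b\|$, $\|Ax+b\|$ are all $\le\varepsilon$. **Method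 (PG-RPD).** Let $\tau=2L_f$, $\sigma>0$, let $(x^{(0)},y^{(0)})$ be feasible for (SP) with $g(y^{(0)})<\infty$, and let $z^{\rm ini}=(z_1^{\rm ini},z_2^{\rm ini})$ with $z_1^{\rm ini}\in\operatorname{dom} g^\star$. In outer iteration $k$ let $$\mathcal D_k(z)=\tfrac1{2\tau}\|H^\top z+\nabla f_0(x^{(k)})-\tau x^{(k)}\|^2+g^\star(z_1)-z_1^\top\bar b-z_2^\top b,\quad \Omega_k=\operatorname{Argmin}\mathcal D_k,\quad \mathrm{gap}_k=\mathcal D_k(z^{\rm ini})-\min\mathcal D_k .$$ A vector $z^{(k+1)}$ with $z^{(k+1)}_1\in\operatorname{dom} g^\star$ and $\operatorname{dist}(z^{(k+1)},\Omega_k)\le\mu_k$ is computed as below, and then $$x^{(k+1)}=x^{(k)}-\tfrac1\tau\big(H^\top z^{(k+1)}+\nabla f_0(x^{(k)})\big),\qquad y^{(k+1)}=\operatorname{prox}_{\sigma^{-1}g}\big(\sigma^{-1}z_1^{(k+1)}+\bar Ax^{(k+1)}+\bar b\big).$$ The vector $z^{(k+1)}$ is the output of a restarted accelerated proximal gradient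 (APG, FISTA) method for $\min\mathcal D_k$ with step $1/L_{\mathcal D}$, $L_{\mathcal D}=\lambda_{\max}(HH^\top)/\tau$, started at $z^{\rm ini}$, which runs $i_k$ cycles of $j_k$ APG steps, with the momentum ($\alpha_0=1$, $\alpha_{j+1}=(1+\sqrt{1+4\alpha_j^2})/2$) reset at the start of each cycle; $i_k=\max\{0,\lceil\log_2(2\,\mathrm{gap}_k/(\rho_k\mu_k^2))\rceil\}$, where $j_k$ and $\rho_k$ are specified below. Let $$\widetilde\mu_k=\min\Big\{\tfrac{\varepsilon}{B_1\sigma},\ \tfrac{\varepsilon}{B_1},\ \tfrac{\varepsilon^2}{12L_fB_1(B_3^k+\sigma\|\bar A\|B_4^k+l_g)},\ \sqrt{\tfrac{\varepsilon^2}{12L_fB_1B_2(1+\tau^{-1}\sigma\|\bar A\|\|H\|)}}\Big\},$$ $B_1=\tau^{-1}\|\bar A\|\|H\|+\sigma^{-1}+\tau^{-1}(\|\bar A\|+\|A\|)\|H\|$, $B_2=1+\|(AA^\top)^{-1}A\|\|H\|$, $B_3^k=\|(AA^\top)^{-1}A\|(\|\nabla f_0(x^{(k)})\|+\|\bar A\|l_g)$,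 $B_4^k=\tau^{-1}(\|\nabla f_0(x^{(k)})\|+\|H\|(l_g+B_3^k))$. Let $\Delta_F=F(x^{(0)},y^{(0)})-\inf_{x,y}F(x,y)$ and $K_\varepsilon=\lceil12L_f\Delta_F\varepsilon^{-2}\rceil$. Below, "$\mathcal O(Q\log(M/\varepsilon)L_f\Delta_F\varepsilon^{-2})$ APG steps" means, with one absolute constant $c$ for all problems and all parts: there are $B\ge1$ and $\varepsilon_0>0$, independent of $\varepsilon$, such that for every $0<\varepsilon<\min\{\sqrt{3L_f},1\}$ the method reaches an $\varepsilon$-KKT point of (SP) after a total number $\sum_k i_kj_k$ of APG steps that is at most $c\,Q\log(B/\varepsilon)K_\varepsilon$, and, if $\varepsilon\le\varepsilon_0$, at most $c\,Q\log(M/\varepsilon)L_f\Delta_F\varepsilon^{-2}$. A Hoffman constant of a system $Mz=r$, $Nz\le s$ is a number $\theta$ such that, for all right-hand sides $(r,s)$ for which the system is solvable and for all $z$, the distance from $z$ to the solution set is at most $\theta\|(Mz-r,(Nz-s)_+)\|$. **Statement.** For every $0<\varepsilon<\min\{\sqrt{3L_f},1\}$ the following hold; in each outer iteration performed the inner solver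 meets the criterion on $z^{(k+1)}$. (a) If $H$ has full row rank, $\mu_k=\widetilde\mu_k$, $j_k=\lceil2\sqrt2\,\kappa(H)\rceil$ and $\rho_k=\lambda_{\min}^+(HH^\top)/\tau$, where $\kappa(H)=\sqrt{\lambda_{\max}(HH^\top)/\lambda^+_{\min}(HH^\top)}$, the method finds an $\varepsilon$-KKT point of (SP) and, if $\Delta_F<\infty$, it needs $\mathcal O(\kappa(H)\log(1/\varepsilon)L_f\Delta_F\varepsilon^{-2})$ APG steps. In (b) and (c) let $g(y)=\sup\{u^\top y: Cu\le c_0\}$ for a matrix $C$ and a vector $c_0$, and $j_k=\lceil2\sqrt{2L_{\mathcal D}/\rho_k}\rceil$. (b) Let $\bar b=0$, $b=0$. Then the system $H^\top z=r$, $Cz_1\le s$ has a Hoffman constant. For any such constant $\theta$, with $\mu_k=\widetilde\mu_k$ and $\rho_k=(\theta^2\tau)^{-1}$, the method finds an $\varepsilon$-KKT point of (SP) and, if $\Delta_F<\infty$, it needs $\mathcal O(\sqrt{\lambda_{\max}(HH^\top)\theta^2}\,\log(1/\varepsilon)L_f\Delta_F\varepsilon^{-2})$ APG steps. (c) Let $\{(x,y):F(x,y)\le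 F(x^{(0)},y^{(0)})+1\}$ be compact. Then the system $H^\top z=r$, $-z_1^\top\bar b-z_2^\top b=t$, $Cz_1\le s$ has a Hoffman constant. For any such constant $\theta$ let $\mu_k=\widetilde\mu_k/(k+1)^2$ and $\rho_k=[\theta^2(\tau+\mathrm{gap}_k+2\|\nu^{(k)}\|^2/\tau)]^{-1}$ if $(\bar b,b)\ne0$, $\rho_k=(\theta^2\tau)^{-1}$ otherwise, where $\nu^{(k)}$ is the common value of $H^\top z+\nabla f_0(x^{(k)})-\tau x^{(k)}$ for $z\in\Omega_k$. There are constants $B_5,B_6$ independent of $\varepsilon$ such that $$\|\nu^{(k)}\|^2\le B_5,\qquad \mathrm{gap}_k\le B_6\qquad(0\le k<K_\varepsilon)\qquad(*)$$ and the method finds an $\varepsilon$-KKT point of (SP) with $\mathcal O(\sqrt{\lambda_{\max}(HH^\top)\theta^2(1+B_6/\tau+2B_5)}\,\log(B_6/\varepsilon)L_f\Delta_F\varepsilon^{-2})$ APG steps. Moreover, for arbitrary $B_5,B_6$ that satisfy $(*)$ for all admissible $\varepsilon$, it does so with $\mathcal O(\max\{1,\sqrt{\lambda_{\max}(HH^\top)\theta^2(1+B_6/\tau+2B_5/\tau^2)}\}\,\log(B_6/\varepsilon)L_f\Delta_F\varepsilon^{-2})$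 APG steps. -/

import Mathlib

open scoped InnerProductSpace

noncomputable section

namespace PGRPD

/-! ### Linear algebra in Euclidean spaces -/

/-- The Euclidean space `ℝ^ι`. -/
abbrev Vec (ι : Type) [Fintype ι] := EuclideanSpace ℝ ι

section LinearAlgebra

variable {ι κ : Type} [Fintype ι] [Fintype κ] [DecidableEq ι] [DecidableEq κ]

/-- The product `M v` of a matrix and a Euclidean vector, as a bounded linear map in `v`. -/
def mul (M : Matrix ι κ ℝ) : Vec κ →L[ℝ] Vec ι :=
  LinearMap.toContinuousLinearMap (Matrix.toEuclideanLin M)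

/-- The spectral norm `‖M‖`. -/
def specNorm (M : Matrix ι κ ℝ) : ℝ := ‖mul M‖

/-- The largest eigenvalue of `M Mᵀ`. -/
def lamMax (M : Matrix ι κ ℝ) : ℝ := sSup (spectrum ℝ (M * M.transpose))

/-- The smallest positive eigenvalue of `M Mᵀ`. -/
def lamMinPos (M : Matrix ι κ ℝ) : ℝ := sInf {t | t ∈ spectrum ℝ (M * M.transpose) ∧ 0 < t}

/-- The condition number `κ(M)`. -/
def condNumber (M : Matrix ι κ ℝ) : ℝ := √(lamMax M / lamMinPos M)

/-- The rows of `M` are linearly independent. -/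
def FullRowRank (M : Matrix ι κ ℝ) : Prop := LinearIndependent ℝ M.row

/-- The block `z₁` of `z = (z₁, z₂)`. -/
def fstBlock (z : Vec (ι ⊕ κ)) : Vec ι := WithLp.toLp 2 fun i => z (Sum.inl i)

/-- The block `z₂` of `z = (z₁, z₂)`. -/
def sndBlock (z : Vec (ι ⊕ κ)) : Vec κ := WithLp.toLp 2 fun i => z (Sum.inr i)

/-- The vector `(z₁, z₂)`. -/
def join (z₁ : Vec ι) (z₂ : Vec κ) : Vec (ι ⊕ κ) := WithLp.toLp 2 (Sum.elim z₁ z₂)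

/-- `θ` is a Hoffman constant of the pair `(M, N)`: for all right-hand sides `(r, s)` for which the
system `M z = r`, `N z ≤ s` is solvable, the distance of any `z` to the solution set is at most
`θ` times the Euclidean norm of the residual `(M z - r, (N z - s)₊)`. -/
def IsHoffmanConstant {p q : Type} [Fintype p] [Fintype q] (M : Matrix p ι ℝ) (N : Matrix q ι ℝ)
    (θ : ℝ) : Prop :=
  ∀ (r : Vec p) (s : Vec q),
    {z : Vec ι | mul M z = r ∧ ∀ i, mul N z i ≤ s i}.Nonempty →
    ∀ z : Vec ι,
      Metric.infDist z {z : Vec ι | mul M z = r ∧ ∀ i, mul N z i ≤ s i} ≤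
        θ * √(‖mul M z - r‖ ^ 2 + ∑ i, (max (mul N z i - s i) 0) ^ 2)

end LinearAlgebra

/-! ### Convex analysis for functions with values in `ℝ ∪ {+∞}` -/

section ConvexAnalysis

variable {ι : Type} [Fintype ι]

/-- The effective domain. -/
def dom (h : Vec ι → EReal) : Set (Vec ι) := {y | h y ≠ ⊤}

/-- `h` is a proper lower semicontinuous convex function (convexity through the epigraph). -/
structure IsProperClosedConvex (h : Vec ι → EReal) : Prop where
  ne_bot : ∀ y, h y ≠ ⊥
  dom_nonempty : (dom h).Nonempty
  lsc : LowerSemicontinuous h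
  convex_epi : Convex ℝ {p : Vec ι × ℝ | h p.1 ≤ (p.2 : EReal)}

/-- The convex subdifferential `∂h(y)`. -/
def subdiff (h : Vec ι → EReal) (y : Vec ι) : Set (Vec ι) :=
  {ξ | ∀ y', h y + ((⟪ξ, y' - y⟫_ℝ : ℝ) : EReal) ≤ h y'}

/-- The convex conjugate `h⋆`. -/
def conj (h : Vec ι → EReal) (z : Vec ι) : EReal := ⨆ y, (((⟪y, z⟫_ℝ : ℝ) : EReal) - h y)

/-- `p` minimizes `h(·) + ‖· - v‖² / (2η)`. -/
def IsProx (η : ℝ) (h : Vec ι → EReal) (v p : Vec ι) : Prop :=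
  ∀ p', h p + ((1 / (2 * η) * ‖p - v‖ ^ 2 : ℝ) : EReal) ≤
    h p' + ((1 / (2 * η) * ‖p' - v‖ ^ 2 : ℝ) : EReal)

/-- The proximal operator: the (unique, for proper closed convex `h` and `η > 0`) minimizer. -/
def prox (η : ℝ) (h : Vec ι → EReal) (v : Vec ι) : Vec ι := Classical.epsilon (IsProx η h v)

end ConvexAnalysis

/-! ### The problem -/

/-- The data of `min f₀(x) + g(Ā x + b̄)` subject to `A x + b = 0` and the inputs of the method:
the Lipschitz constants `L_f` and `l_g`, the parameter `σ`, the initial point `(x⁰, y⁰)` and the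
initial dual point `z^ini`. -/
structure Setup (d n nb : ℕ) where
  f₀ : Vec (Fin d) → ℝ
  g : Vec (Fin nb) → EReal
  A : Matrix (Fin n) (Fin d) ℝ
  b : Vec (Fin n)
  Abar : Matrix (Fin nb) (Fin d) ℝ
  bbar : Vec (Fin nb)
  Lf : ℝ
  lg : ℝ
  σ : ℝ
  x0 : Vec (Fin d)
  y0 : Vec (Fin nb)
  zini : Vec (Fin nb ⊕ Fin n)

namespace Setup

variable {d n nb : ℕ} (S : Setup d n nb)

/-- The stacked matrix `[Ā; A]`. -/
def H : Matrix (Fin nb ⊕ Fin n) (Fin d) ℝ := Matrix.fromRows S.Abar S.A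

/-- The objective `F₀(x) = f₀(x) + g(Ā x + b̄)`. -/
def F₀ (x : Vec (Fin d)) : EReal := (S.f₀ x : EReal) + S.g (mul S.Abar x + S.bbar)

/-- The objective `F(x, y) = f₀(x) + g(y)` of the split problem. -/
def F (p : Vec (Fin d) × Vec (Fin nb)) : EReal := (S.f₀ p.1 : EReal) + S.g p.2

/-- `F` is bounded below, i.e. `Δ_F < ∞`. -/
def BoundedBelow : Prop := ∃ m : ℝ, ∀ p, (m : EReal) ≤ S.F p

/-- `Δ_F = F(x⁰, y⁰) - inf F` (meaningful when `F` is bounded below). -/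
def ΔF : ℝ := (S.F (S.x0, S.y0)).toReal - (⨅ p, S.F p).toReal

/-- The standing assumptions on the problem and the requirements on the inputs. -/
structure Assumptions : Prop where
  differentiable : Differentiable ℝ S.f₀
  lipschitz_grad : ∀ x x', ‖gradient S.f₀ x - gradient S.f₀ x'‖ ≤ S.Lf * ‖x - x'‖
  inf_F₀ : ∃ m : ℝ, ∀ x, (m : EReal) ≤ S.F₀ x
  g_convex : IsProperClosedConvex S.g
  A_rank : FullRowRank S.A
  slater : ∃ x, mul S.A x + S.b = 0 ∧
    mul S.Abar x + S.bbar ∈ intrinsicInterior ℝ (dom S.g)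
  lg_pos : 0 < S.lg
  g_lipschitz : ∀ y ∈ dom S.g, ∀ y' ∈ dom S.g,
    |(S.g y).toReal - (S.g y').toReal| ≤ S.lg * ‖y - y'‖
  σ_pos : 0 < S.σ
  x0_feasible : mul S.A S.x0 + S.b = 0
  y0_feasible : S.y0 = mul S.Abar S.x0 + S.bbar
  y0_dom : S.y0 ∈ dom S.g
  zini_dom : fstBlock S.zini ∈ dom (conj S.g)

/-- `g` is the support function of the polyhedron `{u : C u ≤ c}`. -/
def IsPolyhedral {m : ℕ} (C : Matrix (Fin m) (Fin nb) ℝ) (c : Vec (Fin m)) : Prop :=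
  ∀ y, S.g y = ⨆ u : {u : Vec (Fin nb) // ∀ i, mul C u i ≤ c i}, ((⟪u.1, y⟫_ℝ : ℝ) : EReal)

/-- `(x, y)` is an `ε`-KKT point of the split problem. -/
def IsKKT (ε : ℝ) (x : Vec (Fin d)) (y : Vec (Fin nb)) : Prop :=
  ∃ (γ₁ : Vec (Fin nb)) (γ₂ : Vec (Fin n)),
    Metric.infEDist 0 ((fun ξ => ξ - γ₁) '' subdiff S.g y) ≤ ENNReal.ofReal ε ∧
    ‖gradient S.f₀ x + mul S.Abar.transpose γ₁ + mul S.A.transpose γ₂‖ ≤ ε ∧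
    ‖y - mul S.Abar x - S.bbar‖ ≤ ε ∧
    ‖mul S.A x + S.b‖ ≤ ε

/-! ### The dual subproblem at an outer iterate `x` -/

/-- `τ = 2 L_f`. -/
def τ : ℝ := 2 * S.Lf

/-- `[Ā; A]ᵀ z + ∇f₀(x) - τ x`. -/
def dualResidual (x : Vec (Fin d)) (z : Vec (Fin nb ⊕ Fin n)) : Vec (Fin d) :=
  mul S.H.transpose z + gradient S.f₀ x - S.τ • x

/-- The negative Lagrangian dual function `𝒟(z)` of the subproblem at `x`. -/
def dual (x : Vec (Fin d)) (z : Vec (Fin nb ⊕ Fin n)) : EReal :=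
  ((1 / (2 * S.τ) * ‖S.dualResidual x z‖ ^ 2
      - ⟪fstBlock z, S.bbar⟫_ℝ - ⟪sndBlock z, S.b⟫_ℝ : ℝ) : EReal)
    + conj S.g (fstBlock z)

/-- The set `Ω` of minimizers of `𝒟`. -/
def Ω (x : Vec (Fin d)) : Set (Vec (Fin nb ⊕ Fin n)) := {z | ∀ z', S.dual x z ≤ S.dual x z'}

/-- The initial dual gap `𝒟(z^ini) - min 𝒟`. -/
def gap (x : Vec (Fin d)) : ℝ := (S.dual x S.zini).toReal - (⨅ z, S.dual x z).toReal

/-- The vector `ν`: the common value of `[Ā; A]ᵀ z + ∇f₀(x) - τ x` over all `z ∈ Ω`. -/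
def ν (x : Vec (Fin d)) : Vec (Fin d) :=
  Classical.epsilon fun v => ∀ z ∈ S.Ω x, S.dualResidual x z = v

/-- The acceptance criterion for the inexact dual solution: `z₁ ∈ dom g⋆`, `dist(z, Ω) ≤ μ`. -/
def Accepts (x : Vec (Fin d)) (μ : ℝ) (z : Vec (Fin nb ⊕ Fin n)) : Prop :=
  fstBlock z ∈ dom (conj S.g) ∧ Metric.infEDist z (S.Ω x) ≤ ENNReal.ofReal μ

/-! ### The inner solver: restarted accelerated proximal gradient (APG) method -/

/-- The Lipschitz constant of the gradient of the smooth part of `𝒟`. -/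
def LD : ℝ := lamMax S.H / S.τ

/-- The state of the APG method: main iterate, auxiliary iterate, momentum parameter. -/
structure APGState (nb n : ℕ) where
  z : Vec (Fin nb ⊕ Fin n)
  zhat : Vec (Fin nb ⊕ Fin n)
  α : ℝ

/-- One APG step. -/
def apgStep (x : Vec (Fin d)) (s : APGState nb n) : APGState nb n :=
  let r := S.dualResidual x s.zhat
  let G₁ := (1 / S.τ) • mul S.Abar r - S.bbar
  let G₂ := (1 / S.τ) • mul S.A r - S.b
  let z' := join (prox (1 / S.LD) (conj S.g) (fstBlock s.zhat - (1 / S.LD) • G₁))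
    (sndBlock s.zhat - (1 / S.LD) • G₂)
  let α' := (1 + √(1 + 4 * s.α ^ 2)) / 2
  ⟨z', z' + ((s.α - 1) / α') • (z' - s.z), α'⟩

/-- `j` APG steps started afresh at `z`. -/
def apgCycle (x : Vec (Fin d)) (j : ℕ) (z : Vec (Fin nb ⊕ Fin n)) : Vec (Fin nb ⊕ Fin n) :=
  ((S.apgStep x)^[j] ⟨z, z, 1⟩).z

/-- The restarted APG method from `z^ini`: `i` cycles of `j` steps, hence `i * j` APG steps. -/
def restartedAPG (x : Vec (Fin d)) (i j : ℕ) : Vec (Fin nb ⊕ Fin n) :=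
  (S.apgCycle x j)^[i] S.zini

/-! ### The outer method -/

def B₁ : ℝ :=
  1 / S.τ * specNorm S.Abar * specNorm S.H + S.σ⁻¹
    + 1 / S.τ * (specNorm S.Abar + specNorm S.A) * specNorm S.H

/-- `‖(A Aᵀ)⁻¹ A‖`. -/
def pinvNorm : ℝ := specNorm ((S.A * S.A.transpose)⁻¹ * S.A)

def B₂ : ℝ := 1 + S.pinvNorm * specNorm S.H

def B₃ (x : Vec (Fin d)) : ℝ :=
  S.pinvNorm * (‖gradient S.f₀ x‖ + specNorm S.Abar * S.lg)

def B₄ (x : Vec (Fin d)) : ℝ :=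
  1 / S.τ * (‖gradient S.f₀ x‖ + specNorm S.H * (S.lg + S.B₃ x))

/-- The inner accuracy `μ̃` at the outer iterate `x`. -/
def muTilde (ε : ℝ) (x : Vec (Fin d)) : ℝ :=
  min (min (ε / (S.B₁ * S.σ)) (ε / S.B₁))
    (min (ε ^ 2 / (12 * S.Lf * S.B₁ * (S.B₃ x + S.σ * specNorm S.Abar * S.B₄ x + S.lg)))
      (√(ε ^ 2 / (12 * S.Lf * S.B₁ * S.B₂ *
        (1 + 1 / S.τ * S.σ * specNorm S.Abar * specNorm S.H)))))

/-- The parameters of a run: `μ_k = w_k μ̃_k`; the cycle length `j_k` of the inner solver; and the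
quadratic growth constant `ρ_k`, which determines the number `i_k` of cycles. The last two are
functions of the outer iterate `x^(k)`. -/
structure Params (d : ℕ) where
  w : ℕ → ℝ
  j : Vec (Fin d) → ℕ
  ρ : Vec (Fin d) → ℝ

variable (P : Params d) (ε : ℝ)

/-- `μ_k` when the `k`-th outer iterate is `x`. -/
def mu (k : ℕ) (x : Vec (Fin d)) : ℝ := P.w k * S.muTilde ε x

/-- `i_k = ⌈log₂ (2 (𝒟_k(z^ini) - 𝒟_k^*) / (ρ_k μ_k²))⌉` (or `0` if this is negative). -/
def numCycles (k : ℕ) (x : Vec (Fin d)) : ℕ :=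
  ⌈Real.logb 2 (2 * S.gap x / (P.ρ x * S.mu P ε k x ^ 2))⌉₊

/-- `z^(k+1)`, computed by the inner solver when the `k`-th outer iterate is `x`. -/
def zNext (k : ℕ) (x : Vec (Fin d)) : Vec (Fin nb ⊕ Fin n) :=
  S.restartedAPG x (S.numCycles P ε k x) (P.j x)

/-- The outer iterates `(x^(k), y^(k))`. -/
def iter : ℕ → Vec (Fin d) × Vec (Fin nb)
  | 0 => (S.x0, S.y0)
  | k + 1 =>
    let x := (iter k).1
    let z := S.zNext P ε k x
    let x' := x - (1 / S.τ) • (mul S.Abar.transpose (fstBlock z)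
      + mul S.A.transpose (sndBlock z) + gradient S.f₀ x)
    (x', prox S.σ⁻¹ S.g (S.σ⁻¹ • fstBlock z + mul S.Abar x' + S.bbar))

/-- The total number of APG steps during the first `K` outer iterations. -/
def totalSteps (K : ℕ) : ℕ :=
  ∑ k ∈ Finset.range K, S.numCycles P ε k (S.iter P ε k).1 * P.j (S.iter P ε k).1

/-- After `K` outer iterations, in each of which the inner solver met the acceptance criterion,
the method has reached an `ε`-KKT point of the split problem. -/
def SolvedAt (K : ℕ) : Prop :=
  (∀ k < K, S.Accepts (S.iter P ε k).1 (S.mu P ε k (S.iter P ε k).1)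
    (S.zNext P ε k (S.iter P ε k).1)) ∧
  S.IsKKT ε (S.iter P ε K).1 (S.iter P ε K).2

/-- The range of accuracies. -/
def Admissible : Prop := 0 < ε ∧ ε < min (√(3 * S.Lf)) 1

/-- `K_ε = ⌈12 L_f Δ_F ε⁻²⌉`. -/
def Kε : ℕ := ⌈12 * S.Lf * S.ΔF / ε ^ 2⌉₊

/-- The method finds an `ε`-KKT point for every admissible `ε`. -/
def FindsKKT : Prop := ∀ ε, S.Admissible ε → ∃ K, S.SolvedAt P ε K

/-- The method finds an `ε`-KKT point for every admissible `ε` within `O(Q log(M/ε) L_f Δ_F ε⁻²)`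
APG steps. The constant `cst` in front is uniform; the other parameters of the problem enter only
through the constant `B` inside the logarithm and through the threshold `ε₀`. -/
def SolvesWithin (cst Q M : ℝ) : Prop :=
  ∃ B ≥ (1 : ℝ), ∃ ε₀ > (0 : ℝ), ∀ ε, S.Admissible ε → ∃ K, S.SolvedAt P ε K ∧
    (S.totalSteps P ε K : ℝ) ≤ cst * Q * Real.log (B / ε) * S.Kε ε ∧
    (ε ≤ ε₀ → (S.totalSteps P ε K : ℝ) ≤
      cst * Q * Real.log (M / ε) * (S.Lf * S.ΔF / ε ^ 2))

/-! ### The parameter choices and the Hoffman constants -/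

/-- Full row rank of `[Ā; A]`: `j_k = ⌈2√2 κ([Ā; A])⌉`, `ρ_k = λ⁺_min([Ā; A][Ā; A]ᵀ) / τ`,
`μ_k = μ̃_k`. -/
def fullRankParams : Params d where
  w := fun _ => 1
  j := fun _ => ⌈2 * √2 * condNumber S.H⌉₊
  ρ := fun _ => lamMinPos S.H / S.τ

open Classical in
/-- The quadratic growth constant in the polyhedral case. -/
def ρPoly (θ : ℝ) (x : Vec (Fin d)) : ℝ :=
  if S.bbar = 0 ∧ S.b = 0 then (θ ^ 2 * S.τ)⁻¹
  else (θ ^ 2 * (S.τ + S.gap x + 2 * ‖S.ν x‖ ^ 2 / S.τ))⁻¹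

/-- Polyhedral `g`: `j_k = ⌈2 √(2 L_𝒟 / ρ_k)⌉` and `μ_k = w_k μ̃_k`. -/
def polyParams (θ : ℝ) (w : ℕ → ℝ) : Params d where
  w := w
  j := fun x => ⌈2 * √(2 * S.LD / S.ρPoly θ x)⌉₊
  ρ := S.ρPoly θ

/-- The matrix `[C, 0]`, so that `[C, 0] z = C z₁`. -/
def ineqMatrix {m : ℕ} (C : Matrix (Fin m) (Fin nb) ℝ) : Matrix (Fin m) (Fin nb ⊕ Fin n) ℝ :=
  Matrix.fromCols C 0

/-- `θ(Ā, A, C)`: Hoffman constant of the system `[Ā; A]ᵀ z = r`, `C z₁ ≤ s`. -/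
def IsHoffman {m : ℕ} (C : Matrix (Fin m) (Fin nb) ℝ) (θ : ℝ) : Prop :=
  IsHoffmanConstant S.H.transpose (ineqMatrix (n := n) C) θ

/-- `θ(Ā, A, b̄, b, C)`: Hoffman constant of the system `[Ā; A]ᵀ z = r`,
`-z₁ᵀ b̄ - z₂ᵀ b = t`, `C z₁ ≤ s`. -/
def IsHoffmanAffine {m : ℕ} (C : Matrix (Fin m) (Fin nb) ℝ) (θ : ℝ) : Prop :=
  IsHoffmanConstant
    (Matrix.fromRows S.H.transpose (Matrix.of fun (_ : Unit) i => -Sum.elim S.bbar S.b i))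
    (ineqMatrix (n := n) C) θ

/-- `‖ν^(k)‖² ≤ B₅` and `𝒟_k(z^ini) - 𝒟_k^* ≤ B₆` for all `k < K_ε` and all admissible `ε`. -/
def BoundsRun (B₅ B₆ : ℝ) : Prop :=
  ∀ ε, S.Admissible ε → ∀ k < S.Kε ε,
    ‖S.ν (S.iter P ε k).1‖ ^ 2 ≤ B₅ ∧ S.gap (S.iter P ε k).1 ≤ B₆

end Setup

end PGRPD

end

set_option linter.unusedSectionVars false

/-! Each outer iteration minimizes, over `A u + b = 0`, the linearization of `f₀` at `x^(k)` plus
`τ/2 ‖u - x^(k)‖²` plus `g(Ā u + b̄)`. Every dual solution `w ∈ Ω_k` produces the exact minimizer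
`primal x^(k) w`, and a dual point at distance at most `μ_k` from `Ω_k` produces a point within `‖H‖
μ_k / τ` of it. The argument follows the feasible sequence of exact minimizers (`ExactIterates`) and
treats the computed iterates as perturbations.

Outer loop. Strong convexity of the model and the two-sided descent lemma give a decrease of `L_f
(3/2 V² - errors)`, where `V` is the distance of consecutive exact points (`primalVal_descent`).
Conversely the KKT residual is small as soon as `V` is (`isKKT_of_short_step`). Hence an iterate
that is not `ε`-KKT forces `V` to be of order `ε / L_f` and costs a fixed multiple of `ε² / L_f` of
the objective, which bounds the number of iterations by a multiple of `L_f Δ_F / ε²`. The error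
component in the range of `Aᵀ` is harmless twice: it is orthogonal to differences of feasible
points, and `γ₂` absorbs it in the stationarity residual.

Inner loop. The FISTA Lyapunov function together with quadratic growth of the dual objective on its
initial level set makes each cycle halve the gap (`apgCycle_le`, `accepts_of_growth`). Growth in `Hᵀ
z` is automatic (`dual_growth`). Growth in `z` follows from the smallest eigenvalue of `H Hᵀ` under
full row rank. For polyhedral `g` the conjugate is an indicator function, and a Hoffman constant
turns residuals into distances (`growth_homogeneous`, `growth_affine`).

Counting. The outer iterates grow at most linearly in `k`, so all data of a run are polynomial in
`1/ε` (`exists_run_bounds`) and the number of cycles is logarithmic. Accuracies above a threshold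
`ε₀` are absorbed into `B` (`solvesWithin`). In (c) the summable weights `1/(k+1)²` keep the exact
points in the compact level set; since `B₅`, `B₆` only cover `k < K_ε`, it must also be shown that
`K_ε` iterations suffice (`firstKKT_le_Kε`). -/

namespace PGRPD

/-! ### Hoffman's error bound from Farkas' lemma and Carathéodory's theorem. -/

section Hoffman

/-- **Farkas' lemma** for finitely many linear functionals. -/
theorem exists_nonneg_combination_of_implies {E ι : Type*} [AddCommGroup E] [Module ℝ E]
    (J : Finset ι) (a : ι → E →ₗ[ℝ] ℝ) (v : E →ₗ[ℝ] ℝ)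
    (h : ∀ d, (∀ j ∈ J, a j d ≤ 0) → v d ≤ 0) :
    ∃ l : ι → ℝ, (∀ j ∈ J, 0 ≤ l j) ∧ v = ∑ j ∈ J, l j • a j := by
  classical
  induction J using Finset.induction_on generalizing a v with
  | empty =>
    refine ⟨0, by simp, ?_⟩
    ext d
    have h1 := h d (by simp)
    have h2 := h (-d) (by simp)
    simp only [map_neg] at h2
    simpa using le_antisymm h1 (by linarith)
  | insert i J hi ih =>
    by_cases hv : ∀ d, (∀ j ∈ J, a j d ≤ 0) → v d ≤ 0
    · obtain ⟨l, hl, hvl⟩ := ih a v hv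
      refine ⟨fun j => if j = i then 0 else l j, fun j hj => ?_, ?_⟩
      · by_cases hji : j = i
        · simp [hji]
        · simpa [hji] using hl j ((Finset.mem_insert.1 hj).resolve_left hji)
      · rw [Finset.sum_insert hi, hvl]
        simp only [if_true, zero_smul, zero_add]
        refine Finset.sum_congr rfl fun j hj => ?_
        rw [if_neg (by rintro rfl; exact hi hj)]
    · push Not at hv
      obtain ⟨d₀, hd₀, hvd₀⟩ := hv
      have hid₀ : 0 < a i d₀ := by
        by_contra hc
        push Not at hc
        refine absurd (h d₀ fun j hj => ?_) (not_le.2 hvd₀)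
        rcases Finset.mem_insert.1 hj with rfl | hj
        · exact hc
        · exact hd₀ j hj
      -- With `a i e = 1`, the map `d ↦ d - (a i d) • e` projects onto the kernel of `a i`.
      -- Composing all functionals with it removes the constraint `i`, so the induction hypothesis
      -- applies.
      set e : E := (a i d₀)⁻¹ • d₀ with he
      have hie : a i e = 1 := by simp [he, hid₀.ne']
      have hje : ∀ j ∈ J, a j e ≤ 0 := fun j hj => by
        simpa [he] using mul_nonpos_of_nonneg_of_nonpos (inv_nonneg.2 hid₀.le) (hd₀ j hj)
      have hve : 0 ≤ v e := by
        simpa [he] using mul_nonneg (inv_nonneg.2 hid₀.le) hvd₀.le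
      obtain ⟨l, hl, hvl⟩ := ih (fun j => a j - a j e • a i) (v - v e • a i) (by
        intro d hd
        have := h (d - a i d • e) (by
          intro j hj
          rcases Finset.mem_insert.1 hj with rfl | hj
          · simp [hie]
          · have := hd j hj
            simp only [LinearMap.sub_apply, LinearMap.smul_apply, smul_eq_mul] at this
            simp only [map_sub, map_smul, smul_eq_mul]
            linarith)
        simp only [map_sub, map_smul, smul_eq_mul] at this
        simp only [LinearMap.sub_apply, LinearMap.smul_apply, smul_eq_mul]
        linarith)
      -- The coefficient of `a i` is forced by evaluation at `e`. It is nonnegative because `v e ≥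
      -- 0` while `a j e ≤ 0` on `J`.
      refine ⟨fun j => if j = i then v e - ∑ j ∈ J, l j * a j e else l j, fun j hj => ?_, ?_⟩
      · by_cases hji : j = i
        · subst hji
          simp only [if_true]
          have : ∑ k ∈ J, l k * a k e ≤ 0 :=
            Finset.sum_nonpos fun k hk => mul_nonpos_of_nonneg_of_nonpos (hl k hk) (hje k hk)
          linarith
        · simpa [hji] using hl j ((Finset.mem_insert.1 hj).resolve_left hji)
      · rw [Finset.sum_insert hi]
        have : ∑ j ∈ J, (if j = i then v e - ∑ j ∈ J, l j * a j e else l j) • a j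
            = ∑ j ∈ J, l j • a j :=
          Finset.sum_congr rfl fun j hj => by rw [if_neg (by rintro rfl; exact hi hj)]
        rw [this]
        simp only [if_true]
        ext d
        have hd := LinearMap.congr_fun hvl d
        simp only [LinearMap.sub_apply, LinearMap.smul_apply, smul_eq_mul, LinearMap.sum_apply,
          LinearMap.add_apply] at hd ⊢
        have h3 : ∑ x ∈ J, l x * (a x d - a x e * a i d)
            = ∑ x ∈ J, l x * a x d - (∑ x ∈ J, l x * a x e) * a i d := by
          rw [Finset.sum_mul, ← Finset.sum_sub_distrib]
          exact Finset.sum_congr rfl fun x _ => by ring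
        rw [h3] at hd
        linarith

/-- **Carathéodory's theorem** for finitely generated cones in quantitative form: the coefficients
can be bounded by the norm of the vector. -/
theorem exists_bounded_conic_combination {E ι : Type*} [NormedAddCommGroup E] [NormedSpace ℝ E]
    (a : ι → E) (J : Finset ι) :
    ∃ c : ℝ, 0 ≤ c ∧ ∀ l : ι → ℝ, (∀ j ∈ J, 0 ≤ l j) →
      ∃ l' : ι → ℝ, (∀ j ∈ J, 0 ≤ l' j) ∧ ∑ j ∈ J, l' j • a j = ∑ j ∈ J, l j • a j ∧
        ∑ j ∈ J, l' j ≤ c * ‖∑ j ∈ J, l j • a j‖ := by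
  classical
  induction J using Finset.strongInduction with
  | H J ih =>
    by_cases hli : LinearIndependent ℝ (fun j : J => a j)
    · obtain ⟨K, hK, hA⟩ := LinearMap.exists_antilipschitzWith
        (Fintype.linearCombination ℝ (fun j : J => a j))
        (LinearMap.ker_eq_bot.2 (hli.fintypeLinearCombination_injective))
      refine ⟨J.card * K, by positivity, fun l hl => ⟨l, hl, rfl, ?_⟩⟩
      have h1 := hA.le_mul_dist (fun j : J => l j) 0
      rw [map_zero, dist_zero_right, dist_zero_right, Fintype.linearCombination_apply,
        Finset.sum_coe_sort J (fun j => l j • a j)] at h1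
      calc ∑ j ∈ J, l j ≤ ∑ j ∈ J, ‖fun j : J => l j‖ := Finset.sum_le_sum fun j hj =>
            (le_abs_self _).trans (norm_le_pi_norm (fun j : J => l j) ⟨j, hj⟩)
        _ = J.card * ‖fun j : J => l j‖ := by simp
        _ ≤ J.card * (K * ‖∑ j ∈ J, l j • a j‖) := by gcongr
        _ = _ := by ring
    · obtain ⟨m, hm0, i₀, hi₀, hmi₀⟩ : ∃ m : ι → ℝ, ∑ j ∈ J, m j • a j = 0 ∧
          ∃ i ∈ J, 0 < m i := by
        rw [Fintype.linearIndependent_iff] at hli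
        push Not at hli
        obtain ⟨m, hm, i, hi⟩ := hli
        set m' : ι → ℝ := fun j => if h : j ∈ J then m ⟨j, h⟩ else 0 with hm'
        have hs : ∑ j ∈ J, m' j • a j = 0 := by
          rw [← Finset.sum_coe_sort, ← hm]
          exact Finset.sum_congr rfl fun j _ => by simp [hm']
        have hmi : m' i = m i := by simp [hm']
        rcases lt_or_gt_of_ne hi with h | h
        · exact ⟨fun j => -m' j, by simpa using hs, i, i.2, by simpa [hmi] using h⟩
        · exact ⟨m', hs, i, i.2, by rwa [hmi]⟩
      choose! c hc0 hc using fun i (hi : i ∈ J) => ih (J.erase i) (Finset.erase_ssubset hi)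
      refine ⟨∑ i ∈ J, c i, Finset.sum_nonneg hc0, fun l hl => ?_⟩
      -- Subtracting the linear relation `m`, scaled by the smallest ratio `l j / m j` with `m j >
      -- 0`, keeps all coefficients nonnegative and kills the one at `i`. The sum of the constants
      -- of all `J.erase i` covers whichever index drops out.
      obtain ⟨i, hi, hmin⟩ := Finset.exists_min_image (J.filter fun j => 0 < m j)
        (fun j => l j / m j) ⟨i₀, by simp [hi₀, hmi₀]⟩
      obtain ⟨hiJ, hmi⟩ := Finset.mem_filter.1 hi
      have hnn : ∀ j ∈ J, 0 ≤ l j - l i / m i * m j := fun j hj => by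
        rcases le_or_gt (m j) 0 with h | h
        · have := mul_nonpos_of_nonneg_of_nonpos (div_nonneg (hl i hiJ) hmi.le) h
          linarith [hl j hj]
        · have := hmin j (by simp [hj, h])
          rw [le_div_iff₀ h] at this
          linarith
      have hsum : ∑ j ∈ J.erase i, (l j - l i / m i * m j) • a j = ∑ j ∈ J, l j • a j := by
        rw [Finset.sum_erase _ (by rw [div_mul_cancel₀ _ hmi.ne']; simp)]
        simp only [sub_smul, mul_smul, Finset.sum_sub_distrib, ← Finset.smul_sum, hm0]
        simp
      obtain ⟨l', h1, h2, h3⟩ := hc i hiJ (fun j => l j - l i / m i * m j)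
        fun j hj => hnn j (Finset.mem_of_mem_erase hj)
      rw [hsum] at h2 h3
      refine ⟨Function.update l' i 0, fun j hj => ?_, ?_, ?_⟩
      · by_cases hji : j = i
        · simp [hji]
        · simpa [hji] using h1 j (Finset.mem_erase.2 ⟨hji, hj⟩)
      · rw [← h2, ← Finset.sum_erase J (a := i) (by simp)]
        exact Finset.sum_congr rfl fun j hj => by simp [(Finset.mem_erase.1 hj).1]
      · rw [← Finset.sum_erase J (a := i) (by simp)]
        calc _ = ∑ j ∈ J.erase i, l' j :=
              Finset.sum_congr rfl fun j hj => by simp [(Finset.mem_erase.1 hj).1]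
          _ ≤ c i * ‖∑ j ∈ J, l j • a j‖ := h3
          _ ≤ _ := by
            gcongr
            exact Finset.single_le_sum hc0 hiJ

/-- **Hoffman's error bound** for systems of finitely many linear inequalities. -/
theorem exists_error_bound_of_inequalities {E ι : Type*} [NormedAddCommGroup E]
    [InnerProductSpace ℝ E] [FiniteDimensional ℝ E] [Fintype ι] (a : ι → E) :
    ∃ c : ℝ, 0 ≤ c ∧ ∀ s : ι → ℝ, {z : E | ∀ i, ⟪a i, z⟫_ℝ ≤ s i}.Nonempty →
      ∀ (z : E) (R : ℝ), 0 ≤ R → (∀ i, max (⟪a i, z⟫_ℝ - s i) 0 ≤ R) →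
        Metric.infDist z {z : E | ∀ i, ⟪a i, z⟫_ℝ ≤ s i} ≤ c * R := by
  classical
  choose c hc0 hc using fun J : Finset ι => exists_bounded_conic_combination a J
  refine ⟨∑ J : Finset ι, c J, Finset.sum_nonneg fun J _ => hc0 J, fun s hne z R hR0 hR => ?_⟩
  set K : Set E := {z : E | ∀ i, ⟪a i, z⟫_ℝ ≤ s i} with hK
  have hclosed : IsClosed K := by
    simp only [hK, Set.ofPred_forall]
    exact isClosed_iInter fun i => isClosed_le (by fun_prop) continuous_const
  have hconv : Convex ℝ K := by
    intro x hx y hy α β hα hβ hαβ i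
    rw [inner_add_right, inner_smul_right, inner_smul_right]
    calc _ ≤ α * s i + β * s i := by gcongr <;> [exact hx i; exact hy i]
      _ = s i := by rw [← add_mul, hαβ, one_mul]
  obtain ⟨p, hp, hpd⟩ := exists_norm_eq_iInf_of_complete_convex hne hclosed.isComplete hconv z
  have hvar := (norm_eq_iInf_iff_real_inner_le_zero hconv hp).1 hpd
  set J : Finset ι := Finset.univ.filter fun i => ⟪a i, p⟫_ℝ = s i with hJ
  -- `z - p` lies in the normal cone of `K` at the projection `p`: a direction that is nonpositive
  -- on the active constraints can be followed a short way inside `K`. Farkas then writes `z - p` as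
  -- a conic combination of active rows.
  obtain ⟨l, hl, hv⟩ := exists_nonneg_combination_of_implies J (fun i => innerₗ E (a i))
    (innerₗ E (z - p)) (by
      intro d hd
      have hev : ∀ᶠ t : ℝ in nhdsWithin 0 (Set.Ioi 0), ∀ i, ⟪a i, p + t • d⟫_ℝ ≤ s i := by
        rw [Filter.eventually_all]
        intro i
        by_cases hi : ⟪a i, p⟫_ℝ = s i
        · filter_upwards [self_mem_nhdsWithin] with t ht
          have := hd i (by simp [hJ, hi])
          simp only [innerₗ_apply_apply] at this
          rw [inner_add_right, inner_smul_right, hi]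
          have := mul_nonpos_of_nonneg_of_nonpos (le_of_lt ht) this
          linarith
        · have hlt : ⟪a i, p⟫_ℝ < s i := lt_of_le_of_ne (hp i) hi
          have hcont : Continuous fun t : ℝ => ⟪a i, p + t • d⟫_ℝ := by fun_prop
          have : ∀ᶠ t : ℝ in nhds 0, ⟪a i, p + t • d⟫_ℝ < s i :=
            hcont.continuousAt.eventually_lt continuousAt_const (by simpa using hlt)
          exact (this.filter_mono nhdsWithin_le_nhds).mono fun t ht => ht.le
      obtain ⟨t, ht, htpos⟩ := (hev.and self_mem_nhdsWithin).exists
      have := hvar _ ht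
      rw [add_sub_cancel_left, inner_smul_right] at this
      exact nonpos_of_mul_nonpos_right this htpos)
  have hv' : z - p = ∑ j ∈ J, l j • a j := by
    refine ext_inner_right ℝ fun w => ?_
    have := LinearMap.congr_fun hv w
    simpa [sum_inner, inner_smul_left, inner_sub_left] using this
  obtain ⟨l', hl', hsum, hbd⟩ := hc J l hl
  rw [← hv'] at hsum hbd
  -- Pairing the conic combination with `z - p` replaces each active row by its violation at `z`,
  -- since `⟪a j, p⟫ = s j`.
  have hkey : ‖z - p‖ ^ 2 ≤ c J * ‖z - p‖ * R := by
    have h1 : ‖z - p‖ ^ 2 = ∑ j ∈ J, l' j * ⟪a j, z - p⟫_ℝ := by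
      rw [← real_inner_self_eq_norm_sq]
      nth_rewrite 1 [← hsum]
      simp [sum_inner, inner_smul_left]
    have h2 : ∑ j ∈ J, l' j * ⟪a j, z - p⟫_ℝ ≤ ∑ j ∈ J, l' j * R := by
      refine Finset.sum_le_sum fun j hj => mul_le_mul_of_nonneg_left ?_ (hl' j hj)
      rw [inner_sub_right, (Finset.mem_filter.1 hj).2]
      exact (le_max_left _ _).trans (hR j)
    rw [h1]
    refine h2.trans ?_
    rw [← Finset.sum_mul]
    exact mul_le_mul_of_nonneg_right hbd hR0
  have hd : ‖z - p‖ ≤ c J * R := by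
    rcases eq_or_lt_of_le (norm_nonneg (z - p)) with h | h
    · rw [← h]; exact mul_nonneg (hc0 J) hR0
    · nlinarith
  calc Metric.infDist z K ≤ dist z p := Metric.infDist_le_dist_of_mem hp
    _ = ‖z - p‖ := dist_eq_norm _ _
    _ ≤ c J * R := hd
    _ ≤ _ := by
      gcongr
      exact Finset.single_le_sum (fun J _ => hc0 J) (Finset.mem_univ J)

end Hoffman
end PGRPD

namespace PGRPD

/-! ### Matrix-vector calculus, spectral bounds and existence of Hoffman constants. -/

section MatrixVector

variable {ι κ l : Type} [Fintype ι] [Fintype κ] [Fintype l]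

theorem inner_eq_sum (u v : Vec ι) : ⟪u, v⟫_ℝ = ∑ i, u i * v i := by
  simp [PiLp.inner_apply, mul_comm]

variable [DecidableEq ι] [DecidableEq κ] [DecidableEq l]

theorem mul_eq (M : Matrix ι κ ℝ) (v : Vec κ) : mul M v = WithLp.toLp 2 (M.mulVec v.ofLp) := rfl

theorem mul_apply (M : Matrix ι κ ℝ) (v : Vec κ) (i : ι) :
    mul M v i = ⟪WithLp.toLp 2 (M i), v⟫_ℝ := by
  rw [inner_eq_sum]; rfl

theorem inner_mul_transpose (M : Matrix ι κ ℝ) (u : Vec ι) (v : Vec κ) :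
    ⟪mul M.transpose u, v⟫_ℝ = ⟪u, mul M v⟫_ℝ := by
  rw [inner_eq_sum, inner_eq_sum]
  change (M.transpose.mulVec u.ofLp) ⬝ᵥ v.ofLp = u.ofLp ⬝ᵥ (M.mulVec v.ofLp)
  rw [Matrix.mulVec_transpose, Matrix.dotProduct_mulVec]

theorem mul_mul (M : Matrix ι κ ℝ) (N : Matrix κ l ℝ) (v : Vec l) :
    mul (M * N) v = mul M (mul N v) := by
  simp [mul_eq, Matrix.mulVec_mulVec]

theorem mul_one' (v : Vec ι) : mul (1 : Matrix ι ι ℝ) v = v := by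
  simp [mul_eq]

theorem norm_mul_le (M : Matrix ι κ ℝ) (v : Vec κ) : ‖mul M v‖ ≤ specNorm M * ‖v‖ :=
  (mul M).le_opNorm v

theorem specNorm_nonneg (M : Matrix ι κ ℝ) : 0 ≤ specNorm M := norm_nonneg _

theorem specNorm_pos {M : Matrix ι κ ℝ} (hM : M ≠ 0) : 0 < specNorm M := by
  refine norm_pos_iff.2 fun h => hM ?_
  have : Matrix.toEuclideanLin M = 0 := by
    ext v : 1
    exact DFunLike.congr_fun h v
  simpa using this

theorem norm_mul_transpose_le (M : Matrix ι κ ℝ) (u : Vec ι) :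
    ‖mul M.transpose u‖ ≤ specNorm M * ‖u‖ := by
  have h : ‖mul M.transpose u‖ ^ 2 ≤ specNorm M * ‖u‖ * ‖mul M.transpose u‖ := by
    rw [← real_inner_self_eq_norm_sq, inner_mul_transpose]
    calc _ ≤ ‖u‖ * ‖mul M (mul M.transpose u)‖ := real_inner_le_norm _ _
      _ ≤ ‖u‖ * (specNorm M * ‖mul M.transpose u‖) := by gcongr; exact norm_mul_le _ _
      _ = _ := by ring
  rcases eq_or_lt_of_le (norm_nonneg (mul M.transpose u)) with h0 | h0
  · rw [← h0]; exact mul_nonneg (specNorm_nonneg M) (norm_nonneg u)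
  · nlinarith

/-! ### Blocks -/

section Blocks

@[simp] theorem fstBlock_join (u : Vec ι) (v : Vec κ) : fstBlock (join u v) = u := rfl
@[simp] theorem sndBlock_join (u : Vec ι) (v : Vec κ) : sndBlock (join u v) = v := rfl
@[simp] theorem fstBlock_add (z w : Vec (ι ⊕ κ)) :
    fstBlock (z + w) = fstBlock z + fstBlock w := rfl
@[simp] theorem sndBlock_add (z w : Vec (ι ⊕ κ)) :
    sndBlock (z + w) = sndBlock z + sndBlock w := rfl
@[simp] theorem fstBlock_sub (z w : Vec (ι ⊕ κ)) :
    fstBlock (z - w) = fstBlock z - fstBlock w := rfl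
@[simp] theorem sndBlock_sub (z w : Vec (ι ⊕ κ)) :
    sndBlock (z - w) = sndBlock z - sndBlock w := rfl
@[simp] theorem fstBlock_smul (t : ℝ) (z : Vec (ι ⊕ κ)) :
    fstBlock (t • z) = t • fstBlock z := rfl
@[simp] theorem sndBlock_smul (t : ℝ) (z : Vec (ι ⊕ κ)) :
    sndBlock (t • z) = t • sndBlock z := rfl

theorem inner_blocks (z w : Vec (ι ⊕ κ)) :
    ⟪z, w⟫_ℝ = ⟪fstBlock z, fstBlock w⟫_ℝ + ⟪sndBlock z, sndBlock w⟫_ℝ := by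
  simp only [inner_eq_sum, Fintype.sum_sum_type]; rfl

theorem norm_sq_blocks (z : Vec (ι ⊕ κ)) :
    ‖z‖ ^ 2 = ‖fstBlock z‖ ^ 2 + ‖sndBlock z‖ ^ 2 := by
  simp only [← real_inner_self_eq_norm_sq, inner_blocks]

theorem norm_fstBlock_le (z : Vec (ι ⊕ κ)) : ‖fstBlock z‖ ≤ ‖z‖ := by
  have := norm_sq_blocks z
  exact le_of_sq_le_sq (by nlinarith [sq_nonneg ‖sndBlock z‖]) (norm_nonneg z)

theorem norm_sndBlock_le (z : Vec (ι ⊕ κ)) : ‖sndBlock z‖ ≤ ‖z‖ := by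
  have := norm_sq_blocks z
  exact le_of_sq_le_sq (by nlinarith [sq_nonneg ‖fstBlock z‖]) (norm_nonneg z)

theorem continuous_fstBlock : Continuous (fstBlock : Vec (ι ⊕ κ) → Vec ι) := by
  unfold fstBlock; fun_prop

theorem continuous_sndBlock : Continuous (sndBlock : Vec (ι ⊕ κ) → Vec κ) := by
  unfold sndBlock; fun_prop

end Blocks

theorem mul_fromRows (M : Matrix ι l ℝ) (N : Matrix κ l ℝ) (v : Vec l) :
    mul (Matrix.fromRows M N) v = join (mul M v) (mul N v) := by
  ext i; cases i <;> simp [mul_eq, join, Matrix.fromRows_mulVec]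

theorem mul_fromRows_transpose (M : Matrix ι l ℝ) (N : Matrix κ l ℝ) (z : Vec (ι ⊕ κ)) :
    mul (Matrix.fromRows M N).transpose z
      = mul M.transpose (fstBlock z) + mul N.transpose (sndBlock z) := by
  ext i
  simp only [mul_eq, Matrix.mulVec, dotProduct, Fintype.sum_sum_type, PiLp.add_apply,
    Matrix.transpose_apply, Matrix.fromRows_apply_inl, Matrix.fromRows_apply_inr]
  rfl

theorem mul_fromCols (M : Matrix l ι ℝ) (N : Matrix l κ ℝ) (z : Vec (ι ⊕ κ)) :
    mul (Matrix.fromCols M N) z = mul M (fstBlock z) + mul N (sndBlock z) := by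
  ext i
  simp only [mul_eq, Matrix.mulVec, dotProduct, Fintype.sum_sum_type, PiLp.add_apply,
    Matrix.fromCols_apply_inl, Matrix.fromCols_apply_inr]
  rfl

section SpecNormBlocks

theorem specNorm_le_fromRows_left (M : Matrix ι l ℝ) (N : Matrix κ l ℝ) :
    specNorm M ≤ specNorm (Matrix.fromRows M N) := by
  refine ContinuousLinearMap.opNorm_le_bound _ (specNorm_nonneg _) fun v => ?_
  refine le_trans ?_ (norm_mul_le _ v)
  rw [mul_fromRows]
  exact norm_fstBlock_le (join (mul M v) (mul N v))

theorem specNorm_le_fromRows_right (M : Matrix ι l ℝ) (N : Matrix κ l ℝ) :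
    specNorm N ≤ specNorm (Matrix.fromRows M N) := by
  refine ContinuousLinearMap.opNorm_le_bound _ (specNorm_nonneg _) fun v => ?_
  refine le_trans ?_ (norm_mul_le _ v)
  rw [mul_fromRows]
  exact norm_sndBlock_le (join (mul M v) (mul N v))

theorem specNorm_fromRows_sq_le (M : Matrix ι l ℝ) (N : Matrix κ l ℝ) :
    specNorm (Matrix.fromRows M N) ^ 2 ≤ specNorm M ^ 2 + specNorm N ^ 2 := by
  have h : specNorm (Matrix.fromRows M N) ≤ √(specNorm M ^ 2 + specNorm N ^ 2) := by
    refine ContinuousLinearMap.opNorm_le_bound _ (Real.sqrt_nonneg _) fun v => ?_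
    refine abs_le_of_sq_le_sq' ?_ (by positivity) |>.2
    rw [mul_fromRows, norm_sq_blocks, mul_pow, Real.sq_sqrt (by positivity), add_mul, ← mul_pow,
      ← mul_pow]
    simp only [fstBlock_join, sndBlock_join]
    gcongr <;> exact norm_mul_le _ _
  calc _ ≤ √(specNorm M ^ 2 + specNorm N ^ 2) ^ 2 := by
        gcongr; exact specNorm_nonneg _
    _ = _ := Real.sq_sqrt (by positivity)

end SpecNormBlocks

/-! ### Extreme eigenvalues of `M Mᵀ` -/

theorem isHermitian_mul_transpose (M : Matrix ι κ ℝ) : (M * M.transpose).IsHermitian := by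
  simpa using Matrix.isHermitian_mul_conjTranspose_self M

/-- Diagonalization of `M Mᵀ` in an orthonormal eigenbasis; the bounds by extreme eigenvalues are
read off termwise. -/
theorem norm_mul_transpose_sq (M : Matrix ι κ ℝ) (z : Vec ι) :
    ‖mul M.transpose z‖ ^ 2 = ∑ i, (isHermitian_mul_transpose M).eigenvalues i *
      ⟪(isHermitian_mul_transpose M).eigenvectorBasis i, z⟫_ℝ ^ 2 := by
  set hG := isHermitian_mul_transpose M
  have h1 : ‖mul M.transpose z‖ ^ 2 = ⟪z, mul (M * M.transpose) z⟫_ℝ := by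
    rw [mul_mul, ← real_inner_self_eq_norm_sq, inner_mul_transpose]
  have hsymm : ∀ u v : Vec ι,
      ⟪mul (M * M.transpose) u, v⟫_ℝ = ⟪u, mul (M * M.transpose) v⟫_ℝ := by
    intro u v
    rw [← inner_mul_transpose]
    simp
  rw [h1, ← hG.eigenvectorBasis.sum_inner_mul_inner]
  refine Finset.sum_congr rfl fun i _ => ?_
  have h2 : mul (M * M.transpose) (hG.eigenvectorBasis i)
      = hG.eigenvalues i • hG.eigenvectorBasis i := by
    have := hG.mulVec_eigenvectorBasis i
    ext j
    exact congrFun this j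
  rw [← hsymm, h2, inner_smul_left, real_inner_comm]
  simp only [conj_trivial]
  ring

theorem lamMax_bddAbove (M : Matrix ι κ ℝ) : BddAbove (spectrum ℝ (M * M.transpose)) :=
  (Matrix.finite_real_spectrum (A := M * M.transpose)).bddAbove

theorem norm_mul_transpose_sq_le (M : Matrix ι κ ℝ) (z : Vec ι) :
    ‖mul M.transpose z‖ ^ 2 ≤ lamMax M * ‖z‖ ^ 2 := by
  rw [norm_mul_transpose_sq, ← (isHermitian_mul_transpose M).eigenvectorBasis.sum_sq_inner_right z,
    Finset.mul_sum]
  gcongr with i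
  exact le_csSup (lamMax_bddAbove M) ((isHermitian_mul_transpose M).eigenvalues_mem_spectrum_real i)

theorem exists_mul_transpose_ne_zero {M : Matrix ι κ ℝ} (hM : M ≠ 0) :
    ∃ z, mul M.transpose z ≠ 0 := by
  by_contra! h
  refine (specNorm_pos (M := M.transpose) (by simpa using hM)).ne' ?_
  have : mul M.transpose = 0 := by ext1 v; exact h v
  simp [specNorm, this]

theorem lamMax_pos {M : Matrix ι κ ℝ} (hM : M ≠ 0) : 0 < lamMax M := by
  obtain ⟨z, hz⟩ := exists_mul_transpose_ne_zero hM
  have h1 := norm_mul_transpose_sq_le M z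
  have h2 : 0 < ‖mul M.transpose z‖ ^ 2 := by positivity
  by_contra! h
  nlinarith [sq_nonneg ‖z‖]

theorem FullRowRank.eq_zero_of_mul_transpose {M : Matrix ι κ ℝ}
    (hM : FullRowRank M) {z : Vec ι} (hz : mul M.transpose z = 0) : z = 0 := by
  have h := Matrix.vecMul_injective_iff.2 hM
  have h2 : Matrix.vecMul z.ofLp M = Matrix.vecMul 0 M := by
    rw [← Matrix.mulVec_transpose, Matrix.zero_vecMul]
    exact congrArg WithLp.ofLp hz
  ext i
  exact congrFun (h h2) i

theorem FullRowRank.eigenvalues_pos {M : Matrix ι κ ℝ} (hM : FullRowRank M) (i : ι) :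
    0 < (isHermitian_mul_transpose M).eigenvalues i := by
  set hG := isHermitian_mul_transpose M
  have h := norm_mul_transpose_sq M (hG.eigenvectorBasis i)
  have hs : ∑ j, hG.eigenvalues j * ⟪hG.eigenvectorBasis j, hG.eigenvectorBasis i⟫_ℝ ^ 2
      = hG.eigenvalues i := by
    rw [Finset.sum_eq_single i]
    · simp
    · intro j _ hj; simp [hG.eigenvectorBasis.inner_eq_zero hj]
    · simp
  rw [hs] at h
  rw [← h]
  have : mul M.transpose (hG.eigenvectorBasis i) ≠ 0 := fun h0 =>
    hG.eigenvectorBasis.orthonormal.ne_zero i (hM.eq_zero_of_mul_transpose h0)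
  positivity

theorem lamMinPos_bddBelow (M : Matrix ι κ ℝ) :
    BddBelow {t | t ∈ spectrum ℝ (M * M.transpose) ∧ 0 < t} :=
  ⟨0, fun _ h => h.2.le⟩

/-- Under full row rank all eigenvalues of `M Mᵀ` are positive, so the smallest positive one is a
lower bound for all of them. -/
theorem FullRowRank.le_norm_mul_transpose_sq {M : Matrix ι κ ℝ} (hM : FullRowRank M) (z : Vec ι) :
    lamMinPos M * ‖z‖ ^ 2 ≤ ‖mul M.transpose z‖ ^ 2 := by
  rw [norm_mul_transpose_sq, ← (isHermitian_mul_transpose M).eigenvectorBasis.sum_sq_inner_right z,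
    Finset.mul_sum]
  gcongr with i
  exact csInf_le (lamMinPos_bddBelow M)
    ⟨(isHermitian_mul_transpose M).eigenvalues_mem_spectrum_real i, hM.eigenvalues_pos i⟩

theorem nonempty_of_ne_zero {M : Matrix ι κ ℝ} (hM : M ≠ 0) : Nonempty ι := by
  by_contra h
  rw [not_nonempty_iff] at h
  exact hM (Subsingleton.elim _ _)

theorem FullRowRank.lamMinPos_mem {M : Matrix ι κ ℝ} (hM : FullRowRank M) (h0 : M ≠ 0) :
    lamMinPos M ∈ {t | t ∈ spectrum ℝ (M * M.transpose) ∧ 0 < t} := by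
  obtain ⟨i⟩ := nonempty_of_ne_zero h0
  refine Set.Nonempty.csInf_mem ?_ ?_
  · exact ⟨_, (isHermitian_mul_transpose M).eigenvalues_mem_spectrum_real i, hM.eigenvalues_pos i⟩
  · exact (Matrix.finite_real_spectrum (A := M * M.transpose)).subset fun _ h => h.1

theorem FullRowRank.lamMinPos_pos {M : Matrix ι κ ℝ} (hM : FullRowRank M) (h0 : M ≠ 0) :
    0 < lamMinPos M := (hM.lamMinPos_mem h0).2

theorem FullRowRank.lamMinPos_le_lamMax {M : Matrix ι κ ℝ} (hM : FullRowRank M) (h0 : M ≠ 0) :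
    lamMinPos M ≤ lamMax M := le_csSup (lamMax_bddAbove M) (hM.lamMinPos_mem h0).1

theorem FullRowRank.one_le_condNumber {M : Matrix ι κ ℝ} (hM : FullRowRank M) (h0 : M ≠ 0) :
    1 ≤ condNumber M := by
  rw [condNumber, Real.one_le_sqrt, one_le_div (hM.lamMinPos_pos h0)]
  exact hM.lamMinPos_le_lamMax h0

/-- A matrix of full row rank has the right inverse `Mᵀ (M Mᵀ)⁻¹`. -/
theorem FullRowRank.one_le_pinv_mul [Nonempty ι] {M : Matrix ι κ ℝ} (hM : FullRowRank M) :
    1 ≤ specNorm ((M * M.transpose)⁻¹ * M) * specNorm M := by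
  have hinj : Function.Injective (M * M.transpose).mulVec := by
    rw [← Matrix.coe_mulVecLin, injective_iff_map_eq_zero]
    intro v hv
    have h1 : mul (M * M.transpose) (WithLp.toLp 2 v) = 0 := by
      ext i; exact congrFun hv i
    have h2 : mul M.transpose (WithLp.toLp 2 v) = 0 := by
      rw [mul_mul] at h1
      have h3 := inner_mul_transpose M (WithLp.toLp 2 v) (mul M.transpose (WithLp.toLp 2 v))
      rw [h1, inner_zero_right] at h3
      exact inner_self_eq_zero.1 h3
    have h3 := hM.eq_zero_of_mul_transpose h2
    ext i
    exact congrArg (fun w : Vec ι => w i) h3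
  have hu := Matrix.mulVec_injective_iff_isUnit.1 hinj
  have h1 : (M * M.transpose)⁻¹ * M * M.transpose = 1 := by
    rw [Matrix.mul_assoc]
    exact Matrix.nonsing_inv_mul _ ((Matrix.isUnit_iff_isUnit_det _).1 hu)
  obtain ⟨i⟩ := ‹Nonempty ι›
  set e : Vec ι := EuclideanSpace.single i 1
  have he : ‖e‖ = 1 := by simp [e]
  calc (1 : ℝ) = ‖mul ((M * M.transpose)⁻¹ * M) (mul M.transpose e)‖ := by
        rw [← mul_mul, h1, mul_one', he]
    _ ≤ specNorm ((M * M.transpose)⁻¹ * M) * ‖mul M.transpose e‖ := norm_mul_le _ _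
    _ ≤ specNorm ((M * M.transpose)⁻¹ * M) * (specNorm M * ‖e‖) := by
        gcongr
        · exact specNorm_nonneg _
        · exact norm_mul_transpose_le _ _
    _ = _ := by rw [he, mul_one]

/-! ### Hoffman constants -/

theorem le_sqrt_residual (M : Matrix κ ι ℝ) (N : Matrix l ι ℝ) (r : Vec κ) (s : Vec l)
    (z : Vec ι) :
    (∀ i, |mul M z i - r i| ≤ √(‖mul M z - r‖ ^ 2 + ∑ i, (max (mul N z i - s i) 0) ^ 2)) ∧
    ∀ i, max (mul N z i - s i) 0 ≤ √(‖mul M z - r‖ ^ 2 + ∑ i, (max (mul N z i - s i) 0) ^ 2) := by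
  have hs : 0 ≤ ∑ i, (max (mul N z i - s i) 0) ^ 2 := Finset.sum_nonneg fun i _ => sq_nonneg _
  constructor
  · intro i
    refine Real.le_sqrt_of_sq_le ?_
    rw [sq_abs]
    have h := PiLp.norm_apply_le (mul M z - r) i
    rw [PiLp.sub_apply, Real.norm_eq_abs] at h
    have := pow_le_pow_left₀ (abs_nonneg _) h 2
    rw [sq_abs] at this
    linarith
  · intro i
    refine Real.le_sqrt_of_sq_le ?_
    have := Finset.single_le_sum (f := fun i => (max (mul N z i - s i) 0) ^ 2)
      (fun i _ => sq_nonneg _) (Finset.mem_univ i)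
    have h2 := sq_nonneg ‖mul M z - r‖
    simp only at this
    linarith

/-- An equation is a pair of opposite inequalities, and each single violation is at most the
Euclidean residual. -/
theorem exists_isHoffmanConstant (M : Matrix κ ι ℝ) (N : Matrix l ι ℝ) :
    ∃ θ, IsHoffmanConstant M N θ := by
  let a : κ ⊕ κ ⊕ l → Vec ι := Sum.elim (fun i => WithLp.toLp 2 (M i))
    (Sum.elim (fun i => -WithLp.toLp 2 (M i)) fun i => WithLp.toLp 2 (N i))
  obtain ⟨c, hc, h⟩ := exists_error_bound_of_inequalities a
  refine ⟨c, fun r s hne z => ?_⟩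
  let t : κ ⊕ κ ⊕ l → ℝ := Sum.elim r (Sum.elim (fun i => -r i) s)
  have hset : {z : Vec ι | mul M z = r ∧ ∀ i, mul N z i ≤ s i} = {z | ∀ i, ⟪a i, z⟫_ℝ ≤ t i} := by
    ext z
    simp only [Set.mem_ofPred_eq, Sum.forall, a, t, Sum.elim_inl, Sum.elim_inr, inner_neg_left,
      ← mul_apply, neg_le_neg_iff]
    rw [← and_assoc]
    refine and_congr_left' ⟨fun h => by simp [h], fun h => ?_⟩
    ext i
    exact le_antisymm (h.1 i) (h.2 i)
  have hres := le_sqrt_residual M N r s z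
  rw [hset] at hne ⊢
  refine h t hne z _ (Real.sqrt_nonneg _) ?_
  simp only [Sum.forall, a, t, Sum.elim_inl, Sum.elim_inr, inner_neg_left, ← mul_apply]
  refine ⟨fun i => max_le ((le_abs_self _).trans (hres.1 i)) (Real.sqrt_nonneg _),
    fun i => max_le ?_ (Real.sqrt_nonneg _), hres.2⟩
  refine le_trans ?_ (hres.1 i)
  rw [sub_neg_eq_add, neg_add_eq_sub, abs_sub_comm]
  exact le_abs_self _

end MatrixVector
end PGRPD

namespace PGRPD

/-! ### Subdifferentials, proximal points and conjugates of extended-valued convex functions. -/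

section Convex

variable {ι : Type} [Fintype ι] {h : Vec ι → EReal}

theorem IsProperClosedConvex.coe_toReal (hh : IsProperClosedConvex h) {y : Vec ι}
    (hy : y ∈ dom h) : ((h y).toReal : EReal) = h y :=
  EReal.coe_toReal hy (hh.ne_bot y)

theorem mem_dom_of_le_coe {y : Vec ι} {t : ℝ} (hy : h y ≤ t) : y ∈ dom h :=
  (hy.trans_lt (EReal.coe_lt_top t)).ne

/-- Jensen's inequality on the effective domain. -/
theorem IsProperClosedConvex.convex_comb (hh : IsProperClosedConvex h) {u v : Vec ι}
    (hu : u ∈ dom h) (hv : v ∈ dom h) {s t : ℝ} (hs : 0 ≤ s) (ht : 0 ≤ t) (hst : s + t = 1) :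
    s • u + t • v ∈ dom h ∧
      (h (s • u + t • v)).toReal ≤ s * (h u).toReal + t * (h v).toReal := by
  have := hh.convex_epi (x := (u, (h u).toReal)) (hh.coe_toReal hu).ge
    (y := (v, (h v).toReal)) (hh.coe_toReal hv).ge hs ht hst
  simp only [Prod.smul_mk, Prod.mk_add_mk, Set.mem_ofPred_eq, smul_eq_mul] at this
  have hd := mem_dom_of_le_coe this
  refine ⟨hd, ?_⟩
  rw [← hh.coe_toReal hd] at this
  exact_mod_cast this

theorem mem_dom_of_mem_subdiff (hd : (dom h).Nonempty) {y ξ : Vec ι} (hξ : ξ ∈ subdiff h y) :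
    y ∈ dom h := by
  obtain ⟨y₀, hy₀⟩ := hd
  intro hy
  have := hξ y₀
  rw [hy, EReal.top_add_coe, top_le_iff] at this
  exact hy₀ this

theorem IsProperClosedConvex.mem_subdiff_iff (hh : IsProperClosedConvex h) {y ξ : Vec ι} :
    ξ ∈ subdiff h y ↔ y ∈ dom h ∧
      ∀ y' ∈ dom h, (h y).toReal + ⟪ξ, y' - y⟫_ℝ ≤ (h y').toReal := by
  constructor
  · intro hξ
    have hy := mem_dom_of_mem_subdiff hh.dom_nonempty hξ
    refine ⟨hy, fun y' hy' => ?_⟩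
    have := hξ y'
    rw [← hh.coe_toReal hy, ← hh.coe_toReal hy'] at this
    exact_mod_cast this
  · rintro ⟨hy, H⟩ y'
    by_cases hy' : y' ∈ dom h
    · rw [← hh.coe_toReal hy, ← hh.coe_toReal hy']
      exact_mod_cast H y' hy'
    · rw [not_not.1 hy']; exact le_top

/-- Monotonicity of the subdifferential. -/
theorem IsProperClosedConvex.subdiff_monotone (hh : IsProperClosedConvex h) {y y' ξ ξ' : Vec ι}
    (hξ : ξ ∈ subdiff h y) (hξ' : ξ' ∈ subdiff h y') : 0 ≤ ⟪ξ - ξ', y - y'⟫_ℝ := by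
  have h1 := hh.mem_subdiff_iff.1 hξ
  have h2 := hh.mem_subdiff_iff.1 hξ'
  have h3 := h1.2 y' h2.1
  have h4 := h2.2 y h1.1
  rw [← neg_sub y y', inner_neg_right] at h3
  rw [inner_sub_left]
  linarith

/-! ### Existence of minimizers -/

theorem exists_forall_le_of_lsc {f : Vec ι → EReal} (hf : LowerSemicontinuous f) {R : ℝ}
    (hR : ∀ z, ∃ z', ‖z'‖ ≤ R ∧ f z' ≤ f z) : ∃ p, ∀ z, f p ≤ f z := by
  have hne : (Metric.closedBall (0 : Vec ι) R).Nonempty := by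
    obtain ⟨z', hz', -⟩ := hR 0
    exact ⟨z', by simpa using hz'⟩
  obtain ⟨p, -, hp⟩ := LowerSemicontinuousOn.exists_isMinOn hne
    (isCompact_closedBall (0 : Vec ι) R) (hf.lowerSemicontinuousOn _)
  refine ⟨p, fun z => ?_⟩
  obtain ⟨z', hz', hle⟩ := hR z
  exact (hp (by simpa using hz')).trans hle

theorem lowerSemicontinuous_add_coe {E : Type*} [TopologicalSpace E] {f : E → EReal}
    (hf : LowerSemicontinuous f) {q : E → ℝ} (hq : Continuous q) :
    LowerSemicontinuous fun z => (q z : EReal) + f z := by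
  refine LowerSemicontinuous.add' (continuous_coe_real_ereal.comp hq).lowerSemicontinuous hf ?_
  intro x
  exact EReal.continuousAt_add (by simp) (by simp)

/-- If an extended real valued function dominates a coercive function `m (‖z‖)`, then it attains
its minimum. -/
theorem exists_forall_le_of_coercive {f : Vec ι → EReal} (hf : LowerSemicontinuous f)
    {z₀ : Vec ι} {t R : ℝ} (hz₀ : f z₀ ≤ t) (hR : ∀ z, R < ‖z‖ → (t : EReal) ≤ f z) :
    ∃ p, ∀ z, f p ≤ f z := by
  refine exists_forall_le_of_lsc (R := max R ‖z₀‖) hf fun z => ?_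
  rcases le_or_gt ‖z‖ R with h | h
  · exact ⟨z, h.trans (le_max_left _ _), le_rfl⟩
  · exact ⟨z₀, le_max_right _ _, hz₀.trans (hR z h)⟩

/-- The objective defining the proximal operator attains its minimum if the function does not
decrease faster than linearly. -/
theorem IsProperClosedConvex.exists_isProx (hh : IsProperClosedConvex h) {a b : ℝ} (ha : 0 ≤ a)
    (hb : 0 ≤ b) (hab : ∀ y ∈ dom h, -(a + b * ‖y‖) ≤ (h y).toReal) {η : ℝ} (hη : 0 < η)
    (v : Vec ι) : ∃ p, IsProx η h v p := by
  obtain ⟨y₀, hy₀⟩ := hh.dom_nonempty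
  set t : ℝ := (h y₀).toReal + 1 / (2 * η) * ‖y₀ - v‖ ^ 2 with ht
  have hlsc : LowerSemicontinuous fun p => ((1 / (2 * η) * ‖p - v‖ ^ 2 : ℝ) : EReal) + h p :=
    lowerSemicontinuous_add_coe hh.lsc (by fun_prop)
  obtain ⟨p, hp⟩ := exists_forall_le_of_coercive hlsc (z₀ := y₀) (t := t)
    (R := ‖v‖ + (1 + 2 * η * (b + |t| + a + b * ‖v‖))) (by
      rw [← hh.coe_toReal hy₀, ht]
      norm_cast
      linarith) (by
      intro z hz
      by_cases hzd : z ∈ dom h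
      swap
      · rw [not_not.1 hzd, EReal.coe_add_top]; exact le_top
      have h1 := hab z hzd
      rw [← hh.coe_toReal hzd]
      norm_cast
      have h2 : ‖z‖ ≤ ‖z - v‖ + ‖v‖ := by simpa using norm_add_le (z - v) v
      set s := ‖z - v‖
      have hs1 : 1 + 2 * η * (b + |t| + a + b * ‖v‖) ≤ s := by linarith
      have hnn : 0 ≤ b + |t| + a + b * ‖v‖ := by positivity
      have hs2 : 1 ≤ s := by nlinarith
      have h3 : 1 / (2 * η) * s ^ 2 ≥ (b + |t| + a + b * ‖v‖) * s := by
        rw [ge_iff_le, one_div, ← div_eq_inv_mul, le_div_iff₀ (by positivity)]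
        nlinarith
      have h4 : b * ‖z‖ ≤ b * s + b * ‖v‖ := by nlinarith
      have h5 : (|t| + a + b * ‖v‖) * 1 ≤ (|t| + a + b * ‖v‖) * s := by gcongr
      have := le_abs_self t
      nlinarith)
  refine ⟨p, fun p' => ?_⟩
  have := hp p'
  rwa [add_comm, add_comm _ (h p')] at this

theorem IsProx.mem_dom {η : ℝ} {v p : Vec ι} (hd : (dom h).Nonempty) (hp : IsProx η h v p) :
    p ∈ dom h := by
  obtain ⟨y₀, hy₀⟩ := hd
  intro hpt
  have := hp y₀
  rw [hpt, EReal.top_add_coe, top_le_iff] at this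
  exact (EReal.add_ne_top hy₀ (EReal.coe_ne_top _)) this

/-- Comparing a minimizer with the point at parameter `t` of a segment and dividing by `t` leaves a
first-order term plus `t` times a quadratic one; small `t` isolates the former. -/
theorem nonneg_of_forall_add_mul {A B : ℝ} (h : ∀ t : ℝ, 0 < t → t ≤ 1 → 0 ≤ A + t * B) :
    0 ≤ A := by
  by_contra! hA
  have hB : 0 < B := by have := h 1 one_pos le_rfl; linarith
  have h1 := h (min 1 (-A / (2 * B))) (lt_min one_pos (div_pos (by linarith) (by linarith)))
    (min_le_left _ _)
  have h2 : min 1 (-A / (2 * B)) * B ≤ -A / (2 * B) * B := by gcongr; exact min_le_right _ _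
  have h3 : -A / (2 * B) * B = -A / 2 := by field_simp
  linarith

/-- A point which minimizes `φ + h`, for `φ` with the directional expansion given, satisfies the
first order optimality condition. -/
theorem IsProx.mem_subdiff (hh : IsProperClosedConvex h) {η : ℝ} (hη : 0 < η) {v p : Vec ι}
    (hp : IsProx η h v p) : (1 / η) • (v - p) ∈ subdiff h p := by
  have hpd := hp.mem_dom hh.dom_nonempty
  refine hh.mem_subdiff_iff.2 ⟨hpd, fun y' hy' => ?_⟩
  have key : 0 ≤ ((h y').toReal - (h p).toReal - 1 / η * ⟪v - p, y' - p⟫_ℝ) := by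
    refine nonneg_of_forall_add_mul (B := 1 / (2 * η) * ‖y' - p‖ ^ 2) fun t ht0 ht1 => ?_
    obtain ⟨hd, hle⟩ := hh.convex_comb hpd hy' (sub_nonneg.2 ht1) ht0.le (by ring)
    have h1 := hp ((1 - t) • p + t • y')
    rw [← hh.coe_toReal hpd, ← hh.coe_toReal hd] at h1
    norm_cast at h1
    have h2 : (1 - t) • p + t • y' - v = (p - v) + t • (y' - p) := by module
    rw [h2, norm_add_sq_real, inner_smul_right, norm_smul, Real.norm_eq_abs, abs_of_pos ht0] at h1
    have h3 : ⟪p - v, y' - p⟫_ℝ = -⟪v - p, y' - p⟫_ℝ := by rw [← inner_neg_left, neg_sub]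
    rw [h3] at h1
    have h4 : 0 ≤ t * ((h y').toReal - (h p).toReal - 1 / η * ⟪v - p, y' - p⟫_ℝ
        + t * (1 / (2 * η) * ‖y' - p‖ ^ 2)) := by
      have h5 : 1 / (2 * η) * (‖p - v‖ ^ 2 + 2 * (t * -⟪v - p, y' - p⟫_ℝ) + (t * ‖y' - p‖) ^ 2)
        = 1 / (2 * η) * ‖p - v‖ ^ 2 - t * (1 / η * ⟪v - p, y' - p⟫_ℝ)
          + t * (t * (1 / (2 * η) * ‖y' - p‖ ^ 2)) := by field_simp; ring
      rw [h5] at h1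
      nlinarith
    exact nonneg_of_mul_nonneg_right h4 ht0
  rw [inner_smul_left]
  simp only [conj_trivial]
  linarith

/-- Nonexpansiveness of the proximal operator, through the resolvent identity. -/
theorem IsProperClosedConvex.norm_sub_le_of_subdiff (hh : IsProperClosedConvex h) {c : ℝ}
    (hc : 0 < c) {v v' p p' : Vec ι} (hp : c • (v - p) ∈ subdiff h p)
    (hp' : c • (v' - p') ∈ subdiff h p') : ‖p - p'‖ ≤ ‖v - v'‖ := by
  have h1 := hh.subdiff_monotone hp hp'
  rw [← smul_sub, inner_smul_left] at h1
  have h2 : 0 ≤ ⟪v - p - (v' - p'), p - p'⟫_ℝ := nonneg_of_mul_nonneg_right h1 hc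
  have h3 : v - p - (v' - p') = (v - v') - (p - p') := by abel
  rw [h3, inner_sub_left, real_inner_self_eq_norm_sq] at h2
  have h4 := real_inner_le_norm (v - v') (p - p')
  rcases eq_or_lt_of_le (norm_nonneg (p - p')) with h0 | h0
  · rw [← h0]; exact norm_nonneg _
  · nlinarith

/-! ### The conjugate -/

theorem le_conj (h : Vec ι → EReal) (y z : Vec ι) :
    ((⟪y, z⟫_ℝ : ℝ) : EReal) - h y ≤ conj h z := le_iSup (fun y => ((⟪y, z⟫_ℝ : ℝ) : EReal) - h y) y

theorem IsProperClosedConvex.conj_le_coe_iff (hh : IsProperClosedConvex h) {z : Vec ι} {t : ℝ} :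
    conj h z ≤ t ↔ ∀ y ∈ dom h, ⟪y, z⟫_ℝ - (h y).toReal ≤ t := by
  rw [conj, iSup_le_iff]
  refine forall_congr' fun y => ?_
  by_cases hy : y ∈ dom h
  · simp only [hy, forall_const]
    rw [← hh.coe_toReal hy]
    norm_cast
  · simp only [hy, IsEmpty.forall_iff, iff_true]
    rw [not_not.1 hy]
    simp

theorem IsProperClosedConvex.conj_ne_bot (hh : IsProperClosedConvex h) (z : Vec ι) :
    conj h z ≠ ⊥ := by
  obtain ⟨y₀, hy₀⟩ := hh.dom_nonempty
  have := le_conj h y₀ z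
  rw [← hh.coe_toReal hy₀] at this
  intro hc
  rw [hc, le_bot_iff] at this
  exact absurd this (by rw [← EReal.coe_sub]; exact EReal.coe_ne_bot _)

theorem IsProperClosedConvex.le_conj_toReal (hh : IsProperClosedConvex h) {y z : Vec ι}
    (hy : y ∈ dom h) (hz : z ∈ dom (conj h)) :
    ⟪y, z⟫_ℝ - (h y).toReal ≤ (conj h z).toReal :=
  hh.conj_le_coe_iff.1 (EReal.coe_toReal hz (hh.conj_ne_bot z)).ge y hy

theorem IsProperClosedConvex.conj_properClosedConvex (hh : IsProperClosedConvex h)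
    (hd : (dom (conj h)).Nonempty) : IsProperClosedConvex (conj h) where
  ne_bot := hh.conj_ne_bot
  dom_nonempty := hd
  lsc := by
    refine lowerSemicontinuous_iSup fun y => ?_
    by_cases hy : y ∈ dom h
    · rw [← hh.coe_toReal hy]
      refine Continuous.lowerSemicontinuous ?_
      simp_rw [← EReal.coe_sub]
      exact continuous_coe_real_ereal.comp (by fun_prop)
    · rw [not_not.1 hy]
      simpa using lowerSemicontinuous_const
  convex_epi := by
    rintro ⟨u, s⟩ hu ⟨v, t⟩ hv α β hα hβ hαβ
    simp only [Set.mem_ofPred_eq, Prod.smul_mk, Prod.mk_add_mk, smul_eq_mul] at *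
    rw [hh.conj_le_coe_iff] at *
    intro y hy
    have h1 := mul_le_mul_of_nonneg_left (hu y hy) hα
    have h2 := mul_le_mul_of_nonneg_left (hv y hy) hβ
    rw [inner_add_right, inner_smul_right, inner_smul_right]
    have h3 : (h y).toReal = α * (h y).toReal + β * (h y).toReal := by
      rw [← add_mul, hαβ, one_mul]
    linarith

/-- The Fenchel–Young equality. -/
theorem IsProperClosedConvex.conj_of_mem_subdiff (hh : IsProperClosedConvex h) {y ξ : Vec ι}
    (hξ : ξ ∈ subdiff h y) :
    ξ ∈ dom (conj h) ∧ (conj h ξ).toReal = ⟪y, ξ⟫_ℝ - (h y).toReal := by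
  obtain ⟨hy, H⟩ := hh.mem_subdiff_iff.1 hξ
  have h1 : conj h ξ ≤ ((⟪y, ξ⟫_ℝ - (h y).toReal : ℝ) : EReal) := by
    refine hh.conj_le_coe_iff.2 fun y' hy' => ?_
    have := H y' hy'
    rw [inner_sub_right, real_inner_comm, real_inner_comm y ξ] at this
    linarith
  have hd := mem_dom_of_le_coe h1
  refine ⟨hd, le_antisymm ?_ (hh.le_conj_toReal hy hd)⟩
  rw [← EReal.coe_toReal hd (hh.conj_ne_bot ξ)] at h1
  exact_mod_cast h1

theorem IsProperClosedConvex.mem_subdiff_conj (hh : IsProperClosedConvex h) {y ξ : Vec ι}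
    (hξ : ξ ∈ subdiff h y) : y ∈ subdiff (conj h) ξ := by
  obtain ⟨hd, he⟩ := hh.conj_of_mem_subdiff hξ
  have hy := (hh.mem_subdiff_iff.1 hξ).1
  refine (hh.conj_properClosedConvex ⟨ξ, hd⟩).mem_subdiff_iff.2 ⟨hd, fun z hz => ?_⟩
  have := hh.le_conj_toReal hy hz
  rw [he, inner_sub_right]
  linarith

/-- Inversion of the subdifferential of the conjugate. -/
theorem IsProperClosedConvex.mem_subdiff_of_conj (hh : IsProperClosedConvex h) {a b : ℝ}
    (ha : 0 ≤ a) (hb : 0 ≤ b) (hab : ∀ y ∈ dom h, -(a + b * ‖y‖) ≤ (h y).toReal) {y z : Vec ι}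
    (hz : z ∈ dom (conj h)) (hy : y ∈ subdiff (conj h) z) : z ∈ subdiff h y := by
  -- Instead of biconjugation, take the proximal point `p` of `y + z`. Then `y + z - p ∈ ∂h(p)`,
  -- hence `p ∈ ∂h⋆(y + z - p)`, and monotonicity of `∂h⋆` against `y ∈ ∂h⋆(z)` reads `-‖p - y‖² ≥
  -- 0`, so `p = y`.
  obtain ⟨p, hp⟩ := hh.exists_isProx ha hb hab one_pos (y + z)
  have hξ := hp.mem_subdiff hh one_pos
  rw [one_div_one, one_smul] at hξ
  have hpξ := hh.mem_subdiff_conj hξ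
  have hm := (hh.conj_properClosedConvex ⟨z, hz⟩).subdiff_monotone hpξ hy
  have h1 : y + z - p - z = -(p - y) := by abel
  rw [h1, inner_neg_right, real_inner_self_eq_norm_sq] at hm
  have h2 : ‖p - y‖ = 0 := by nlinarith [sq_nonneg ‖p - y‖]
  have h3 : p = y := sub_eq_zero.1 (norm_eq_zero.1 h2)
  rw [h3, add_sub_cancel_left] at hξ
  exact hξ

end Convex

end PGRPD

namespace PGRPD

namespace Setup

variable {d n nb : ℕ} {S : Setup d n nb}

/-! ### The dual objective as a real valued function on its domain -/

variable (S) in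
/-- The smooth part of the dual objective. -/
noncomputable def dualSmooth (x : Vec (Fin d)) (z : Vec (Fin nb ⊕ Fin n)) : ℝ :=
  1 / (2 * S.τ) * ‖S.dualResidual x z‖ ^ 2 - ⟪fstBlock z, S.bbar⟫_ℝ - ⟪sndBlock z, S.b⟫_ℝ

variable (S) in
/-- The gradient of the smooth part of the dual objective. -/
noncomputable def dualGrad (x : Vec (Fin d)) (z : Vec (Fin nb ⊕ Fin n)) : Vec (Fin nb ⊕ Fin n) :=
  join ((1 / S.τ) • mul S.Abar (S.dualResidual x z) - S.bbar)
    ((1 / S.τ) • mul S.A (S.dualResidual x z) - S.b)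

variable (S) in
/-- The domain of the dual objective. -/
noncomputable def dualDom : Set (Vec (Fin nb ⊕ Fin n)) := {z | fstBlock z ∈ dom (conj S.g)}

variable (S) in
/-- The real value of the dual objective. -/
noncomputable def dualVal (x : Vec (Fin d)) (z : Vec (Fin nb ⊕ Fin n)) : ℝ :=
  S.dualSmooth x z + (conj S.g (fstBlock z)).toReal

theorem mul_H_transpose (z : Vec (Fin nb ⊕ Fin n)) :
    mul S.H.transpose z = mul S.Abar.transpose (fstBlock z) + mul S.A.transpose (sndBlock z) :=
  mul_fromRows_transpose _ _ z

theorem mul_H (v : Vec (Fin d)) : mul S.H v = join (mul S.Abar v) (mul S.A v) :=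
  mul_fromRows _ _ v

theorem dual_eq (x : Vec (Fin d)) (z : Vec (Fin nb ⊕ Fin n)) :
    S.dual x z = (S.dualSmooth x z : EReal) + conj S.g (fstBlock z) := rfl

theorem dualResidual_sub (x : Vec (Fin d)) (z w : Vec (Fin nb ⊕ Fin n)) :
    S.dualResidual x w = S.dualResidual x z + mul S.H.transpose (w - z) := by
  simp only [dualResidual, map_sub]; abel

theorem inner_dualGrad (x : Vec (Fin d)) (z w : Vec (Fin nb ⊕ Fin n)) :
    ⟪S.dualGrad x z, w⟫_ℝ = 1 / S.τ * ⟪S.dualResidual x z, mul S.H.transpose w⟫_ℝ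
      - ⟪fstBlock w, S.bbar⟫_ℝ - ⟪sndBlock w, S.b⟫_ℝ := by
  rw [inner_blocks, dualGrad, fstBlock_join, sndBlock_join, real_inner_comm _ (S.dualResidual x z),
    inner_mul_transpose, mul_H, inner_blocks, fstBlock_join, sndBlock_join]
  simp only [inner_sub_left, inner_smul_left, conj_trivial, real_inner_comm]
  ring

/-- The smooth part of the dual objective is quadratic. -/
theorem dualSmooth_expand (x : Vec (Fin d)) (z w : Vec (Fin nb ⊕ Fin n)) :
    S.dualSmooth x w = S.dualSmooth x z + ⟪S.dualGrad x z, w - z⟫_ℝ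
      + 1 / (2 * S.τ) * ‖mul S.H.transpose (w - z)‖ ^ 2 := by
  rw [inner_dualGrad, dualSmooth, dualSmooth, dualResidual_sub x z w, norm_add_sq_real]
  simp only [fstBlock_sub, sndBlock_sub, inner_sub_left]
  have : 1 / S.τ = 2 * (1 / (2 * S.τ)) := by
    rcases eq_or_ne S.τ 0 with h | h
    · simp [h]
    · field_simp
  rw [this]
  ring

/-! ### Consequences of the standing assumptions -/

theorem τ_pos (hLf : 0 < S.Lf) : 0 < S.τ := by unfold τ; linarith

theorem LD_pos (hLf : 0 < S.Lf) (hH : S.H ≠ 0) : 0 < S.LD := div_pos (lamMax_pos hH) (τ_pos hLf)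

namespace Assumptions

variable (hA : S.Assumptions)
include hA

theorem conj_convex : IsProperClosedConvex (conj S.g) :=
  hA.g_convex.conj_properClosedConvex ⟨_, hA.zini_dom⟩

theorem zini_mem : S.zini ∈ S.dualDom := hA.zini_dom

/-- Lipschitz continuity on the domain gives a minorant of linear growth, which is what the
existence of proximal points and the inversion of `∂g⋆` require. -/
theorem g_lower_bound : ∃ a b : ℝ, 0 ≤ a ∧ 0 ≤ b ∧
    ∀ y ∈ dom S.g, -(a + b * ‖y‖) ≤ (S.g y).toReal := by
  refine ⟨|(S.g S.y0).toReal| + S.lg * ‖S.y0‖, S.lg,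
    add_nonneg (abs_nonneg _) (mul_nonneg hA.lg_pos.le (norm_nonneg _)), hA.lg_pos.le,
    fun y hy => ?_⟩
  have h1 := hA.g_lipschitz y hy S.y0 hA.y0_dom
  have h2 := norm_sub_le y S.y0
  have h3 : S.lg * ‖y - S.y0‖ ≤ S.lg * (‖y‖ + ‖S.y0‖) := by gcongr; exact hA.lg_pos.le
  have h4 := neg_abs_le (S.g S.y0).toReal
  have h5 := neg_le_of_abs_le h1
  linarith

theorem conj_lower_bound (z : Vec (Fin nb)) (hz : z ∈ dom (conj S.g)) :
    ⟪S.y0, z⟫_ℝ - (S.g S.y0).toReal ≤ (conj S.g z).toReal :=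
  hA.g_convex.le_conj_toReal hA.y0_dom hz

/-- `prox` is a choice and means something only once a minimizer exists. The Fenchel–Young
inequality at `y⁰` supplies the linear minorant of `g⋆`. -/
theorem prox_conj_spec {η : ℝ} (hη : 0 < η) (v : Vec (Fin nb)) :
    IsProx η (conj S.g) v (prox η (conj S.g) v) := by
  refine Classical.epsilon_spec (hA.conj_convex.exists_isProx (abs_nonneg (S.g S.y0).toReal)
    (norm_nonneg S.y0) (fun z hz => ?_) hη v)
  have h1 := hA.conj_lower_bound z hz
  have h2 := neg_le_of_abs_le (abs_real_inner_le_norm S.y0 z)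
  have h3 := le_abs_self (S.g S.y0).toReal
  linarith

theorem prox_g_spec {η : ℝ} (hη : 0 < η) (v : Vec (Fin nb)) : IsProx η S.g v (prox η S.g v) := by
  obtain ⟨a, b, ha, hb, hab⟩ := hA.g_lower_bound
  exact Classical.epsilon_spec (hA.g_convex.exists_isProx ha hb hab hη v)

theorem mem_subdiff_g {y z : Vec (Fin nb)} (hz : z ∈ dom (conj S.g))
    (hy : y ∈ subdiff (conj S.g) z) : z ∈ subdiff S.g y := by
  obtain ⟨a, b, ha, hb, hab⟩ := hA.g_lower_bound
  exact hA.g_convex.mem_subdiff_of_conj ha hb hab hz hy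

theorem dual_coe {x : Vec (Fin d)} {z : Vec (Fin nb ⊕ Fin n)} (hz : z ∈ S.dualDom) :
    S.dual x z = (S.dualVal x z : EReal) := by
  rw [dual_eq, dualVal, EReal.coe_add, hA.conj_convex.coe_toReal hz]

theorem dual_top {x : Vec (Fin d)} {z : Vec (Fin nb ⊕ Fin n)} (hz : z ∉ S.dualDom) :
    S.dual x z = ⊤ := by
  rw [dual_eq, show conj S.g (fstBlock z) = ⊤ from not_not.1 hz, EReal.coe_add_top]

theorem mem_Ω_iff {x : Vec (Fin d)} {z : Vec (Fin nb ⊕ Fin n)} :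
    z ∈ S.Ω x ↔ z ∈ S.dualDom ∧ ∀ w ∈ S.dualDom, S.dualVal x z ≤ S.dualVal x w := by
  constructor
  · intro hz
    have hzd : z ∈ S.dualDom := by
      by_contra hzd
      have := hz S.zini
      rw [hA.dual_top hzd, hA.dual_coe hA.zini_mem, top_le_iff] at this
      exact EReal.coe_ne_top _ this
    refine ⟨hzd, fun w hw => ?_⟩
    have := hz w
    rw [hA.dual_coe hzd, hA.dual_coe hw] at this
    exact_mod_cast this
  · rintro ⟨hz, H⟩ w
    by_cases hw : w ∈ S.dualDom
    · rw [hA.dual_coe hz, hA.dual_coe hw]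
      exact_mod_cast H w hw
    · rw [hA.dual_top hw]; exact le_top

theorem gap_eq {x : Vec (Fin d)} {w : Vec (Fin nb ⊕ Fin n)} (hw : w ∈ S.Ω x) :
    S.gap x = S.dualVal x S.zini - S.dualVal x w := by
  have h1 : ⨅ z, S.dual x z = S.dual x w := le_antisymm (iInf_le _ w) (le_iInf hw)
  rw [gap, h1, hA.dual_coe hA.zini_mem, hA.dual_coe (hA.mem_Ω_iff.1 hw).1, EReal.toReal_coe,
    EReal.toReal_coe]

theorem gap_nonneg {x : Vec (Fin d)} (hx : (S.Ω x).Nonempty) : 0 ≤ S.gap x := by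
  obtain ⟨w, hw⟩ := hx
  rw [hA.gap_eq hw]
  linarith [(hA.mem_Ω_iff.1 hw).2 _ hA.zini_mem]

theorem dual_lsc (x : Vec (Fin d)) : LowerSemicontinuous (S.dual x) := by
  refine lowerSemicontinuous_add_coe (hA.conj_convex.lsc.comp continuous_fstBlock) ?_
  have := continuous_fstBlock (ι := Fin nb) (κ := Fin n)
  have := continuous_sndBlock (ι := Fin nb) (κ := Fin n)
  unfold dualResidual
  fun_prop

theorem isClosed_Ω (x : Vec (Fin d)) : IsClosed (S.Ω x) := by
  rw [show S.Ω x = ⋂ z', S.dual x ⁻¹' Set.Iic (S.dual x z') by ext; simp [Ω]]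
  exact isClosed_iInter fun z' => (hA.dual_lsc x).isClosed_preimage _

/-! ### The accelerated proximal gradient method -/

/-- The basic inequality of a proximal gradient step. -/
theorem apgStep_le (hLf : 0 < S.Lf) (hH : S.H ≠ 0) (x : Vec (Fin d)) (s : APGState nb n) :
    (S.apgStep x s).z ∈ S.dualDom ∧ ∀ u ∈ S.dualDom,
      S.dualVal x (S.apgStep x s).z + S.LD / 2 * ‖(S.apgStep x s).z - u‖ ^ 2
        ≤ S.dualVal x u + S.LD / 2 * ‖s.zhat - u‖ ^ 2 := by
  have hL := LD_pos hLf hH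
  have hτ := τ_pos hLf
  set z' := (S.apgStep x s).z with hz'
  have hp := hA.prox_conj_spec (one_div_pos.2 hL)
    (fstBlock s.zhat - (1 / S.LD) • fstBlock (S.dualGrad x s.zhat))
  have hfst : fstBlock z' = prox (1 / S.LD) (conj S.g)
    (fstBlock s.zhat - (1 / S.LD) • fstBlock (S.dualGrad x s.zhat)) := rfl
  have hsnd : sndBlock z' = sndBlock s.zhat - (1 / S.LD) • sndBlock (S.dualGrad x s.zhat) := rfl
  rw [← hfst] at hp
  obtain ⟨hd, hsub⟩ := hA.conj_convex.mem_subdiff_iff.1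
    (hp.mem_subdiff hA.conj_convex (one_div_pos.2 hL))
  refine ⟨hd, fun u hu => ?_⟩
  have h1 := hsub _ hu
  have h2 := dualSmooth_expand (S := S) x s.zhat z'
  have h3 := dualSmooth_expand (S := S) x s.zhat u
  have h4 : 1 / (2 * S.τ) * ‖mul S.H.transpose (z' - s.zhat)‖ ^ 2
      ≤ S.LD / 2 * ‖z' - s.zhat‖ ^ 2 := by
    have := norm_mul_transpose_sq_le S.H (z' - s.zhat)
    calc _ ≤ 1 / (2 * S.τ) * (lamMax S.H * ‖z' - s.zhat‖ ^ 2) := by gcongr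
      _ = _ := by rw [LD]; field_simp
  have h5 : 0 ≤ 1 / (2 * S.τ) * ‖mul S.H.transpose (u - s.zhat)‖ ^ 2 := by positivity
  -- The left side sees only the first block. In the second block `LD • (ẑ - z')` equals the
  -- gradient, so its contribution to the right side vanishes.
  have h6 : ⟪(1 / (1 / S.LD)) • (fstBlock s.zhat - (1 / S.LD) • fstBlock (S.dualGrad x s.zhat)
      - fstBlock z'), fstBlock u - fstBlock z'⟫_ℝ
      = S.LD * ⟪s.zhat - z', u - z'⟫_ℝ - ⟪S.dualGrad x s.zhat, u - z'⟫_ℝ := by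
    rw [inner_blocks (s.zhat - z'), inner_blocks (S.dualGrad x s.zhat)]
    simp only [sndBlock_sub, fstBlock_sub]
    rw [hsnd]
    simp only [inner_smul_left, inner_sub_left, conj_trivial, one_div, inv_inv, sub_sub_cancel]
    field_simp
    ring
  have h7 : ⟪S.dualGrad x s.zhat, u - z'⟫_ℝ = ⟪S.dualGrad x s.zhat, u - s.zhat⟫_ℝ
      - ⟪S.dualGrad x s.zhat, z' - s.zhat⟫_ℝ := by
    rw [← inner_sub_right]; congr 1; abel
  have h8 : ‖s.zhat - u‖ ^ 2 = ‖z' - s.zhat‖ ^ 2 - 2 * ⟪s.zhat - z', u - z'⟫_ℝ + ‖z' - u‖ ^ 2 := by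
    rw [show s.zhat - u = (s.zhat - z') - (u - z') by abel, norm_sub_sq_real,
      norm_sub_rev s.zhat z', norm_sub_rev u z']
  rw [h6, h7] at h1
  rw [h8]
  unfold dualVal
  nlinarith

/-- The Lyapunov function of the accelerated method does not increase. -/
theorem apg_invariant (hLf : 0 < S.Lf) (hH : S.H ≠ 0) (x : Vec (Fin d))
    {z w : Vec (Fin nb ⊕ Fin n)} (hz : z ∈ S.dualDom) (hw : w ∈ S.Ω x) (j : ℕ) :
    let s := (S.apgStep x)^[j] ⟨z, z, 1⟩
    s.z ∈ S.dualDom ∧ ((j : ℝ) + 2) / 2 ≤ s.α ∧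
      (s.α ^ 2 - s.α) * (2 / S.LD * (S.dualVal x s.z - S.dualVal x w))
        + ‖s.α • s.zhat - (s.α - 1) • s.z - w‖ ^ 2 ≤ ‖z - w‖ ^ 2 := by
  have hL := LD_pos hLf hH
  have hwd := (hA.mem_Ω_iff.1 hw).1
  induction j with
  | zero => simp [hz]
  | succ j ih =>
    obtain ⟨h1, h2, h3⟩ := ih
    simp only [Function.iterate_succ_apply']
    set s := (S.apgStep x)^[j] ⟨z, z, 1⟩
    obtain ⟨h4, h5⟩ := hA.apgStep_le hLf hH x s
    have hα' : (S.apgStep x s).α = (1 + √(1 + 4 * s.α ^ 2)) / 2 := rfl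
    have hzh : (S.apgStep x s).zhat = (S.apgStep x s).z
      + ((s.α - 1) / (S.apgStep x s).α) • ((S.apgStep x s).z - s.z) := rfl
    set s' := S.apgStep x s
    have hj : (0 : ℝ) ≤ j := j.cast_nonneg
    have hα0 : 0 ≤ s.α := by linarith
    have hsq : √(1 + 4 * s.α ^ 2) ^ 2 = 1 + 4 * s.α ^ 2 := Real.sq_sqrt (by positivity)
    have hsge : 2 * s.α ≤ √(1 + 4 * s.α ^ 2) :=
      Real.le_sqrt_of_sq_le (by nlinarith)
    -- The momentum recursion is the positive root of `α'² - α' = α²`, which makes the weights of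
    -- the gap telescope.
    have hαeq : s'.α ^ 2 - s'.α = s.α ^ 2 := by rw [hα']; nlinarith
    have hαpos : 0 < s'.α := by rw [hα']; positivity
    refine ⟨h4, by rw [hα']; push_cast; linarith, ?_⟩
    -- The extrapolation is chosen so that this combination no longer involves the new `α'`.
    have hU : s'.α • s'.zhat - (s'.α - 1) • s'.z = s.α • s'.z - (s.α - 1) • s.z := by
      rw [hzh, smul_add, smul_smul, mul_div_cancel₀ _ hαpos.ne']
      module
    rw [hU, hαeq]
    refine le_trans ?_ h3
    -- The proximal inequality is used at the previous iterate with weight `α² - α` and at the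
    -- minimizer with weight `α`; `hid` recombines the squared distances into the Lyapunov term.
    have h6 := h5 s.z h1
    have h7 := h5 w hwd
    have hid : ∀ p : Vec (Fin nb ⊕ Fin n), ‖s.α • p - (s.α - 1) • s.z - w‖ ^ 2
        = (s.α ^ 2 - s.α) * ‖p - s.z‖ ^ 2 + s.α * ‖p - w‖ ^ 2 - (s.α - 1) * ‖s.z - w‖ ^ 2 := by
      intro p
      have e1 : s.α • p - (s.α - 1) • s.z - w = s.α • (p - w) - (s.α - 1) • (s.z - w) := by module
      have e2 : p - s.z = (p - w) - (s.z - w) := by abel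
      rw [e1, e2, norm_sub_sq_real, norm_sub_sq_real, norm_smul, norm_smul, inner_smul_left,
        inner_smul_right, mul_pow, mul_pow, Real.norm_eq_abs, Real.norm_eq_abs, sq_abs, sq_abs]
      simp only [conj_trivial]
      ring
    rw [hid, hid]
    have hα1 : 0 ≤ s.α ^ 2 - s.α := by nlinarith
    have h8 := mul_le_mul_of_nonneg_left h6 hα1
    have h9 := mul_le_mul_of_nonneg_left h7 hα0
    have h10 : (s.α ^ 2) * (S.dualVal x s'.z - S.dualVal x w)
        + S.LD / 2 * ((s.α ^ 2 - s.α) * ‖s'.z - s.z‖ ^ 2 + s.α * ‖s'.z - w‖ ^ 2)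
        ≤ (s.α ^ 2 - s.α) * (S.dualVal x s.z - S.dualVal x w)
        + S.LD / 2 * ((s.α ^ 2 - s.α) * ‖s.zhat - s.z‖ ^ 2 + s.α * ‖s.zhat - w‖ ^ 2) := by
      nlinarith
    have h11 := mul_le_mul_of_nonneg_left h10 (by positivity : 0 ≤ 2 / S.LD)
    have h12 : 2 / S.LD * (S.LD / 2) = 1 := by field_simp
    have e : ∀ A B : ℝ, 2 / S.LD * (A + S.LD / 2 * B) = 2 / S.LD * A + B := by
      intro A B; rw [mul_add, ← mul_assoc, h12, one_mul]
    rw [e, e] at h11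
    linarith

/-- A cycle of sufficiently many steps halves the dual gap. -/
theorem apgCycle_le (hLf : 0 < S.Lf) (hH : S.H ≠ 0) (x : Vec (Fin d))
    {z w : Vec (Fin nb ⊕ Fin n)} (hz : z ∈ S.dualDom) (hw : w ∈ S.Ω x) {ρ : ℝ} (hρ : 0 < ρ)
    (hgrowth : ρ / 2 * ‖z - w‖ ^ 2 ≤ S.dualVal x z - S.dualVal x w) {j : ℕ}
    (hj : 2 * √(2 * S.LD / ρ) ≤ j) :
    S.apgCycle x j z ∈ S.dualDom ∧
      S.dualVal x (S.apgCycle x j z) - S.dualVal x w ≤ (S.dualVal x z - S.dualVal x w) / 2 := by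
  obtain ⟨h1, h2, h3⟩ := hA.apg_invariant hLf hH x hz hw j
  refine ⟨h1, ?_⟩
  change S.dualVal x ((S.apgStep x)^[j] ⟨z, z, 1⟩).z - S.dualVal x w ≤ _
  set s := (S.apgStep x)^[j] ⟨z, z, 1⟩
  have hL := LD_pos hLf hH
  have hj2 : 8 * S.LD / ρ ≤ (j : ℝ) ^ 2 := by
    have := pow_le_pow_left₀ (by positivity) hj 2
    rw [mul_pow, Real.sq_sqrt (by positivity)] at this
    calc _ = 2 ^ 2 * (2 * S.LD / ρ) := by ring
      _ ≤ _ := this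
  have hj0 : (0 : ℝ) ≤ j := j.cast_nonneg
  have hδ : 0 ≤ S.dualVal x s.z - S.dualVal x w := by
    linarith [(hA.mem_Ω_iff.1 hw).2 _ h1]
  set δ := S.dualVal x s.z - S.dualVal x w
  set δ₀ := S.dualVal x z - S.dualVal x w
  -- From `α ≥ (j + 2) / 2` one gets `α² - α ≥ j (j + 2) / 4`.
  have hα : (j : ℝ) ^ 2 / 4 ≤ s.α ^ 2 - s.α := by nlinarith
  have h4 : 2 * S.LD / ρ * (2 / S.LD * δ) ≤ ‖z - w‖ ^ 2 := by
    calc _ ≤ (s.α ^ 2 - s.α) * (2 / S.LD * δ) := by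
          gcongr
          calc 2 * S.LD / ρ = 8 * S.LD / ρ / 4 := by ring
            _ ≤ (j : ℝ) ^ 2 / 4 := by gcongr
            _ ≤ _ := hα
      _ ≤ _ := by nlinarith [sq_nonneg ‖s.α • s.zhat - (s.α - 1) • s.z - w‖]
  have h5 : 2 * S.LD / ρ * (2 / S.LD * δ) = 4 * δ / ρ := by field_simp; ring
  rw [h5, div_le_iff₀ hρ] at h4
  linarith

/-- Linear convergence of the restarted method, and the acceptance criterion. -/
theorem accepts_of_growth (hLf : 0 < S.Lf) (hH : S.H ≠ 0) (x : Vec (Fin d))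
    (hΩ : (S.Ω x).Nonempty) {ρ : ℝ} (hρ : 0 < ρ)
    (hgrowth : ∀ z ∈ S.dualDom, S.dualVal x z ≤ S.dualVal x S.zini →
      ∃ w ∈ S.Ω x, ρ / 2 * ‖z - w‖ ^ 2 ≤ S.dualVal x z - S.dualVal x w) {j : ℕ}
    (hj : 2 * √(2 * S.LD / ρ) ≤ j) {μ : ℝ} (hμ : 0 < μ) :
    S.Accepts x μ (S.restartedAPG x ⌈Real.logb 2 (2 * S.gap x / (ρ * μ ^ 2))⌉₊ j) := by
  obtain ⟨w₀, hw₀⟩ := hΩ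
  have hΩval : ∀ w ∈ S.Ω x, S.dualVal x w = S.dualVal x w₀ := fun w hw =>
    le_antisymm ((hA.mem_Ω_iff.1 hw).2 _ (hA.mem_Ω_iff.1 hw₀).1)
      ((hA.mem_Ω_iff.1 hw₀).2 _ (hA.mem_Ω_iff.1 hw).1)
  have hgap := hA.gap_eq hw₀
  have hgap0 := hA.gap_nonneg ⟨w₀, hw₀⟩
  -- Growth is invoked only at restart points. They stay in the initial level set because the gap
  -- halves over each cycle, even if it is not monotone inside a cycle.
  have key : ∀ i : ℕ, S.restartedAPG x i j ∈ S.dualDom ∧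
      S.dualVal x (S.restartedAPG x i j) - S.dualVal x w₀ ≤ S.gap x / 2 ^ i := by
    intro i
    induction i with
    | zero => exact ⟨hA.zini_mem, by simp [restartedAPG, hgap]⟩
    | succ i ih =>
      have h1 : S.restartedAPG x (i + 1) j = S.apgCycle x j (S.restartedAPG x i j) :=
        Function.iterate_succ_apply' _ _ _
      have h2 : S.gap x / 2 ^ i ≤ S.gap x := div_le_self hgap0 (one_le_pow₀ (by norm_num))
      obtain ⟨w, hw, hg⟩ := hgrowth _ ih.1 (by linarith [ih.2])
      obtain ⟨h3, h4⟩ := hA.apgCycle_le hLf hH x ih.1 hw hρ hg hj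
      rw [h1]
      refine ⟨h3, ?_⟩
      rw [hΩval w hw] at h4
      calc _ ≤ _ := h4
        _ ≤ S.gap x / 2 ^ i / 2 := by gcongr; exact ih.2
        _ = _ := by rw [pow_succ]; field_simp
  set i := ⌈Real.logb 2 (2 * S.gap x / (ρ * μ ^ 2))⌉₊ with hi
  obtain ⟨h1, h2⟩ := key i
  refine ⟨h1, ?_⟩
  have h3 : S.gap x / 2 ^ i ≤ S.gap x := div_le_self hgap0 (one_le_pow₀ (by norm_num))
  obtain ⟨w, hw, hg⟩ := hgrowth _ h1 (by linarith)
  rw [hΩval w hw] at hg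
  have h4 : 2 * S.gap x / (ρ * μ ^ 2) ≤ 2 ^ i := by
    rcases eq_or_lt_of_le hgap0 with h0 | h0
    · rw [← h0]; simp
    · have hpos : 0 < 2 * S.gap x / (ρ * μ ^ 2) := by positivity
      calc _ = (2 : ℝ) ^ Real.logb 2 (2 * S.gap x / (ρ * μ ^ 2)) :=
            (Real.rpow_logb (by norm_num) (by norm_num) hpos).symm
        _ ≤ (2 : ℝ) ^ (i : ℝ) := by
            apply Real.rpow_le_rpow_of_exponent_le (by norm_num)
            exact Nat.le_ceil _
        _ = 2 ^ i := Real.rpow_natCast _ _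
  have h5 : ‖S.restartedAPG x i j - w‖ ≤ μ := by
    refine le_of_sq_le_sq ?_ hμ.le
    rw [div_le_iff₀ (by positivity)] at h4
    have h6 : S.gap x / 2 ^ i ≤ ρ / 2 * μ ^ 2 := by
      rw [div_le_iff₀ (by positivity)]; linarith
    have h7 : ρ / 2 * ‖S.restartedAPG x i j - w‖ ^ 2 ≤ ρ / 2 * μ ^ 2 := by linarith
    exact le_of_mul_le_mul_left h7 (by positivity)
  calc _ ≤ edist (S.restartedAPG x i j) w := Metric.infEDist_le_edist_of_mem hw
    _ = ENNReal.ofReal ‖S.restartedAPG x i j - w‖ := by rw [edist_dist, dist_eq_norm]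
    _ ≤ _ := ENNReal.ofReal_le_ofReal h5

end Assumptions

end Setup
end PGRPD

namespace PGRPD

/-! ### Hoffman constants: sign and projection -/

section HoffmanConstant

variable {ι p q : Type} [Fintype ι] [DecidableEq ι] [Fintype p] [Fintype q]

theorem isClosed_system (M : Matrix p ι ℝ) (N : Matrix q ι ℝ) (r : Vec p) (s : Vec q) :
    IsClosed {z : Vec ι | mul M z = r ∧ ∀ i, mul N z i ≤ s i} := by
  rw [Set.ofPred_and, Set.ofPred_forall]
  refine (isClosed_eq (by fun_prop) continuous_const).inter (isClosed_iInter fun i => ?_)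
  exact isClosed_le (by fun_prop) continuous_const

/-- The nearest solution of a system, seen from a point satisfying the inequalities. -/
theorem IsHoffmanConstant.exists_solution {M : Matrix p ι ℝ} {N : Matrix q ι ℝ} {θ : ℝ}
    (hθ : IsHoffmanConstant M N θ) {s : Vec q} {z w : Vec ι} (hz : ∀ i, mul N z i ≤ s i)
    (hw : ∀ i, mul N w i ≤ s i) :
    ∃ u, mul M u = mul M w ∧ (∀ i, mul N u i ≤ s i) ∧ ‖z - u‖ ≤ θ * ‖mul M z - mul M w‖ := by
  have hne : {u : Vec ι | mul M u = mul M w ∧ ∀ i, mul N u i ≤ s i}.Nonempty := ⟨w, rfl, hw⟩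
  obtain ⟨u, hu, hd⟩ := (isClosed_system M N (mul M w) s).exists_infDist_eq_dist hne z
  refine ⟨u, hu.1, hu.2, ?_⟩
  have := hθ _ s hne z
  rw [hd, dist_eq_norm] at this
  have h0 : ∑ i, (max (mul N z i - s i) 0) ^ 2 = 0 :=
    Finset.sum_eq_zero fun i _ => by rw [max_eq_right (by linarith [hz i])]; simp
  rwa [h0, add_zero, Real.sqrt_sq (norm_nonneg _)] at this

/-- The system with right-hand side `(0, (N v)₊)` is solved by `0`, and `v` violates only its
equations. So some `u` in the kernel of `M` has `‖v - u‖ ≤ θ ‖M v‖`, while `M v = M (v - u)`. This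
makes the complexity factor in (b) at least `1`. -/
theorem IsHoffmanConstant.one_le {M : Matrix p ι ℝ} {N : Matrix q ι ℝ} {θ : ℝ}
    (hθ : IsHoffmanConstant M N θ) {v : Vec ι} (hv : mul M v ≠ 0) :
    0 < θ ∧ ∀ Λ : ℝ, (∀ u, ‖mul M u‖ ^ 2 ≤ Λ * ‖u‖ ^ 2) → 1 ≤ Λ * θ ^ 2 := by
  obtain ⟨u, hu, -, hd⟩ := hθ.exists_solution (s := WithLp.toLp 2 fun i => max (mul N v i) 0)
    (z := v) (w := 0) (fun i => le_max_left _ _) (fun i => by simp)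
  rw [map_zero] at hu
  rw [map_zero, sub_zero] at hd
  have hMv : mul M v = mul M (v - u) := by rw [map_sub, hu, sub_zero]
  have hpos : 0 < ‖mul M v‖ := norm_pos_iff.2 hv
  have hvu : 0 < ‖v - u‖ := norm_pos_iff.2 fun h => hv (by rw [hMv, h, map_zero])
  have hθ0 : 0 < θ := by
    by_contra! h
    nlinarith
  refine ⟨hθ0, fun Λ hΛ => ?_⟩
  have h1 := hΛ (v - u)
  rw [← hMv] at h1
  have h2 : ‖v - u‖ ^ 2 ≤ θ ^ 2 * ‖mul M v‖ ^ 2 := by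
    rw [← mul_pow]; exact pow_le_pow_left₀ hvu.le hd 2
  have hΛ0 : 0 < Λ := by
    by_contra! h
    nlinarith [sq_nonneg ‖v - u‖, pow_pos hpos 2]
  have h3 : ‖mul M v‖ ^ 2 ≤ Λ * θ ^ 2 * ‖mul M v‖ ^ 2 := by
    calc _ ≤ _ := h1
      _ ≤ Λ * (θ ^ 2 * ‖mul M v‖ ^ 2) := by gcongr
      _ = _ := by ring
  by_contra! h
  nlinarith [pow_pos hpos 2]

end HoffmanConstant

/-! ### The dual objective through `Hᵀ z`, recovery of primal points, and dual solutions. -/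

namespace Setup

variable {d n nb : ℕ} {S : Setup d n nb}

theorem mul_ineqMatrix {m : ℕ} (C : Matrix (Fin m) (Fin nb) ℝ) (z : Vec (Fin nb ⊕ Fin n)) :
    mul (ineqMatrix (n := n) C) z = mul C (fstBlock z) := by
  rw [ineqMatrix, mul_fromCols]
  simp [mul]

variable (S) in
/-- The primal point generated by the dual point `z`. -/
noncomputable def primal (x : Vec (Fin d)) (z : Vec (Fin nb ⊕ Fin n)) : Vec (Fin d) :=
  x - (1 / S.τ) • (mul S.H.transpose z + gradient S.f₀ x)

theorem primal_eq (hLf : 0 < S.Lf) (x : Vec (Fin d)) (z : Vec (Fin nb ⊕ Fin n)) :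
    S.primal x z = -((1 / S.τ) • S.dualResidual x z) := by
  have := (τ_pos hLf).ne'
  rw [primal, dualResidual, smul_sub, smul_smul, one_div_mul_cancel this, one_smul]
  abel

theorem τ_smul_primal_sub (hLf : 0 < S.Lf) (x : Vec (Fin d)) (z : Vec (Fin nb ⊕ Fin n)) :
    S.τ • (S.primal x z - x) = -(mul S.H.transpose z + gradient S.f₀ x) := by
  have := (τ_pos hLf).ne'
  rw [primal, sub_sub_cancel_left, smul_neg, smul_smul, mul_one_div_cancel this, one_smul]

namespace Assumptions

variable (hA : S.Assumptions)
include hA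

/-- Feasibility of `(x⁰, y⁰)` eliminates `b̄` and `b`: the linear term of the dual depends on `z`
only through `Hᵀ z` and `⟪y⁰, z₁⟫`. -/
theorem inner_rhs (z : Vec (Fin nb ⊕ Fin n)) :
    ⟪fstBlock z, S.bbar⟫_ℝ + ⟪sndBlock z, S.b⟫_ℝ
      = ⟪S.y0, fstBlock z⟫_ℝ - ⟪mul S.H.transpose z, S.x0⟫_ℝ := by
  have h1 : S.bbar = S.y0 - mul S.Abar S.x0 := by rw [hA.y0_feasible]; abel
  have h2 : S.b = -mul S.A S.x0 := by
    rw [eq_neg_iff_add_eq_zero, add_comm]; exact hA.x0_feasible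
  rw [inner_mul_transpose, mul_H, inner_blocks z]
  simp only [fstBlock_join, sndBlock_join]
  rw [h1, h2, inner_sub_right, inner_neg_right, real_inner_comm]
  ring

/-- The dual objective in terms of `[Ā; A]ᵀ z` and `g⋆(z₁) - ⟨y⁰, z₁⟩`. -/
theorem dualVal_eq (hLf : 0 < S.Lf) (x : Vec (Fin d)) (z : Vec (Fin nb ⊕ Fin n)) :
    S.dualVal x z = 1 / (2 * S.τ) * ‖S.dualResidual x z + S.τ • S.x0‖ ^ 2
      - ⟪gradient S.f₀ x - S.τ • x, S.x0⟫_ℝ - S.τ / 2 * ‖S.x0‖ ^ 2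
      + ((conj S.g (fstBlock z)).toReal - ⟪S.y0, fstBlock z⟫_ℝ) := by
  have h := hA.inner_rhs z
  have hτ := τ_pos hLf
  have h1 : ⟪S.dualResidual x z, S.x0⟫_ℝ = ⟪mul S.H.transpose z, S.x0⟫_ℝ
      + ⟪gradient S.f₀ x - S.τ • x, S.x0⟫_ℝ := by
    rw [← inner_add_left, dualResidual]; congr 1; abel
  rw [dualVal, dualSmooth, sub_sub, h, norm_add_sq_real, inner_smul_right, norm_smul, h1,
    Real.norm_eq_abs, mul_pow, sq_abs]
  field_simp
  ring

/-- Fenchel–Young at `y⁰` removes the conjugate, and what remains is coercive in `Hᵀ z`. Existence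
of dual solutions and the bounds on the gap rest on this. -/
theorem le_dualVal (hLf : 0 < S.Lf) (x : Vec (Fin d)) {z : Vec (Fin nb ⊕ Fin n)}
    (hz : z ∈ S.dualDom) :
    1 / (2 * S.τ) * ‖S.dualResidual x z + S.τ • S.x0‖ ^ 2
      - ⟪gradient S.f₀ x - S.τ • x, S.x0⟫_ℝ - S.τ / 2 * ‖S.x0‖ ^ 2 - (S.g S.y0).toReal
      ≤ S.dualVal x z := by
  rw [hA.dualVal_eq hLf]
  linarith [hA.conj_lower_bound _ hz]

/-! ### Optimality conditions of the dual subproblem -/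

/-- First order optimality. -/
theorem variational (x : Vec (Fin d)) {w u : Vec (Fin nb ⊕ Fin n)} (hw : w ∈ S.Ω x)
    (hu : u ∈ S.dualDom) :
    0 ≤ ⟪S.dualGrad x w, u - w⟫_ℝ
      + ((conj S.g (fstBlock u)).toReal - (conj S.g (fstBlock w)).toReal) := by
  obtain ⟨hwd, hmin⟩ := hA.mem_Ω_iff.1 hw
  refine nonneg_of_forall_add_mul (B := 1 / (2 * S.τ) * ‖mul S.H.transpose (u - w)‖ ^ 2)
    fun t ht0 ht1 => ?_
  obtain ⟨hd, hle⟩ := hA.conj_convex.convex_comb hwd hu (sub_nonneg.2 ht1) ht0.le (by ring)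
  have h1 := hmin ((1 - t) • w + t • u) hd
  have h2 : (1 - t) • w + t • u - w = t • (u - w) := by module
  rw [dualVal, dualVal, dualSmooth_expand x w ((1 - t) • w + t • u), h2, map_smul, norm_smul,
    inner_smul_right, Real.norm_eq_abs, mul_pow, sq_abs] at h1
  simp only [fstBlock_add, fstBlock_smul] at h1
  have h3 : 0 ≤ t * (⟪S.dualGrad x w, u - w⟫_ℝ
      + ((conj S.g (fstBlock u)).toReal - (conj S.g (fstBlock w)).toReal)
      + t * (1 / (2 * S.τ) * ‖mul S.H.transpose (u - w)‖ ^ 2)) := by nlinarith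
  exact nonneg_of_mul_nonneg_right h3 ht0

/-- Quadratic growth in terms of `[Ā; A]ᵀ z`. -/
theorem dual_growth (x : Vec (Fin d)) {w u : Vec (Fin nb ⊕ Fin n)} (hw : w ∈ S.Ω x)
    (hu : u ∈ S.dualDom) :
    1 / (2 * S.τ) * ‖mul S.H.transpose (u - w)‖ ^ 2 ≤ S.dualVal x u - S.dualVal x w := by
  have := hA.variational x hw hu
  rw [dualVal, dualVal, dualSmooth_expand x w u]
  linarith

/-- By `dual_growth` two dual solutions have the same image under `Hᵀ`, so the choice in the
definition of `ν` is well founded. -/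
theorem residual_eq_ν (hLf : 0 < S.Lf) (x : Vec (Fin d)) {w : Vec (Fin nb ⊕ Fin n)}
    (hw : w ∈ S.Ω x) : S.dualResidual x w = S.ν x := by
  refine Classical.epsilon_spec (p := fun v => ∀ z ∈ S.Ω x, S.dualResidual x z = v)
    ⟨S.dualResidual x w, fun z hz => ?_⟩ w hw
  have h1 := hA.dual_growth x hw (hA.mem_Ω_iff.1 hz).1
  have h2 := (hA.mem_Ω_iff.1 hz).2 _ (hA.mem_Ω_iff.1 hw).1
  have hτ := τ_pos hLf
  have h3 : 1 / (2 * S.τ) * ‖mul S.H.transpose (z - w)‖ ^ 2 ≤ 1 / (2 * S.τ) * 0 := by linarith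
  have h4 := le_of_mul_le_mul_left h3 (by positivity)
  have h5 : mul S.H.transpose (z - w) = 0 :=
    norm_eq_zero.1 (pow_eq_zero_iff two_ne_zero |>.1 (le_antisymm h4 (sq_nonneg _)))
  rw [dualResidual_sub x w z, h5, add_zero]

/-- A dual solution generates a primal point which is feasible for the affine constraint. -/
theorem primal_feasible (hLf : 0 < S.Lf) (x : Vec (Fin d)) {w : Vec (Fin nb ⊕ Fin n)}
    (hw : w ∈ S.Ω x) : mul S.A (S.primal x w) + S.b = 0 := by
  have hwd := (hA.mem_Ω_iff.1 hw).1
  -- The block `z₂` is unconstrained. Shifting it by minus its gradient block turns the variational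
  -- inequality into `-‖gradient block‖² ≥ 0`.
  have h1 := hA.variational x hw (u := join (fstBlock w)
    (sndBlock w - sndBlock (S.dualGrad x w))) hwd
  rw [inner_blocks] at h1
  simp only [fstBlock_sub, sndBlock_sub, fstBlock_join, sndBlock_join, sub_self, inner_zero_right,
    sub_sub_cancel_left, inner_neg_right, real_inner_self_eq_norm_sq, add_zero, zero_add] at h1
  have h2 : ‖sndBlock (S.dualGrad x w)‖ = 0 := by nlinarith [sq_nonneg ‖sndBlock (S.dualGrad x w)‖]
  have h3 : (1 / S.τ) • mul S.A (S.dualResidual x w) - S.b = 0 := norm_eq_zero.1 h2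
  rw [primal_eq hLf, map_neg, map_smul, neg_add_eq_zero]
  exact sub_eq_zero.1 h3

theorem fstBlock_mem_subdiff (hLf : 0 < S.Lf) (x : Vec (Fin d)) {w : Vec (Fin nb ⊕ Fin n)}
    (hw : w ∈ S.Ω x) : fstBlock w ∈ subdiff S.g (mul S.Abar (S.primal x w) + S.bbar) := by
  have hwd := (hA.mem_Ω_iff.1 hw).1
  refine hA.mem_subdiff_g hwd (hA.conj_convex.mem_subdiff_iff.2 ⟨hwd, fun u hu => ?_⟩)
  -- With `z₂` fixed, the inequality says that minus the first gradient block, which is `Ā p + b̄`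
  -- at the primal point `p`, lies in `∂g⋆(w₁)`.
  have h1 := hA.variational x hw (u := join u (sndBlock w)) hu
  rw [inner_blocks] at h1
  simp only [fstBlock_sub, sndBlock_sub, fstBlock_join, sndBlock_join, sub_self, inner_zero_right,
    add_zero] at h1
  have h2 : mul S.Abar (S.primal x w) + S.bbar = -fstBlock (S.dualGrad x w) := by
    rw [primal_eq hLf, map_neg, map_smul, dualGrad, fstBlock_join]; abel
  rw [h2, inner_neg_left]
  linarith

/-- The primal point generated by a dual solution minimizes the strongly convex model. -/
theorem primal_optimal (hLf : 0 < S.Lf) (x : Vec (Fin d)) {w : Vec (Fin nb ⊕ Fin n)}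
    (hw : w ∈ S.Ω x) {u : Vec (Fin d)} (hu : mul S.A u + S.b = 0)
    (hud : mul S.Abar u + S.bbar ∈ dom S.g) :
    ⟪gradient S.f₀ x, S.primal x w - x⟫_ℝ + S.τ / 2 * ‖S.primal x w - x‖ ^ 2
        + (S.g (mul S.Abar (S.primal x w) + S.bbar)).toReal + S.τ / 2 * ‖u - S.primal x w‖ ^ 2
      ≤ ⟪gradient S.f₀ x, u - x⟫_ℝ + S.τ / 2 * ‖u - x‖ ^ 2
        + (S.g (mul S.Abar u + S.bbar)).toReal := by
  have h1 := (hA.g_convex.mem_subdiff_iff.1 (hA.fstBlock_mem_subdiff hLf x hw)).2 _ hud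
  have h2 := hA.primal_feasible hLf x hw
  have h3 := τ_smul_primal_sub hLf x w
  set p := S.primal x w
  have h4 : mul S.A (u - p) = 0 := by
    rw [map_sub, ← add_sub_add_right_eq_sub _ _ S.b, hu, h2, sub_zero]
  have h5 : mul S.Abar u + S.bbar - (mul S.Abar p + S.bbar) = mul S.Abar (u - p) := by
    rw [map_sub]; abel
  have h6 : ⟪mul S.H.transpose w, u - p⟫_ℝ = ⟪fstBlock w, mul S.Abar (u - p)⟫_ℝ := by
    rw [inner_mul_transpose, mul_H, inner_blocks]
    simp [h4]
  have h7 : ⟪S.τ • (p - x), u - p⟫_ℝ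
      = -⟪fstBlock w, mul S.Abar (u - p)⟫_ℝ - ⟪gradient S.f₀ x, u - p⟫_ℝ := by
    rw [h3, inner_neg_left, inner_add_left, h6]; ring
  rw [inner_smul_left] at h7
  simp only [conj_trivial] at h7
  have h8 : ‖u - x‖ ^ 2 = ‖p - x‖ ^ 2 + 2 * ⟪p - x, u - p⟫_ℝ + ‖u - p‖ ^ 2 := by
    rw [← norm_add_sq_real]; congr 2; abel
  have h9 : ⟪gradient S.f₀ x, u - x⟫_ℝ
      = ⟪gradient S.f₀ x, p - x⟫_ℝ + ⟪gradient S.f₀ x, u - p⟫_ℝ := by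
    rw [← inner_add_right]; congr 1; abel
  rw [h5] at h1
  rw [h8, h9]
  linarith

/-! ### Existence of dual solutions and the acceptance criterion: full row rank -/

/-- Full row rank makes `‖Hᵀ z‖` dominate `‖z‖`, so coercivity in `Hᵀ z` is coercivity in `z`. -/
theorem Ω_nonempty_of_fullRowRank (hLf : 0 < S.Lf) (hH : S.H ≠ 0) (hR : FullRowRank S.H)
    (x : Vec (Fin d)) : (S.Ω x).Nonempty := by
  have hτ := τ_pos hLf
  have hl := hR.lamMinPos_pos hH
  set v := gradient S.f₀ x - S.τ • x with hv
  set M := S.dualVal x S.zini + ⟪v, S.x0⟫_ℝ + S.τ / 2 * ‖S.x0‖ ^ 2 + (S.g S.y0).toReal with hM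
  refine exists_forall_le_of_coercive (hA.dual_lsc x) (z₀ := S.zini) (t := S.dualVal x S.zini)
    (R := (1 + 2 * S.τ * |M| + ‖v + S.τ • S.x0‖) / √(lamMinPos S.H))
    (hA.dual_coe hA.zini_mem).le fun z hz => ?_
  by_cases hzd : z ∈ S.dualDom
  swap
  · rw [hA.dual_top hzd]; exact le_top
  rw [hA.dual_coe hzd]
  norm_cast
  have h1 := hA.le_dualVal hLf x hzd
  have h2 : S.dualResidual x z + S.τ • S.x0 = mul S.H.transpose z + (v + S.τ • S.x0) := by
    rw [dualResidual, hv]; abel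
  have h3 : √(lamMinPos S.H) * ‖z‖ ≤ ‖mul S.H.transpose z‖ := by
    refine le_of_sq_le_sq ?_ (norm_nonneg _)
    rw [mul_pow, Real.sq_sqrt hl.le]
    exact hR.le_norm_mul_transpose_sq z
  rw [div_lt_iff₀ (Real.sqrt_pos.2 hl)] at hz
  have h4 : ‖mul S.H.transpose z‖ ≤ ‖S.dualResidual x z + S.τ • S.x0‖ + ‖v + S.τ • S.x0‖ := by
    rw [h2]
    simpa using norm_sub_le (mul S.H.transpose z + (v + S.τ • S.x0)) (v + S.τ • S.x0)
  set s := ‖S.dualResidual x z + S.τ • S.x0‖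
  have h5 : 1 + 2 * S.τ * |M| ≤ s := by linarith
  have h6 : 0 ≤ 2 * S.τ * |M| := by positivity
  have h7 : |M| ≤ 1 / (2 * S.τ) * s ^ 2 := by
    rw [one_div, ← div_eq_inv_mul, le_div_iff₀ (by positivity)]
    nlinarith
  have := le_abs_self M
  linarith

theorem accepts_fullRowRank (hLf : 0 < S.Lf) (hH : S.H ≠ 0) (hR : FullRowRank S.H) {ε : ℝ} {k : ℕ}
    (x : Vec (Fin d)) (hμ : 0 < S.mu S.fullRankParams ε k x) :
    S.Accepts x (S.mu S.fullRankParams ε k x) (S.zNext S.fullRankParams ε k x) := by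
  have hτ := τ_pos hLf
  have hl := hR.lamMinPos_pos hH
  have hΩ := hA.Ω_nonempty_of_fullRowRank hLf hH hR x
  obtain ⟨w, hw⟩ := hΩ
  refine hA.accepts_of_growth hLf hH x ⟨w, hw⟩ (ρ := lamMinPos S.H / S.τ) (by positivity)
    (fun z hz _ => ⟨w, hw, ?_⟩) ?_ hμ
  · have h1 := hA.dual_growth x hw hz
    have h2 := hR.le_norm_mul_transpose_sq (z - w)
    calc _ = 1 / (2 * S.τ) * (lamMinPos S.H * ‖z - w‖ ^ 2) := by field_simp
      _ ≤ 1 / (2 * S.τ) * ‖mul S.H.transpose (z - w)‖ ^ 2 := by gcongr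
      _ ≤ _ := h1
  · have h1 : 2 * √(2 * S.LD / (lamMinPos S.H / S.τ)) = 2 * √2 * condNumber S.H := by
      rw [condNumber, mul_assoc, ← Real.sqrt_mul (by norm_num), LD]
      congr 2
      field_simp
    rw [h1]
    exact Nat.le_ceil _

/-! ### The polyhedral case -/

section Polyhedral

variable {m : ℕ} {C : Matrix (Fin m) (Fin nb) ℝ} {c : Vec (Fin m)} (hP : S.IsPolyhedral C c)
include hP

theorem polyhedron_nonempty : ∃ u : Vec (Fin nb), ∀ i, mul C u i ≤ c i := by
  by_contra! h
  have : IsEmpty {u : Vec (Fin nb) // ∀ i, mul C u i ≤ c i} :=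
    ⟨fun u => by obtain ⟨i, hi⟩ := h u.1; exact absurd (u.2 i) (not_le.2 hi)⟩
  refine hA.g_convex.ne_bot 0 ?_
  rw [hP 0]
  exact iSup_of_empty _

theorem conj_polyhedral {z : Vec (Fin nb)} (hz : ∀ i, mul C z i ≤ c i) : conj S.g z = 0 := by
  refine le_antisymm ?_ ?_
  · refine iSup_le fun y => ?_
    have h1 : ((⟪z, y⟫_ℝ : ℝ) : EReal) ≤ S.g y := by
      rw [hP y]
      exact le_iSup (fun u : {u : Vec (Fin nb) // ∀ i, mul C u i ≤ c i} =>
        ((⟪u.1, y⟫_ℝ : ℝ) : EReal)) ⟨z, hz⟩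
    rw [real_inner_comm]
    exact EReal.sub_nonpos.2 h1
  · have h1 := le_conj S.g 0 z
    have h2 : S.g 0 = 0 := by
      rw [hP 0]
      obtain ⟨u, hu⟩ := hA.polyhedron_nonempty hP
      have : Nonempty {u : Vec (Fin nb) // ∀ i, mul C u i ≤ c i} := ⟨⟨u, hu⟩⟩
      simp
    rw [h2] at h1
    simpa using h1

/-- If row `i` is violated at `z`, then along the ray `t • C i` the bound `g(t • C i) ≤ t * c i`
makes `⟪t • C i, z⟫ - g(t • C i)` tend to infinity. -/
theorem mem_dom_conj_polyhedral {z : Vec (Fin nb)} :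
    z ∈ dom (conj S.g) ↔ ∀ i, mul C z i ≤ c i := by
  constructor
  · intro hz i
    by_contra! hi
    set a : Vec (Fin nb) := WithLp.toLp 2 (C i) with ha
    have hg : ∀ t : ℝ, 0 ≤ t → S.g (t • a) ≤ ((t * c i : ℝ) : EReal) := by
      intro t ht
      rw [hP]
      refine iSup_le fun u => ?_
      norm_cast
      rw [inner_smul_right, real_inner_comm, ha, ← mul_apply]
      exact mul_le_mul_of_nonneg_left (u.2 i) ht
    have hK : ∀ t : ℝ, 0 ≤ t → t * (mul C z i - c i) ≤ (conj S.g z).toReal := by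
      intro t ht
      have hd := mem_dom_of_le_coe (hg t ht)
      have h1 := hA.g_convex.le_conj_toReal hd hz
      have h2 := hg t ht
      rw [← hA.g_convex.coe_toReal hd] at h2
      have h3 : (S.g (t • a)).toReal ≤ t * c i := by exact_mod_cast h2
      rw [inner_smul_left, ha, ← mul_apply] at h1
      simp only [conj_trivial] at h1
      linarith
    have hpos : 0 < mul C z i - c i := by linarith
    have h4 := hK ((|(conj S.g z).toReal| + 1) / (mul C z i - c i)) (by positivity)
    rw [div_mul_cancel₀ _ hpos.ne'] at h4
    linarith [le_abs_self (conj S.g z).toReal]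
  · intro hz h
    rw [hA.conj_polyhedral hP hz] at h
    exact EReal.zero_ne_top h

theorem mem_dualDom_polyhedral {z : Vec (Fin nb ⊕ Fin n)} :
    z ∈ S.dualDom ↔ ∀ i, mul (ineqMatrix (n := n) C) z i ≤ c i := by
  rw [mul_ineqMatrix]
  exact hA.mem_dom_conj_polyhedral hP

theorem conj_toReal_polyhedral {z : Vec (Fin nb ⊕ Fin n)} (hz : z ∈ S.dualDom) :
    (conj S.g (fstBlock z)).toReal = 0 := by
  rw [hA.conj_polyhedral hP ((hA.mem_dom_conj_polyhedral hP).1 hz)]; rfl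

/-- Level sets of the dual may be unbounded, but on its domain the dual value depends only on `M z =
(Hᵀ z, ⟪y⁰, z₁⟫)`, which is bounded on the initial level set. A Hoffman constant of `M` provides a
point with the same image at bounded distance from `z^ini`, so it is enough to minimize over a ball.
-/
theorem Ω_nonempty_of_polyhedral (hLf : 0 < S.Lf) (x : Vec (Fin d)) : (S.Ω x).Nonempty := by
  have hτ := τ_pos hLf
  let M : Matrix (Fin d ⊕ Unit) (Fin nb ⊕ Fin n) ℝ :=
    Matrix.fromRows S.H.transpose (Matrix.of fun _ : Unit => Sum.elim S.y0 0)
  obtain ⟨θ, hθ⟩ := exists_isHoffmanConstant M (ineqMatrix (n := n) C)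
  have hM : ∀ z, fstBlock (mul M z) = mul S.H.transpose z := fun z => by
    rw [mul_fromRows, fstBlock_join]
  have hM2 : ∀ z, sndBlock (mul M z) () = ⟪S.y0, fstBlock z⟫_ℝ := fun z => by
    rw [mul_fromRows, sndBlock_join, mul_apply, inner_blocks]
    have : sndBlock (WithLp.toLp 2 (Matrix.of (fun _ : Unit => Sum.elim S.y0 (0 : Fin n → ℝ)) ()))
      = 0 := by ext i; rfl
    rw [this, inner_zero_left, add_zero]
    rfl
  have hval : ∀ z w, z ∈ S.dualDom → w ∈ S.dualDom → mul M z = mul M w →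
      S.dualVal x z = S.dualVal x w := by
    intro z w hz hw h
    have h1 : mul S.H.transpose z = mul S.H.transpose w := by rw [← hM, ← hM, h]
    have h2 : ⟪S.y0, fstBlock z⟫_ℝ = ⟪S.y0, fstBlock w⟫_ℝ := by rw [← hM2, ← hM2, h]
    rw [hA.dualVal_eq hLf, hA.dualVal_eq hLf, hA.conj_toReal_polyhedral hP hz,
      hA.conj_toReal_polyhedral hP hw, h2, dualResidual, dualResidual, h1]
  set v := gradient S.f₀ x - S.τ • x with hv
  set K := S.dualVal x S.zini + ⟪v, S.x0⟫_ℝ + S.τ / 2 * ‖S.x0‖ ^ 2 + (S.g S.y0).toReal with hK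
  set R₁ := 1 + 2 * S.τ * |K| + ‖v + S.τ • S.x0‖ with hR₁
  set R₂ := |(S.g S.y0).toReal| + |K| with hR₂
  have hbd : ∀ z ∈ S.dualDom, S.dualVal x z ≤ S.dualVal x S.zini → ‖mul M z‖ ≤ R₁ + R₂ := by
    intro z hz hle
    have h1 := hA.le_dualVal hLf x hz
    have h2 := hA.dualVal_eq hLf x z
    have h3 : S.dualResidual x z + S.τ • S.x0 = mul S.H.transpose z + (v + S.τ • S.x0) := by
      rw [dualResidual, hv]; abel
    have h4 : ‖mul S.H.transpose z‖ ≤ ‖S.dualResidual x z + S.τ • S.x0‖ + ‖v + S.τ • S.x0‖ := by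
      rw [h3]
      simpa using norm_sub_le (mul S.H.transpose z + (v + S.τ • S.x0)) (v + S.τ • S.x0)
    set s := ‖S.dualResidual x z + S.τ • S.x0‖
    have h5 : 1 / (2 * S.τ) * s ^ 2 ≤ |K| := by linarith [le_abs_self K]
    rw [one_div, ← div_eq_inv_mul, div_le_iff₀ (by positivity)] at h5
    have h6 : s ≤ 1 + 2 * S.τ * |K| := by nlinarith [sq_nonneg (s - 1)]
    have h7 := hA.conj_lower_bound _ hz
    rw [hA.conj_toReal_polyhedral hP hz] at h2 h7
    have h8 : 0 ≤ 1 / (2 * S.τ) * s ^ 2 := by positivity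
    have h9 : |⟪S.y0, fstBlock z⟫_ℝ| ≤ R₂ := by
      rw [hR₂, abs_le]
      have e1 := le_abs_self K
      have e2 := le_abs_self (S.g S.y0).toReal
      have e3 := neg_abs_le (S.g S.y0).toReal
      have e4 := abs_nonneg K
      constructor <;> linarith
    have h10 : ‖mul M z‖ ^ 2 ≤ R₁ ^ 2 + R₂ ^ 2 := by
      rw [norm_sq_blocks, hM]
      have e1 : ‖sndBlock (mul M z)‖ ^ 2 = ⟪S.y0, fstBlock z⟫_ℝ ^ 2 := by
        rw [EuclideanSpace.norm_sq_eq]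
        simp [hM2]
      rw [e1, ← sq_abs ⟪S.y0, fstBlock z⟫_ℝ]
      gcongr
      linarith
    have hR₁0 : 0 ≤ R₁ := by positivity
    have hR₂0 : 0 ≤ R₂ := by positivity
    exact le_of_sq_le_sq (by nlinarith) (by positivity)
  refine exists_forall_le_of_lsc (hA.dual_lsc x)
    (R := ‖S.zini‖ + |θ| * (‖mul M S.zini‖ + (R₁ + R₂))) fun z => ?_
  have hR0 : 0 ≤ R₁ + R₂ := by positivity
  by_cases hz : z ∈ S.dualDom ∧ S.dualVal x z ≤ S.dualVal x S.zini
  · obtain ⟨u, hu1, hu2, hu3⟩ := hθ.exists_solution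
      ((hA.mem_dualDom_polyhedral hP).1 hA.zini_mem) ((hA.mem_dualDom_polyhedral hP).1 hz.1)
    have hud := (hA.mem_dualDom_polyhedral hP).2 hu2
    refine ⟨u, ?_, ?_⟩
    · have h1 : ‖u‖ ≤ ‖S.zini‖ + ‖S.zini - u‖ := by
        simpa using norm_sub_le S.zini (S.zini - u)
      have h2 : θ * ‖mul M S.zini - mul M z‖ ≤ |θ| * (‖mul M S.zini‖ + (R₁ + R₂)) := by
        gcongr
        · exact le_abs_self θ
        · exact (norm_sub_le _ _).trans (by linarith [hbd z hz.1 hz.2])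
      linarith
    · rw [hA.dual_coe hud, hA.dual_coe hz.1, hval u z hud hz.1 hu1]
  · refine ⟨S.zini, le_add_of_nonneg_right (by positivity), ?_⟩
    rw [hA.dual_coe hA.zini_mem]
    by_cases hzd : z ∈ S.dualDom
    · rw [hA.dual_coe hzd]
      norm_cast
      by_contra! h
      exact hz ⟨hzd, h.le⟩
    · rw [hA.dual_top hzd]; exact le_top

end Polyhedral

end Assumptions

end Setup
end PGRPD

/-! ### Quadratic growth and acceptance for polyhedral `g`. -/

namespace PGRPD

namespace Setup

variable {d n nb : ℕ} {S : Setup d n nb}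

variable (S) in
/-- The matrix of the equations `[Ā; A]ᵀ z = r`, `-z₁ᵀ b̄ - z₂ᵀ b = t`. -/
def affineMatrix : Matrix (Fin d ⊕ Unit) (Fin nb ⊕ Fin n) ℝ :=
  Matrix.fromRows S.H.transpose (Matrix.of fun (_ : Unit) i => -Sum.elim S.bbar S.b i)

theorem fstBlock_affineMatrix (z : Vec (Fin nb ⊕ Fin n)) :
    fstBlock (mul S.affineMatrix z) = mul S.H.transpose z := by
  rw [affineMatrix, mul_fromRows, fstBlock_join]

theorem norm_affineMatrix_sq (z : Vec (Fin nb ⊕ Fin n)) :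
    ‖mul S.affineMatrix z‖ ^ 2 = ‖mul S.H.transpose z‖ ^ 2
      + (⟪fstBlock z, S.bbar⟫_ℝ + ⟪sndBlock z, S.b⟫_ℝ) ^ 2 := by
  rw [norm_sq_blocks, fstBlock_affineMatrix]
  congr 1
  have h : sndBlock (mul S.affineMatrix z) ()
      = -(⟪fstBlock z, S.bbar⟫_ℝ + ⟪sndBlock z, S.b⟫_ℝ) := by
    rw [affineMatrix, mul_fromRows, sndBlock_join, mul_apply]
    have : WithLp.toLp 2 (Matrix.of (fun (_ : Unit) i => -Sum.elim S.bbar.ofLp S.b.ofLp i) ())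
        = -join S.bbar S.b := by ext i; rfl
    rw [this, inner_neg_left, inner_blocks, fstBlock_join, sndBlock_join, real_inner_comm,
      real_inner_comm (sndBlock z)]
  rw [EuclideanSpace.norm_sq_eq]
  simp only [Finset.univ_unique, PUnit.default_eq_unit, Finset.sum_singleton, Real.norm_eq_abs,
    sq_abs, h]
  ring

/-- The elementary estimate behind quadratic growth: `a` is the change of the residual, `l` the change
of the linear part, and `p - l` the (nonnegative) first order change of the objective. -/
theorem affine_growth_estimate {τ N a l p G γ : ℝ} (hτ : 0 < τ) (hp : |p| ≤ 1 / τ * (N * a))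
    (hG : G = p - l + 1 / (2 * τ) * a ^ 2) (hpl : 0 ≤ p - l) (hGγ : G ≤ γ) :
    a ^ 2 + l ^ 2 ≤ 2 * G * (τ + γ + 2 * N ^ 2 / τ) := by
  have hq0 : 0 ≤ 1 / (2 * τ) * a ^ 2 := by positivity
  have ha2 : a ^ 2 = 2 * τ * (1 / (2 * τ) * a ^ 2) := by field_simp
  set q := 1 / (2 * τ) * a ^ 2
  have hG0 : 0 ≤ G := by linarith
  have h1 : a ^ 2 ≤ 2 * τ * G := by
    rw [ha2]
    exact mul_le_mul_of_nonneg_left (by linarith) (by positivity)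
  have hp2 : p ^ 2 ≤ 2 * N ^ 2 / τ * G := by
    have e2 := pow_le_pow_left₀ (abs_nonneg _) hp 2
    rw [sq_abs] at e2
    calc _ ≤ _ := e2
      _ = N ^ 2 / τ ^ 2 * a ^ 2 := by field_simp
      _ ≤ N ^ 2 / τ ^ 2 * (2 * τ * G) := by gcongr
      _ = _ := by field_simp
  have e2 : p - l ≤ G := by linarith
  -- Write `l = p - (p - l)`. Cauchy–Schwarz controls `p`, and `p - l` lies in `[0, G]`, where `G ≤
  -- γ` turns `G²` into `G * γ`.
  have e3 : l ^ 2 ≤ 2 * (p - l) ^ 2 + 2 * p ^ 2 := by nlinarith [sq_nonneg (p + (p - l))]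
  have e4 : (p - l) ^ 2 ≤ G * γ := by
    calc (p - l) ^ 2 ≤ G ^ 2 := pow_le_pow_left₀ hpl e2 2
      _ = G * G := sq G
      _ ≤ G * γ := mul_le_mul_of_nonneg_left hGγ hG0
  calc a ^ 2 + l ^ 2 ≤ 2 * τ * G + (2 * (G * γ) + 2 * (2 * N ^ 2 / τ * G)) := by linarith
    _ = _ := by ring

namespace Assumptions

variable (hA : S.Assumptions)
include hA

theorem dualVal_eq_of_Ω (x : Vec (Fin d)) {w u : Vec (Fin nb ⊕ Fin n)} (hw : w ∈ S.Ω x)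
    (hu : u ∈ S.dualDom) (h : S.dualVal x u = S.dualVal x w) : u ∈ S.Ω x :=
  hA.mem_Ω_iff.2 ⟨hu, fun v hv => h ▸ (hA.mem_Ω_iff.1 hw).2 v hv⟩

theorem ρPoly_pos (hLf : 0 < S.Lf) {θ : ℝ} (hθ0 : 0 < θ) (x : Vec (Fin d))
    (hΩ : (S.Ω x).Nonempty) : 0 < S.ρPoly θ x := by
  have hτ := τ_pos hLf
  have := hA.gap_nonneg hΩ
  rw [ρPoly]
  split_ifs <;> positivity

section Polyhedral

variable {m : ℕ} {C : Matrix (Fin m) (Fin nb) ℝ} {c : Vec (Fin m)} (hP : S.IsPolyhedral C c)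
include hP

/-- Quadratic growth for homogeneous constraints. -/
theorem growth_homogeneous (hLf : 0 < S.Lf) (hb : S.bbar = 0 ∧ S.b = 0) {p : Type} [Fintype p]
    {M : Matrix p (Fin nb ⊕ Fin n) ℝ} (hM : ∀ z, ‖mul M z‖ = ‖mul S.H.transpose z‖) {θ : ℝ}
    (hθ : IsHoffmanConstant M (ineqMatrix (n := n) C) θ) (hθ0 : 0 < θ) (x : Vec (Fin d))
    (hΩ : (S.Ω x).Nonempty) {z : Vec (Fin nb ⊕ Fin n)} (hz : z ∈ S.dualDom) :
    ∃ u ∈ S.Ω x, (θ ^ 2 * S.τ)⁻¹ / 2 * ‖z - u‖ ^ 2 ≤ S.dualVal x z - S.dualVal x u := by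
  have hτ := τ_pos hLf
  obtain ⟨w, hw⟩ := hΩ
  have hwd := (hA.mem_Ω_iff.1 hw).1
  obtain ⟨u, hu1, hu2, hu3⟩ := hθ.exists_solution ((hA.mem_dualDom_polyhedral hP).1 hz)
    ((hA.mem_dualDom_polyhedral hP).1 hwd)
  have hud := (hA.mem_dualDom_polyhedral hP).2 hu2
  have hHu : mul S.H.transpose u = mul S.H.transpose w := by
    have h := hM (u - w)
    rw [map_sub, hu1, sub_self, norm_zero] at h
    rw [← sub_eq_zero, ← map_sub]
    exact norm_eq_zero.1 h.symm
  have hval : S.dualVal x u = S.dualVal x w := by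
    rw [dualVal, dualVal, dualSmooth, dualSmooth, hA.conj_toReal_polyhedral hP hud,
      hA.conj_toReal_polyhedral hP hwd, dualResidual, dualResidual, hHu, hb.1, hb.2]
    simp
  refine ⟨u, hA.dualVal_eq_of_Ω x hw hud hval, ?_⟩
  rw [hval]
  have h1 := hA.dual_growth x hw hz
  rw [← map_sub, hM] at hu3
  have h2 := pow_le_pow_left₀ (norm_nonneg _) hu3 2
  rw [mul_pow] at h2
  calc _ ≤ (θ ^ 2 * S.τ)⁻¹ / 2 * (θ ^ 2 * ‖mul S.H.transpose (z - w)‖ ^ 2) := by gcongr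
    _ = 1 / (2 * S.τ) * ‖mul S.H.transpose (z - w)‖ ^ 2 := by field_simp
    _ ≤ _ := h1

/-- Quadratic growth on the initial level set for inhomogeneous constraints. -/
theorem growth_affine (hLf : 0 < S.Lf) {θ : ℝ}
    (hθ : IsHoffmanConstant S.affineMatrix (ineqMatrix (n := n) C) θ) (hθ0 : 0 < θ)
    (x : Vec (Fin d)) (hΩ : (S.Ω x).Nonempty) {z : Vec (Fin nb ⊕ Fin n)} (hz : z ∈ S.dualDom)
    (hzl : S.dualVal x z ≤ S.dualVal x S.zini) :
    ∃ u ∈ S.Ω x, (θ ^ 2 * (S.τ + S.gap x + 2 * ‖S.ν x‖ ^ 2 / S.τ))⁻¹ / 2 * ‖z - u‖ ^ 2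
      ≤ S.dualVal x z - S.dualVal x u := by
  have hτ := τ_pos hLf
  obtain ⟨w, hw⟩ := hΩ
  have hwd := (hA.mem_Ω_iff.1 hw).1
  have hgap0 := hA.gap_nonneg ⟨w, hw⟩
  obtain ⟨u, hu1, hu2, hu3⟩ := hθ.exists_solution ((hA.mem_dualDom_polyhedral hP).1 hz)
    ((hA.mem_dualDom_polyhedral hP).1 hwd)
  have hud := (hA.mem_dualDom_polyhedral hP).2 hu2
  have h0 := norm_affineMatrix_sq (S := S) (u - w)
  rw [map_sub, hu1, sub_self, norm_zero] at h0
  have hHu : mul S.H.transpose (u - w) = 0 := by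
    refine norm_eq_zero.1 (pow_eq_zero_iff two_ne_zero |>.1 (le_antisymm ?_ (sq_nonneg _)))
    nlinarith [sq_nonneg (⟪fstBlock (u - w), S.bbar⟫_ℝ + ⟪sndBlock (u - w), S.b⟫_ℝ)]
  have hlu : ⟪fstBlock (u - w), S.bbar⟫_ℝ + ⟪sndBlock (u - w), S.b⟫_ℝ = 0 := by
    refine pow_eq_zero_iff two_ne_zero |>.1 (le_antisymm ?_ (sq_nonneg _))
    nlinarith [sq_nonneg ‖mul S.H.transpose (u - w)‖]
  -- `u` and `w` agree in `Hᵀ` and in the linear term, and `g⋆` vanishes on its domain.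
  have hval : S.dualVal x u = S.dualVal x w := by
    rw [dualVal, dualVal, dualSmooth_expand x w u, hA.conj_toReal_polyhedral hP hud,
      hA.conj_toReal_polyhedral hP hwd, hHu, inner_dualGrad, hHu]
    simp only [inner_zero_right, norm_zero]
    linarith
  refine ⟨u, hA.dualVal_eq_of_Ω x hw hud hval, ?_⟩
  rw [hval]
  have h1 := hA.dual_growth x hw hz
  have h2 := hA.variational x hw hz
  have h3 : S.dualVal x z - S.dualVal x w = ⟪S.dualGrad x w, z - w⟫_ℝ
      + 1 / (2 * S.τ) * ‖mul S.H.transpose (z - w)‖ ^ 2 := by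
    rw [dualVal, dualVal, dualSmooth_expand x w z, hA.conj_toReal_polyhedral hP hz,
      hA.conj_toReal_polyhedral hP hwd]
    ring
  rw [hA.conj_toReal_polyhedral hP hz, hA.conj_toReal_polyhedral hP hwd] at h2
  rw [inner_dualGrad, hA.residual_eq_ν hLf x hw] at h2 h3
  have hgap := hA.gap_eq hw
  rw [← map_sub] at hu3
  have h4 := pow_le_pow_left₀ (norm_nonneg _) hu3 2
  rw [mul_pow, norm_affineMatrix_sq] at h4
  set l := ⟪fstBlock (z - w), S.bbar⟫_ℝ + ⟪sndBlock (z - w), S.b⟫_ℝ with hl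
  have hG : S.dualVal x z - S.dualVal x w ≤ S.gap x := by rw [hgap]; linarith
  have hCS : |1 / S.τ * ⟪S.ν x, mul S.H.transpose (z - w)⟫_ℝ|
      ≤ 1 / S.τ * (‖S.ν x‖ * ‖mul S.H.transpose (z - w)‖) := by
    rw [abs_mul, abs_of_pos (by positivity : 0 < 1 / S.τ)]
    gcongr
    exact abs_real_inner_le_norm _ _
  have h5 := affine_growth_estimate hτ hCS (l := l) (by rw [h3, hl]; ring)
    (by rw [hl]; linarith) hG
  set a := ‖mul S.H.transpose (z - w)‖
  set N := ‖S.ν x‖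
  set G := S.dualVal x z - S.dualVal x w
  have hpos : 0 < S.τ + S.gap x + 2 * N ^ 2 / S.τ := by positivity
  calc _ ≤ (θ ^ 2 * (S.τ + S.gap x + 2 * N ^ 2 / S.τ))⁻¹ / 2 * (θ ^ 2 * (a ^ 2 + l ^ 2)) := by
        gcongr
    _ ≤ (θ ^ 2 * (S.τ + S.gap x + 2 * N ^ 2 / S.τ))⁻¹ / 2
        * (θ ^ 2 * (2 * G * (S.τ + S.gap x + 2 * N ^ 2 / S.τ))) := by gcongr
    _ = G := by field_simp

theorem accepts_homogeneous (hLf : 0 < S.Lf) (hH : S.H ≠ 0) (hb : S.bbar = 0 ∧ S.b = 0) {p : Type}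
    [Fintype p] {M : Matrix p (Fin nb ⊕ Fin n) ℝ} (hM : ∀ z, ‖mul M z‖ = ‖mul S.H.transpose z‖)
    {θ : ℝ} (hθ : IsHoffmanConstant M (ineqMatrix (n := n) C) θ) (hθ0 : 0 < θ) {w : ℕ → ℝ} {ε : ℝ}
    {k : ℕ} (x : Vec (Fin d)) (hμ : 0 < S.mu (S.polyParams θ w) ε k x) :
    S.Accepts x (S.mu (S.polyParams θ w) ε k x) (S.zNext (S.polyParams θ w) ε k x) := by
  have hΩ := hA.Ω_nonempty_of_polyhedral hP hLf x
  refine hA.accepts_of_growth hLf hH x hΩ (ρ := S.ρPoly θ x) (hA.ρPoly_pos hLf hθ0 x hΩ)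
    (fun z hz _ => ?_) (Nat.le_ceil _) hμ
  rw [ρPoly, if_pos hb]
  exact hA.growth_homogeneous hP hLf hb hM hθ hθ0 x hΩ hz

theorem accepts_affine (hLf : 0 < S.Lf) (hH : S.H ≠ 0) {θ : ℝ}
    (hθ : S.IsHoffmanAffine C θ) (hθ0 : 0 < θ) {w : ℕ → ℝ} {ε : ℝ}
    {k : ℕ} (x : Vec (Fin d)) (hμ : 0 < S.mu (S.polyParams θ w) ε k x) :
    S.Accepts x (S.mu (S.polyParams θ w) ε k x) (S.zNext (S.polyParams θ w) ε k x) := by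
  by_cases hb : S.bbar = 0 ∧ S.b = 0
  · refine hA.accepts_homogeneous hP hLf hH hb (M := S.affineMatrix) (fun z => ?_) hθ hθ0 x hμ
    -- For `b̄ = 0`, `b = 0` the extra row of `affineMatrix` is zero, so its residual is that of
    -- `Hᵀ` and the homogeneous case applies to this matrix.
    have := norm_affineMatrix_sq (S := S) z
    rw [hb.1, hb.2] at this
    simp only [inner_zero_right, add_zero, ne_eq, OfNat.ofNat_ne_zero, not_false_eq_true,
      zero_pow] at this
    exact (pow_left_inj₀ (norm_nonneg _) (norm_nonneg _) two_ne_zero).1 this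
  · have hΩ := hA.Ω_nonempty_of_polyhedral hP hLf x
    refine hA.accepts_of_growth hLf hH x hΩ (ρ := S.ρPoly θ x) (hA.ρPoly_pos hLf hθ0 x hΩ)
      (fun z hz hzl => ?_) (Nat.le_ceil _) hμ
    rw [ρPoly, if_neg hb]
    exact hA.growth_affine hP hLf hθ hθ0 x hΩ hz hzl

end Polyhedral

end Assumptions

theorem IsHoffman.pos {m : ℕ} {C : Matrix (Fin m) (Fin nb) ℝ} {θ : ℝ} (hH : S.H ≠ 0)
    (hθ : S.IsHoffman C θ) : 0 < θ ∧ 1 ≤ lamMax S.H * θ ^ 2 := by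
  obtain ⟨v, hv⟩ := exists_mul_transpose_ne_zero hH
  obtain ⟨h1, h2⟩ := IsHoffmanConstant.one_le hθ hv
  exact ⟨h1, h2 _ (norm_mul_transpose_sq_le S.H)⟩

theorem IsHoffmanAffine.pos {m : ℕ} {C : Matrix (Fin m) (Fin nb) ℝ} {θ : ℝ} (hH : S.H ≠ 0)
    (hθ : S.IsHoffmanAffine C θ) : 0 < θ := by
  obtain ⟨v, hv⟩ := exists_mul_transpose_ne_zero hH
  refine (IsHoffmanConstant.one_le (M := S.affineMatrix) hθ (v := v) fun h => hv ?_).1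
  rw [← fstBlock_affineMatrix, h]; rfl

end Setup
end PGRPD

/-! ### The descent lemma, the inner accuracy and a single outer iteration. -/

namespace PGRPD

/-- The descent lemma: first order expansion of a function with Lipschitz gradient. -/
theorem abs_sub_linearization_le {E : Type*} [NormedAddCommGroup E] [InnerProductSpace ℝ E]
    [CompleteSpace E] {f : E → ℝ} {L : ℝ} (hf : Differentiable ℝ f)
    (hL : ∀ x x', ‖gradient f x - gradient f x'‖ ≤ L * ‖x - x'‖) (x u : E) :
    |f u - f x - ⟪gradient f x, u - x⟫_ℝ| ≤ L / 2 * ‖u - x‖ ^ 2 := by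
  set v := u - x with hv
  have hd : ∀ t : ℝ, HasDerivAt (fun t : ℝ => f (x + t • v)) ⟪gradient f (x + t • v), v⟫_ℝ t := by
    intro t
    have h1 : HasDerivAt (fun t : ℝ => x + t • v) v t := by
      simpa using ((hasDerivAt_id t).smul_const v).const_add x
    have h2 := (hf (x + t • v)).hasGradientAt.hasFDerivAt.comp_hasDerivAt t h1
    exact h2
  have hb : ∀ t : ℝ, 0 ≤ t → |⟪gradient f (x + t • v), v⟫_ℝ - ⟪gradient f x, v⟫_ℝ|
      ≤ L * t * ‖v‖ ^ 2 := by
    intro t ht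
    rw [← inner_sub_left]
    calc _ ≤ ‖gradient f (x + t • v) - gradient f x‖ * ‖v‖ := abs_real_inner_le_norm _ _
      _ ≤ L * ‖x + t • v - x‖ * ‖v‖ := by gcongr; exact hL _ _
      _ = _ := by rw [add_sub_cancel_left, norm_smul, Real.norm_eq_abs, abs_of_nonneg ht]; ring
  -- The sign `s = ±1` yields both sides at once; the function shown to be antitone on `[0, 1]` is
  -- the signed error minus its quadratic bound.
  have key : ∀ s : ℝ, |s| = 1 →
      s * (f u - f x - ⟪gradient f x, v⟫_ℝ) ≤ L / 2 * ‖v‖ ^ 2 := by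
    intro s hs
    have hψ : ∀ t : ℝ, HasDerivAt (fun t : ℝ => s * (f (x + t • v) - t * ⟪gradient f x, v⟫_ℝ)
        - L / 2 * t ^ 2 * ‖v‖ ^ 2)
        (s * (⟪gradient f (x + t • v), v⟫_ℝ - ⟪gradient f x, v⟫_ℝ) - L * t * ‖v‖ ^ 2) t := by
      intro t
      have h1 := ((hd t).sub ((hasDerivAt_id t).mul_const ⟪gradient f x, v⟫_ℝ)).const_mul s
      have h2 := (((hasDerivAt_id t).pow 2).const_mul (L / 2)).mul_const (‖v‖ ^ 2)
      refine HasDerivAt.congr_deriv (h1.sub h2) ?_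
      simp only [id, Nat.cast_ofNat, Nat.add_one_sub_one, pow_one]
      ring
    have hanti : AntitoneOn (fun t : ℝ => s * (f (x + t • v) - t * ⟪gradient f x, v⟫_ℝ)
        - L / 2 * t ^ 2 * ‖v‖ ^ 2) (Set.Icc 0 1) := by
      refine antitoneOn_of_deriv_nonpos (convex_Icc 0 1)
        (fun t _ => (hψ t).continuousAt.continuousWithinAt)
        (fun t _ => (hψ t).differentiableAt.differentiableWithinAt) fun t ht => ?_
      rw [interior_Icc] at ht
      rw [(hψ t).deriv]
      have h1 := hb t ht.1.le
      have h2 := le_abs_self (s * (⟪gradient f (x + t • v), v⟫_ℝ - ⟪gradient f x, v⟫_ℝ))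
      rw [abs_mul, hs, one_mul] at h2
      linarith
    have h1 := hanti (Set.left_mem_Icc.2 zero_le_one) (Set.right_mem_Icc.2 zero_le_one) zero_le_one
    simp only [one_smul, zero_smul, add_zero] at h1
    rw [hv, add_sub_cancel, ← hv] at h1
    linarith
  rw [abs_le]
  have h1 := key 1 (by simp)
  have h2 := key (-1) (by simp)
  constructor <;> linarith

namespace Setup

variable {d n nb : ℕ} {S : Setup d n nb}

variable (S) in
/-- The real value of the objective `F₀`. -/
noncomputable def primalVal (u : Vec (Fin d)) : ℝ :=
  S.f₀ u + (S.g (mul S.Abar u + S.bbar)).toReal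

/-! ### The inner accuracy -/

theorem B₁_eq : S.B₁ = 2 * (specNorm S.Abar * specNorm S.H / S.τ) + S.σ⁻¹
    + specNorm S.A * specNorm S.H / S.τ := by
  rw [B₁]; ring

theorem pinvNorm_nonneg : 0 ≤ S.pinvNorm := specNorm_nonneg _

/-- Expanding, `(2s + σ⁻¹)(1 + σs) = 3s + 2σs² + σ⁻¹`, and by the arithmetic-geometric mean `2σs² +
σ⁻¹ ≥ 2√2 s ≥ 11/4 s`. Here `23/4 = 3 + 11/4`. -/
theorem le_accuracy_factor {σ s t r : ℝ} (hσ : 0 < σ) (hs : 0 ≤ s) (ht : 0 ≤ t) (hr : 0 ≤ r) :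
    (23 / 4 * s + t) * (1 + r) ≤ (2 * s + σ⁻¹ + t) * (1 + r) * (1 + σ * s) := by
  have h1 : 11 / 4 * s ≤ 2 * (σ * s * s) + σ⁻¹ := by
    have h : 11 / 4 * (σ * s) ≤ 2 * (σ * s) ^ 2 + 1 := by nlinarith [sq_nonneg (σ * s - 11 / 16)]
    have h2 := mul_le_mul_of_nonneg_left h (inv_nonneg.2 hσ.le)
    calc 11 / 4 * s = σ⁻¹ * (11 / 4 * (σ * s)) := by field_simp
      _ ≤ _ := h2
      _ = _ := by field_simp
  have h2 : 0 ≤ t * (σ * s) := by positivity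
  have h3 : σ⁻¹ * (σ * s) = s := by field_simp
  have h4 : (23 / 4 * s + t) ≤ (2 * s + σ⁻¹ + t) * (1 + σ * s) := by nlinarith
  nlinarith [mul_le_mul_of_nonneg_right h4 (by linarith : 0 ≤ 1 + r)]

theorem τ_eq : S.τ = 2 * S.Lf := rfl

namespace Assumptions

variable (hA : S.Assumptions)
include hA

theorem B₁_pos (hLf : 0 < S.Lf) : 0 < S.B₁ := by
  have hτ := τ_pos hLf
  have h1 := specNorm_nonneg S.Abar
  have h2 := specNorm_nonneg S.H
  have h3 := specNorm_nonneg S.A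
  have hσ := hA.σ_pos
  rw [B₁_eq]; positivity

theorem B₃_nonneg (x : Vec (Fin d)) : 0 ≤ S.B₃ x :=
  mul_nonneg pinvNorm_nonneg (add_nonneg (norm_nonneg _)
    (mul_nonneg (specNorm_nonneg _) hA.lg_pos.le))

theorem B₄_nonneg (hLf : 0 < S.Lf) (x : Vec (Fin d)) : 0 ≤ S.B₄ x := by
  have hτ := τ_pos hLf
  have h2 := specNorm_nonneg S.H
  have h3 := hA.B₃_nonneg x
  have h4 := hA.lg_pos
  rw [B₄]; positivity

theorem muTilde_pos (hLf : 0 < S.Lf) {ε : ℝ} (hε : 0 < ε) (x : Vec (Fin d)) :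
    0 < S.muTilde ε x := by
  have hτ := τ_pos hLf
  have h1 := specNorm_nonneg S.Abar
  have h2 := specNorm_nonneg S.H
  have hσ := hA.σ_pos
  have hB₁ := hA.B₁_pos hLf
  have hB₃ := hA.B₃_nonneg x
  have hB₄ := hA.B₄_nonneg hLf x
  have hlg := hA.lg_pos
  have hB₂ : 0 < S.B₂ := by
    have := pinvNorm_nonneg (S := S)
    rw [B₂]; positivity
  refine lt_min (lt_min (by positivity) (by positivity)) (lt_min (by positivity) ?_)
  exact Real.sqrt_pos.2 (by positivity)

theorem muTilde_le_left (hLf : 0 < S.Lf) (ε : ℝ) (x : Vec (Fin d)) :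
    S.B₁ * S.muTilde ε x * S.σ ≤ ε ∧ S.B₁ * S.muTilde ε x ≤ ε := by
  have hB₁ := hA.B₁_pos hLf
  have hσ := hA.σ_pos
  have h1 : S.muTilde ε x ≤ ε / (S.B₁ * S.σ) := (min_le_left _ _).trans (min_le_left _ _)
  have h2 : S.muTilde ε x ≤ ε / S.B₁ := (min_le_left _ _).trans (min_le_right _ _)
  rw [le_div_iff₀ (by positivity)] at h1
  rw [le_div_iff₀ hB₁] at h2
  constructor <;> linarith

/-- Uses the last entry of the minimum in `muTilde`. The number `24` is the `12` there times the `2`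
of `τ = 2 L_f`. -/
theorem muTilde_sq_le (hLf : 0 < S.Lf) {ε : ℝ} (x : Vec (Fin d)) {h r : ℝ}
    (hε : 0 < ε) (hr : 0 < r)
    (hX : r * (h ^ 2 / S.τ) ≤ S.B₁ * S.B₂ * (1 + S.σ * (specNorm S.Abar * specNorm S.H / S.τ))) :
    (h / S.τ * S.muTilde ε x) ^ 2 ≤ (ε / S.Lf) ^ 2 / (24 * r) := by
  have hτ := τ_pos hLf
  have h1 := specNorm_nonneg S.Abar
  have h2 := specNorm_nonneg S.H
  have hσ := hA.σ_pos
  have hB₁ := hA.B₁_pos hLf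
  have hB₂ : 0 < S.B₂ := by
    have := pinvNorm_nonneg (S := S)
    rw [B₂]; positivity
  set X := S.B₁ * S.B₂ * (1 + S.σ * (specNorm S.Abar * specNorm S.H / S.τ)) with hXdef
  have hXpos : 0 < X := by positivity
  have h3 : S.muTilde ε x ≤ √(ε ^ 2 / (12 * S.Lf * X)) := by
    have : S.muTilde ε x ≤ _ := (min_le_right _ _).trans (min_le_right _ _)
    refine this.trans (le_of_eq ?_)
    rw [hXdef]; congr 2; ring
  have h4 : S.muTilde ε x ^ 2 ≤ ε ^ 2 / (12 * S.Lf * X) := by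
    have := pow_le_pow_left₀ (hA.muTilde_pos hLf hε x).le h3 2
    rwa [Real.sq_sqrt (by positivity)] at this
  calc (h / S.τ * S.muTilde ε x) ^ 2 = (h ^ 2 / S.τ) / S.τ * S.muTilde ε x ^ 2 := by
        field_simp
    _ ≤ (X / r) / S.τ * (ε ^ 2 / (12 * S.Lf * X)) := by
        have h5 : h ^ 2 / S.τ ≤ X / r := by rw [le_div_iff₀ hr]; linarith
        exact mul_le_mul (div_le_div_of_nonneg_right h5 hτ.le) h4 (sq_nonneg _) (by positivity)
    _ = _ := by rw [τ_eq]; field_simp; norm_num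

/-- The inner accuracy controls the perturbation of the outer iterates. -/
theorem exists_perturbation_bounds (hLf : 0 < S.Lf) :
    ∃ δ δ₁ : ℝ, ((δ = 1444 / 10000 ∧ δ₁ = 616 / 10000) ∨ (δ = 852 / 10000 ∧ δ₁ = 852 / 10000)) ∧
      ∀ (ε : ℝ) (x : Vec (Fin d)), 0 < ε →
        specNorm S.H / S.τ * S.muTilde ε x ≤ δ * (ε / S.Lf) ∧
        specNorm S.Abar / S.τ * S.muTilde ε x ≤ δ₁ * (ε / S.Lf) := by
  have hτ := τ_pos hLf
  have hp := specNorm_nonneg S.Abar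
  have hq := specNorm_nonneg S.A
  have hh := specNorm_nonneg S.H
  have hN := pinvNorm_nonneg (S := S)
  have hph : specNorm S.Abar ≤ specNorm S.H := specNorm_le_fromRows_left _ _
  have hqh : specNorm S.A ≤ specNorm S.H := specNorm_le_fromRows_right _ _
  have hsq : specNorm S.H ^ 2 ≤ specNorm S.Abar ^ 2 + specNorm S.A ^ 2 :=
    specNorm_fromRows_sq_le _ _
  have key := le_accuracy_factor hA.σ_pos (s := specNorm S.Abar * specNorm S.H / S.τ)
    (t := specNorm S.A * specNorm S.H / S.τ) (r := S.pinvNorm * specNorm S.H) (by positivity)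
    (by positivity) (by positivity)
  rw [← B₁_eq] at key
  set X := S.B₁ * S.B₂ * (1 + S.σ * (specNorm S.Abar * specNorm S.H / S.τ))
  -- It remains to bound `h² / τ` by `X / r`; then any `δ ≥ 1/√(24 r)` is allowed.
  have fin : ∀ (h δ r ε : ℝ) (x : Vec (Fin d)), 0 < ε → 0 < r → 0 ≤ δ → r * (h ^ 2 / S.τ) ≤ X →
      1 ≤ δ ^ 2 * (24 * r) → h / S.τ * S.muTilde ε x ≤ δ * (ε / S.Lf) := by
    intro h δ r ε x hε hr hδ hX hδr
    refine le_of_sq_le_sq ?_ (by positivity)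
    refine (hA.muTilde_sq_le hLf x hε hr hX).trans ?_
    rw [mul_pow, div_le_iff₀ (by positivity)]
    nlinarith [sq_nonneg (ε / S.Lf)]
  have hps : specNorm S.Abar ^ 2 / S.τ ≤ specNorm S.Abar * specNorm S.H / S.τ := by
    gcongr; nlinarith
  have hst : specNorm S.H ^ 2 / S.τ
      ≤ specNorm S.Abar * specNorm S.H / S.τ + specNorm S.A * specNorm S.H / S.τ := by
    rw [← add_div]
    gcongr
    have : specNorm S.H ≤ specNorm S.Abar + specNorm S.A :=
      le_of_sq_le_sq (by nlinarith) (by positivity)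
    nlinarith
  have hp2 : specNorm S.Abar ^ 2 / S.τ ≤ specNorm S.H ^ 2 / S.τ := by gcongr
  have hs0 : 0 ≤ specNorm S.Abar * specNorm S.H / S.τ := by positivity
  have ht0 : 0 ≤ specNorm S.A * specNorm S.H / S.τ := by positivity
  rcases isEmpty_or_nonempty (Fin n) with hn | hn
  -- Without affine constraints `‖A‖ = 0` and `‖Ā‖ = ‖H‖`, so `r = 23/4` serves both norms, and
  -- `0.0852 ≥ 1/√138`.
  · have hq0 : specNorm S.A = 0 := by
      rw [specNorm, norm_eq_zero]
      ext v i
      exact hn.elim i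
    have hpeq : specNorm S.Abar = specNorm S.H := by
      refine le_antisymm hph (le_of_sq_le_sq ?_ hp)
      rw [hq0] at hsq; linarith
    have hX : 23 / 4 * (specNorm S.H ^ 2 / S.τ) ≤ X := by
      refine le_trans ?_ key
      rw [hpeq, hq0]
      have : 0 ≤ S.pinvNorm * specNorm S.H := by positivity
      have h2 : 0 ≤ specNorm S.H ^ 2 / S.τ := by positivity
      rw [← sq, zero_mul, zero_div, add_zero]
      nlinarith
    refine ⟨852 / 10000, 852 / 10000, Or.inr ⟨rfl, rfl⟩, fun ε x hε => ⟨?_, ?_⟩⟩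
    · exact fin _ _ (23 / 4) ε x hε (by norm_num) (by norm_num) hX (by norm_num)
    · refine fin _ _ (23 / 4) ε x hε (by norm_num) (by norm_num) ?_ (by norm_num)
      rw [hpeq]; exact hX
  -- When `A` has rows, `‖(A Aᵀ)⁻¹A‖ ‖A‖ ≥ 1` gives `B₂ ≥ 2`, which improves `X`. Then `r = 2` works
  -- for `H` and `r = 11` for `Ā`, with `0.1444 ≥ 1/√48` and `0.0616 ≥ 1/√264`.
  · have hpinv : 1 ≤ S.pinvNorm * specNorm S.A := hA.A_rank.one_le_pinv_mul
    have hNh : 1 ≤ S.pinvNorm * specNorm S.H := hpinv.trans (by gcongr)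
    have htN : specNorm S.H ^ 2 / S.τ
        ≤ specNorm S.A * specNorm S.H / S.τ * (S.pinvNorm * specNorm S.H) := by
      calc specNorm S.H ^ 2 / S.τ = 1 * (specNorm S.H ^ 2 / S.τ) := (one_mul _).symm
        _ ≤ (S.pinvNorm * specNorm S.A) * (specNorm S.H ^ 2 / S.τ) := by gcongr
        _ = _ := by ring
    have hX : 23 / 2 * (specNorm S.Abar * specNorm S.H / S.τ)
        + specNorm S.A * specNorm S.H / S.τ + specNorm S.H ^ 2 / S.τ ≤ X := by
      refine le_trans ?_ key
      nlinarith
    refine ⟨1444 / 10000, 616 / 10000, Or.inl ⟨rfl, rfl⟩, fun ε x hε => ⟨?_, ?_⟩⟩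
    · refine fin _ _ 2 ε x hε (by norm_num) (by norm_num) ?_ (by norm_num)
      linarith
    · refine fin _ _ 11 ε x hε (by norm_num) (by norm_num) ?_ (by norm_num)
      have : 0 ≤ specNorm S.Abar ^ 2 / S.τ := by positivity
      linarith

/-! ### One outer iteration -/

/-- Descent of the objective along the exact solutions of the subproblems. -/
theorem primalVal_descent (hLf : 0 < S.Lf) {x u : Vec (Fin d)} {w : Vec (Fin nb ⊕ Fin n)}
    (hw : w ∈ S.Ω x) (hu : mul S.A u + S.b = 0) (hud : mul S.Abar u + S.bbar ∈ dom S.g) :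
    S.primalVal (S.primal x w) ≤ S.primalVal u - S.Lf * (3 / 2 * ‖S.primal x w - u‖ ^ 2
      - ⟪S.primal x w - u, x - u⟫_ℝ - ‖x - u‖ ^ 2) := by
  have h1 := hA.primal_optimal hLf x hw hu hud
  set p := S.primal x w
  -- The upper side of the descent lemma is used at `p` and the lower side at `u`; `f₀` need not be
  -- convex.
  have h2 := (abs_le.1 (abs_sub_linearization_le hA.differentiable hA.lipschitz_grad x p)).2
  have h3 := (abs_le.1 (abs_sub_linearization_le hA.differentiable hA.lipschitz_grad x u)).1
  have h4 : ‖p - x‖ ^ 2 = ‖p - u‖ ^ 2 - 2 * ⟪p - u, x - u⟫_ℝ + ‖x - u‖ ^ 2 := by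
    rw [← norm_sub_sq_real]; congr 2; abel
  rw [τ_eq] at h1
  rw [norm_sub_rev u p, norm_sub_rev u x, h4] at h1
  rw [h4] at h2
  rw [norm_sub_rev u x] at h3
  unfold primalVal
  linarith

/-- The next iterate is an `ε`-KKT point as soon as the exact step is short. -/
theorem isKKT_of_short_step (hLf : 0 < S.Lf) {ε μ : ℝ} {x u : Vec (Fin d)}
    {w z : Vec (Fin nb ⊕ Fin n)} (hw : w ∈ S.Ω x) (hz : ‖z - w‖ ≤ μ)
    (hμ : S.B₁ * μ ≤ ε) (hμσ : S.B₁ * μ * S.σ ≤ ε) {e₁ : Vec (Fin d)} {c : Vec (Fin n)}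
    (he : x - u = e₁ + mul S.A.transpose c)
    (hshort : 3 * ‖S.primal x w - u‖ + ‖x - u‖ + 2 * ‖e₁‖
      + specNorm S.H / S.τ * μ + 2 * (specNorm S.Abar / S.τ * μ) ≤ ε / S.Lf) :
    S.IsKKT ε (S.primal x z) (prox S.σ⁻¹ S.g
      (S.σ⁻¹ • fstBlock z + mul S.Abar (S.primal x z) + S.bbar)) := by
  have hτ := τ_pos hLf
  have hσ := hA.σ_pos
  have hp := specNorm_nonneg S.Abar
  have hq := specNorm_nonneg S.A
  have hh := specNorm_nonneg S.H
  have hμ0 : 0 ≤ μ := (norm_nonneg _).trans hz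
  have hdiff : S.primal x z - S.primal x w = -((1 / S.τ) • mul S.H.transpose (z - w)) := by
    rw [primal, primal, map_sub]; module
  have hdn : ‖S.primal x z - S.primal x w‖ ≤ specNorm S.H / S.τ * μ := by
    rw [hdiff, norm_neg, norm_smul, Real.norm_eq_abs, abs_of_pos (by positivity)]
    calc 1 / S.τ * ‖mul S.H.transpose (z - w)‖ ≤ 1 / S.τ * (specNorm S.H * μ) := by
          gcongr
          exact (norm_mul_transpose_le _ _).trans (by gcongr)
      _ = _ := by ring
  have hz1 : ‖fstBlock z - fstBlock w‖ ≤ μ := (norm_fstBlock_le (z - w)).trans hz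
  set xp := S.primal x z
  set ξ := S.primal x w
  set yp := prox S.σ⁻¹ S.g (S.σ⁻¹ • fstBlock z + mul S.Abar xp + S.bbar) with hyp
  -- the proximal step
  have hprox := (hA.prox_g_spec (inv_pos.2 hσ)
    (S.σ⁻¹ • fstBlock z + mul S.Abar xp + S.bbar)).mem_subdiff hA.g_convex (inv_pos.2 hσ)
  rw [← hyp, one_div, inv_inv] at hprox
  have hw1 := hA.fstBlock_mem_subdiff hLf x hw
  have hw1' : S.σ • ((S.σ⁻¹ • fstBlock w + (mul S.Abar ξ + S.bbar)) - (mul S.Abar ξ + S.bbar))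
      ∈ subdiff S.g (mul S.Abar ξ + S.bbar) := by
    rwa [add_sub_cancel_right, smul_smul, mul_inv_cancel₀ hσ.ne', one_smul]
  have hA1 : ‖mul S.Abar xp - mul S.Abar ξ‖ ≤ specNorm S.Abar * (specNorm S.H / S.τ * μ) := by
    rw [← map_sub]
    exact (norm_mul_le _ _).trans (by gcongr)
  have hy1 : ‖yp - (mul S.Abar ξ + S.bbar)‖
      ≤ S.σ⁻¹ * μ + specNorm S.Abar * (specNorm S.H / S.τ * μ) := by
    refine (hA.g_convex.norm_sub_le_of_subdiff hσ hprox hw1').trans ?_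
    have : S.σ⁻¹ • fstBlock z + mul S.Abar xp + S.bbar
        - (S.σ⁻¹ • fstBlock w + (mul S.Abar ξ + S.bbar))
        = S.σ⁻¹ • (fstBlock z - fstBlock w) + (mul S.Abar xp - mul S.Abar ξ) := by module
    rw [this]
    refine (norm_add_le _ _).trans (add_le_add ?_ hA1)
    rw [norm_smul, Real.norm_eq_abs, abs_of_pos (inv_pos.2 hσ)]
    gcongr
  have hA2 : ‖mul S.A xp + S.b‖ ≤ specNorm S.A * (specNorm S.H / S.τ * μ) := by
    have : mul S.A xp + S.b = mul S.A (xp - ξ) := by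
      rw [map_sub, ← add_sub_add_right_eq_sub _ _ S.b, hA.primal_feasible hLf x hw, sub_zero]
    rw [this]
    exact (norm_mul_le _ _).trans (by gcongr)
  have hB₁ : S.B₁ * μ = (S.σ⁻¹ * μ + specNorm S.Abar * (specNorm S.H / S.τ * μ))
      + specNorm S.Abar * (specNorm S.H / S.τ * μ) + specNorm S.A * (specNorm S.H / S.τ * μ) := by
    rw [B₁_eq]; ring
  have hpos1 : 0 ≤ specNorm S.Abar * (specNorm S.H / S.τ * μ) := by positivity
  have hpos2 : 0 ≤ specNorm S.A * (specNorm S.H / S.τ * μ) := by positivity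
  have hpos3 : 0 ≤ S.σ⁻¹ * μ := by positivity
  have hy2 : ‖yp - mul S.Abar xp - S.bbar‖ ≤ S.B₁ * μ := by
    have : yp - mul S.Abar xp - S.bbar = (yp - (mul S.Abar ξ + S.bbar))
        - (mul S.Abar xp - mul S.Abar ξ) := by abel
    rw [this]
    refine (norm_sub_le _ _).trans ?_
    linarith
  -- `γ₁ = z₁` makes the first residual `σ` times the third. `γ₂` is `z₂` corrected by the
  -- `Aᵀ`-components of the previous error `x - u` and of the present error, so only the `Āᵀ`-parts
  -- `e₁` and `e₁'` remain in the stationarity residual.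
  refine ⟨fstBlock z, sndBlock z - S.τ • c - sndBlock (z - w), ?_, ?_, by linarith, by linarith⟩
  · set η := S.σ • (S.σ⁻¹ • fstBlock z + mul S.Abar xp + S.bbar - yp) with hη
    have hηz : η - fstBlock z = -(S.σ • (yp - mul S.Abar xp - S.bbar)) := by
      rw [hη]
      have : fstBlock z = S.σ • (S.σ⁻¹ • fstBlock z) := by
        rw [smul_smul, mul_inv_cancel₀ hσ.ne', one_smul]
      nth_rewrite 2 [this]
      module
    calc _ ≤ edist 0 (η - fstBlock z) :=
          Metric.infEDist_le_edist_of_mem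
            (Set.mem_image_of_mem (fun ξ => ξ - fstBlock z) hprox)
      _ = ENNReal.ofReal ‖η - fstBlock z‖ := by rw [edist_dist, dist_eq_norm, zero_sub, norm_neg]
      _ ≤ _ := by
        apply ENNReal.ofReal_le_ofReal
        rw [hηz, norm_neg, norm_smul, Real.norm_eq_abs, abs_of_pos hσ]
        nlinarith
  · set e₁' := -((1 / S.τ) • mul S.Abar.transpose (fstBlock (z - w))) with he₁'
    have he₁n : ‖e₁'‖ ≤ specNorm S.Abar / S.τ * μ := by
      rw [he₁', norm_neg, norm_smul, Real.norm_eq_abs, abs_of_pos (by positivity)]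
      calc _ ≤ 1 / S.τ * (specNorm S.Abar * μ) := by
            gcongr
            exact (norm_mul_transpose_le _ _).trans (by gcongr; exact hz1)
        _ = _ := by ring
    have hres : gradient S.f₀ xp + mul S.Abar.transpose (fstBlock z)
        + mul S.A.transpose (sndBlock z - S.τ • c - sndBlock (z - w))
        = (gradient S.f₀ xp - gradient S.f₀ x) - S.τ • ((ξ - u) - e₁ + e₁') := by
      have h1 := τ_smul_primal_sub (S := S) hLf x z
      have h2 : xp - x = (xp - ξ) + (ξ - u) - (e₁ + mul S.A.transpose c) := by rw [← he]; abel
      have h3 : S.τ • (xp - ξ) = S.τ • e₁' - mul S.A.transpose (sndBlock (z - w)) := by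
        rw [hdiff, he₁', mul_H_transpose, smul_neg, smul_neg, smul_smul, smul_smul,
          mul_one_div_cancel hτ.ne', one_smul, one_smul]
        abel
      rw [h2, smul_sub, smul_add, h3, mul_H_transpose, smul_add, ← map_smul] at h1
      simp only [map_sub] at h1 ⊢
      rw [smul_add, smul_sub]
      have h4 : mul S.Abar.transpose (fstBlock z) = -(S.τ • e₁'
          - mul S.A.transpose (sndBlock (z - w)) + S.τ • (ξ - u)
          - (S.τ • e₁ + mul S.A.transpose (S.τ • c))) - gradient S.f₀ x
          - mul S.A.transpose (sndBlock z) := by rw [h1]; abel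
      rw [h4]
      abel
    rw [hres]
    have hg := hA.lipschitz_grad xp x
    have h3 : ‖xp - x‖ ≤ specNorm S.H / S.τ * μ + ‖ξ - u‖ + ‖x - u‖ := by
      have : xp - x = (xp - ξ) + (ξ - u) - (x - u) := by abel
      rw [this]
      refine (norm_sub_le _ _).trans ?_
      gcongr
      exact (norm_add_le _ _).trans (by gcongr)
    have h4 : ‖(ξ - u) - e₁ + e₁'‖ ≤ ‖ξ - u‖ + ‖e₁‖ + specNorm S.Abar / S.τ * μ :=
      (norm_add_le _ _).trans (add_le_add (norm_sub_le _ _) he₁n)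
    rw [le_div_iff₀ hLf] at hshort
    calc _ ≤ ‖gradient S.f₀ xp - gradient S.f₀ x‖ + ‖S.τ • ((ξ - u) - e₁ + e₁')‖ :=
          norm_sub_le _ _
      _ ≤ S.Lf * (specNorm S.H / S.τ * μ + ‖ξ - u‖ + ‖x - u‖)
          + S.τ * (‖ξ - u‖ + ‖e₁‖ + specNorm S.Abar / S.τ * μ) := by
          rw [norm_smul, Real.norm_eq_abs, abs_of_pos hτ]
          gcongr
          exact hg.trans (by gcongr)
      _ = (3 * ‖ξ - u‖ + ‖x - u‖ + 2 * ‖e₁‖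
      + specNorm S.H / S.τ * μ + 2 * (specNorm S.Abar / S.τ * μ)) * S.Lf := by
          nth_rewrite 2 [τ_eq]; ring
      _ ≤ ε := hshort

end Assumptions

end Setup
end PGRPD

/-! ### Exact iterates and the decrease of the objective along a run. -/

namespace PGRPD

namespace Setup

variable {d n nb : ℕ} {S : Setup d n nb} {P : Params d} {ε : ℝ}

/-- The weight of the inner accuracy of the previous outer iteration. -/
def lagWeight (P : Params d) : ℕ → ℝ
  | 0 => 0
  | k + 1 => P.w k

theorem iter_succ_fst (k : ℕ) :
    (S.iter P ε (k + 1)).1 = S.primal (S.iter P ε k).1 (S.zNext P ε k (S.iter P ε k).1) := by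
  rw [primal, mul_H_transpose]; rfl

theorem iter_succ_snd (k : ℕ) :
    (S.iter P ε (k + 1)).2 = prox S.σ⁻¹ S.g
      (S.σ⁻¹ • fstBlock (S.zNext P ε k (S.iter P ε k).1)
        + mul S.Abar (S.iter P ε (k + 1)).1 + S.bbar) := rfl

variable (S P ε) in
/-- The properties of the exact solutions `xt (k + 1)` of the subproblems of a run, where
`xt 0 = x⁰`. -/
structure ExactIterates (xt : ℕ → Vec (Fin d)) : Prop where
  zero : xt 0 = S.x0
  feasible : ∀ k, mul S.A (xt k) + S.b = 0
  mem_dom : ∀ k, mul S.Abar (xt k) + S.bbar ∈ dom S.g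
  ν_eq : ∀ k, S.ν (S.iter P ε k).1 = -(S.τ • xt (k + 1))
  near : ∀ k, ‖(S.iter P ε k).1 - xt k‖ ≤ 15 / 100 * (ε / S.Lf)
  -- The error of step `k` comes from the preceding inner solve, hence `lagWeight`, which is `0` at
  -- `k = 0` because `x⁰` is exact.
  descent : ∀ k, S.primalVal (xt (k + 1)) ≤ S.primalVal (xt k)
    - S.Lf * (‖xt (k + 1) - xt k‖ ^ 2 - 23 / 1000 * lagWeight P k ^ 2 * (ε / S.Lf) ^ 2)
  descent_of_not_KKT : ∀ k, ¬ S.IsKKT ε (S.iter P ε (k + 1)).1 (S.iter P ε (k + 1)).2 →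
    S.primalVal (xt (k + 1)) ≤ S.primalVal (xt k) - 5 / 1000 * (S.Lf * (ε / S.Lf) ^ 2)
  strong_descent_of_not_KKT : ∀ k, lagWeight P k ≤ 1 / 16 → P.w k ≤ 1 / 16 →
    ¬ S.IsKKT ε (S.iter P ε (k + 1)).1 (S.iter P ε (k + 1)).2 →
    S.primalVal (xt (k + 1)) ≤ S.primalVal (xt k) - 15 / 100 * (S.Lf * (ε / S.Lf) ^ 2)

section Numeric

variable {δ δ₁ a V ω w : ℝ}
  (hδ : (δ = 1444 / 10000 ∧ δ₁ = 616 / 10000) ∨ (δ = 852 / 10000 ∧ δ₁ = 852 / 10000))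
include hδ

/-- Completing the square in `V` requires `δ₁² / 2 + δ² ≤ 23/1000`, which holds for both pairs of
constants. -/
theorem decrease_general :
    V ^ 2 - 23 / 1000 * ω ^ 2 * a ^ 2
      ≤ 3 / 2 * V ^ 2 - ω * δ₁ * a * V - (ω * δ * a) ^ 2 := by
  rcases hδ with ⟨rfl, rfl⟩ | ⟨rfl, rfl⟩
  · nlinarith [sq_nonneg (V - ω * a * (616 / 10000)), sq_nonneg (ω * a)]
  · nlinarith [sq_nonneg (V - ω * a * (852 / 10000)), sq_nonneg (ω * a)]

/-- With weights at most `1` the error terms use at most `2(δ + 2δ₁) a ≤ 0.5352 a`, so `V ≥ 0.154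
a`; the quadratic then stays above `0.005 a²`. -/
theorem decrease_of_long_step (ha : 0 ≤ a) (hV : 0 ≤ V) (hω0 : 0 ≤ ω) (hω : ω ≤ 1) (hw : w ≤ 1)
    (h : a < 3 * V + ω * δ * a + 2 * (ω * δ₁ * a) + w * δ * a + 2 * (w * δ₁ * a)) :
    5 / 1000 * a ^ 2 ≤ 3 / 2 * V ^ 2 - ω * δ₁ * a * V - (ω * δ * a) ^ 2 := by
  have h1 : ω * a ≤ a := mul_le_of_le_one_left ha hω
  have h2 : w * a ≤ a := mul_le_of_le_one_left ha hw
  have h3 : 0 ≤ ω * a := mul_nonneg hω0 ha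
  have h4 : ω * a * V ≤ a * V := mul_le_mul_of_nonneg_right h1 hV
  have h5 : (ω * a) ^ 2 ≤ a ^ 2 := pow_le_pow_left₀ h3 h1 2
  rcases hδ with ⟨rfl, rfl⟩ | ⟨rfl, rfl⟩
  · have h6 : 154 / 1000 * a ≤ V := by linarith
    nlinarith [mul_nonneg (sub_nonneg.2 h6) hV, mul_nonneg (sub_nonneg.2 h6) ha]
  · have h6 : 154 / 1000 * a ≤ V := by linarith
    nlinarith [mul_nonneg (sub_nonneg.2 h6) hV, mul_nonneg (sub_nonneg.2 h6) ha]

/-- Weights at most `1/16` shrink the error terms to `0.0335 a`, which gives `V ≥ 0.322 a`. -/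
theorem strong_decrease_of_long_step (ha : 0 ≤ a) (hV : 0 ≤ V) (hω0 : 0 ≤ ω) (hω : ω ≤ 1 / 16)
    (hw : w ≤ 1 / 16)
    (h : a < 3 * V + ω * δ * a + 2 * (ω * δ₁ * a) + w * δ * a + 2 * (w * δ₁ * a)) :
    15 / 100 * a ^ 2 ≤ 3 / 2 * V ^ 2 - ω * δ₁ * a * V - (ω * δ * a) ^ 2 := by
  have h1 : ω * a ≤ 1 / 16 * a := mul_le_mul_of_nonneg_right hω ha
  have h2 : w * a ≤ 1 / 16 * a := mul_le_mul_of_nonneg_right hw ha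
  have h3 : 0 ≤ ω * a := mul_nonneg hω0 ha
  have h4 : ω * a * V ≤ 1 / 16 * a * V := mul_le_mul_of_nonneg_right h1 hV
  have h5 : (ω * a) ^ 2 ≤ (1 / 16 * a) ^ 2 := pow_le_pow_left₀ h3 h1 2
  rcases hδ with ⟨rfl, rfl⟩ | ⟨rfl, rfl⟩
  · have h6 : 322 / 1000 * a ≤ V := by linarith
    nlinarith [mul_nonneg (sub_nonneg.2 h6) hV, mul_nonneg (sub_nonneg.2 h6) ha]
  · have h6 : 322 / 1000 * a ≤ V := by linarith
    nlinarith [mul_nonneg (sub_nonneg.2 h6) hV, mul_nonneg (sub_nonneg.2 h6) ha]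

end Numeric

/-- A finite extended distance excludes an empty `Ω`, and closedness of `Ω` makes the distance
attained. -/
theorem Accepts.exists_near (hA : S.Assumptions) {x : Vec (Fin d)} {μ : ℝ}
    {z : Vec (Fin nb ⊕ Fin n)} (hμ : 0 ≤ μ) (h : S.Accepts x μ z) : ∃ w ∈ S.Ω x, ‖z - w‖ ≤ μ := by
  have hne : (S.Ω x).Nonempty := by
    by_contra hc
    have h2 := h.2
    rw [Set.not_nonempty_iff_eq_empty.1 hc, Metric.infEDist_empty, top_le_iff] at h2
    exact ENNReal.ofReal_ne_top h2
  obtain ⟨w, hw, hd⟩ := (hA.isClosed_Ω x).exists_infDist_eq_dist hne z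
  refine ⟨w, hw, ?_⟩
  rw [← dist_eq_norm, ← hd, Metric.infDist]
  exact ENNReal.toReal_le_of_le_ofReal hμ h.2

namespace Assumptions

variable (hA : S.Assumptions)
include hA

theorem exists_exactIterates (hLf : 0 < S.Lf) (hε : 0 < ε) (hw : ∀ k, 0 < P.w k ∧ P.w k ≤ 1)
    (hacc : ∀ k, S.Accepts (S.iter P ε k).1 (S.mu P ε k (S.iter P ε k).1)
      (S.zNext P ε k (S.iter P ε k).1)) : ∃ xt, S.ExactIterates P ε xt := by
  have hτ := τ_pos hLf
  obtain ⟨δ, δ₁, hδ, hpert⟩ := hA.exists_perturbation_bounds hLf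
  have hmu : ∀ k, 0 < S.mu P ε k (S.iter P ε k).1 := fun k =>
    mul_pos (hw k).1 (hA.muTilde_pos hLf hε _)
  choose w hwΩ hwd using fun k => (hacc k).exists_near hA (hmu k).le
  let xt : ℕ → Vec (Fin d) := fun k => Nat.casesOn k S.x0 fun k => S.primal (S.iter P ε k).1 (w k)
  have hxt : ∀ k, xt (k + 1) = S.primal (S.iter P ε k).1 (w k) := fun k => rfl
  have hω0 : ∀ k, 0 ≤ lagWeight P k := by
    rintro (_ | k)
    · exact le_rfl
    · exact (hw k).1.le
  have hω1 : ∀ k, lagWeight P k ≤ 1 := by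
    rintro (_ | k)
    · exact zero_le_one
    · exact (hw k).2
  set a := ε / S.Lf
  have ha0 : 0 < a := by positivity
  have hH : ∀ k, specNorm S.H / S.τ * S.mu P ε k (S.iter P ε k).1 ≤ P.w k * δ * a := fun k => by
    rw [mu]
    nlinarith [mul_le_mul_of_nonneg_left (hpert ε (S.iter P ε k).1 hε).1 (hw k).1.le]
  have hAb : ∀ k, specNorm S.Abar / S.τ * S.mu P ε k (S.iter P ε k).1 ≤ P.w k * δ₁ * a := fun k => by
    rw [mu]
    nlinarith [mul_le_mul_of_nonneg_left (hpert ε (S.iter P ε k).1 hε).2 (hw k).1.le]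
  have hfeas : ∀ k, mul S.A (xt k) + S.b = 0 := by
    rintro (_ | k)
    · exact hA.x0_feasible
    · exact hA.primal_feasible hLf _ (hwΩ k)
  have hdom : ∀ k, mul S.Abar (xt k) + S.bbar ∈ dom S.g := by
    rintro (_ | k)
    · have := hA.y0_dom
      rwa [hA.y0_feasible] at this
    · exact (hA.g_convex.mem_subdiff_iff.1 (hA.fstBlock_mem_subdiff hLf _ (hwΩ k))).1
  -- The error is split into an `Āᵀ`-part of size `δ₁` and a part in the range of `Aᵀ`; the total
  -- has size `δ`.
  have hdec : ∀ k, ∃ e₁ c, (S.iter P ε k).1 - xt k = e₁ + mul S.A.transpose c ∧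
      ‖e₁‖ ≤ lagWeight P k * δ₁ * a ∧ ‖(S.iter P ε k).1 - xt k‖ ≤ lagWeight P k * δ * a := by
    rintro (_ | k)
    · refine ⟨0, 0, ?_, ?_, ?_⟩ <;> simp [xt, iter, lagWeight]
    · have hdiff : (S.iter P ε (k + 1)).1 - xt (k + 1)
          = -((1 / S.τ) • mul S.H.transpose (S.zNext P ε k (S.iter P ε k).1 - w k)) := by
        rw [iter_succ_fst, hxt, primal, primal, map_sub]; module
      refine ⟨-((1 / S.τ) • mul S.Abar.transpose
        (fstBlock (S.zNext P ε k (S.iter P ε k).1 - w k))),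
        -((1 / S.τ) • sndBlock (S.zNext P ε k (S.iter P ε k).1 - w k)), ?_, ?_, ?_⟩
      · rw [hdiff, mul_H_transpose, map_neg, map_smul, smul_add, neg_add]
      · refine le_trans ?_ (hAb k)
        rw [norm_neg, norm_smul, Real.norm_eq_abs, abs_of_pos (by positivity)]
        calc _ ≤ 1 / S.τ * (specNorm S.Abar * S.mu P ε k (S.iter P ε k).1) := by
              gcongr
              refine (norm_mul_transpose_le _ _).trans ?_
              gcongr
              · exact specNorm_nonneg _
              · exact (norm_fstBlock_le _).trans (hwd k)
          _ = _ := by ring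
      · refine le_trans ?_ (hH k)
        rw [hdiff, norm_neg, norm_smul, Real.norm_eq_abs, abs_of_pos (by positivity)]
        calc _ ≤ 1 / S.τ * (specNorm S.H * S.mu P ε k (S.iter P ε k).1) := by
              gcongr
              refine (norm_mul_transpose_le _ _).trans ?_
              gcongr
              · exact specNorm_nonneg _
              · exact hwd k
          _ = _ := by ring
  have hstep : ∀ k, S.primalVal (xt (k + 1)) ≤ S.primalVal (xt k)
      - S.Lf * (3 / 2 * ‖xt (k + 1) - xt k‖ ^ 2
        - lagWeight P k * δ₁ * a * ‖xt (k + 1) - xt k‖ - (lagWeight P k * δ * a) ^ 2) := by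
    intro k
    obtain ⟨e₁, c, he, he₁, hen⟩ := hdec k
    have h1 := hA.primalVal_descent hLf (hwΩ k) (hfeas k) (hdom k)
    rw [← hxt] at h1
    refine h1.trans ?_
    -- Consecutive exact points are feasible, so their difference is orthogonal to the range of `Aᵀ`
    -- and only `e₁` enters the cross term.
    have hAv : mul S.A (xt (k + 1) - xt k) = 0 := by
      rw [map_sub, ← add_sub_add_right_eq_sub _ _ S.b, hfeas (k + 1), hfeas k, sub_zero]
    have h2 : ⟪xt (k + 1) - xt k, (S.iter P ε k).1 - xt k⟫_ℝ
        ≤ lagWeight P k * δ₁ * a * ‖xt (k + 1) - xt k‖ := by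
      rw [he, inner_add_right, real_inner_comm (mul S.A.transpose c), inner_mul_transpose, hAv,
        inner_zero_right, add_zero]
      refine (real_inner_le_norm _ _).trans ?_
      rw [mul_comm]
      gcongr
    have h3 : ‖(S.iter P ε k).1 - xt k‖ ^ 2 ≤ (lagWeight P k * δ * a) ^ 2 :=
      pow_le_pow_left₀ (norm_nonneg _) hen 2
    have h4 : 3 / 2 * ‖xt (k + 1) - xt k‖ ^ 2
        - lagWeight P k * δ₁ * a * ‖xt (k + 1) - xt k‖ - (lagWeight P k * δ * a) ^ 2
        ≤ 3 / 2 * ‖xt (k + 1) - xt k‖ ^ 2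
        - ⟪xt (k + 1) - xt k, (S.iter P ε k).1 - xt k⟫_ℝ - ‖(S.iter P ε k).1 - xt k‖ ^ 2 := by
      linarith
    exact sub_le_sub_left (mul_le_mul_of_nonneg_left h4 hLf.le) _
  have hkkt : ∀ k, ¬ S.IsKKT ε (S.iter P ε (k + 1)).1 (S.iter P ε (k + 1)).2 →
      a < 3 * ‖xt (k + 1) - xt k‖ + lagWeight P k * δ * a + 2 * (lagWeight P k * δ₁ * a)
        + P.w k * δ * a + 2 * (P.w k * δ₁ * a) := by
    intro k hk
    by_contra! hc
    refine hk ?_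
    obtain ⟨e₁, c, he, he₁, hen⟩ := hdec k
    have h1 := hA.muTilde_le_left hLf ε (S.iter P ε k).1
    have hB := hA.B₁_pos hLf
    have hmle : S.mu P ε k (S.iter P ε k).1 ≤ S.muTilde ε (S.iter P ε k).1 :=
      mul_le_of_le_one_left (hA.muTilde_pos hLf hε _).le (hw k).2
    have hBm := mul_le_mul_of_nonneg_left hmle hB.le
    rw [iter_succ_snd, iter_succ_fst]
    refine hA.isKKT_of_short_step hLf (hwΩ k) (hwd k) (hBm.trans h1.2)
      ((mul_le_mul_of_nonneg_right hBm hA.σ_pos.le).trans h1.1) he ?_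
    rw [← hxt]
    linarith [hH k, hAb k]
  refine ⟨xt, ⟨rfl, hfeas, hdom, fun k => ?_, fun k => ?_, fun k => ?_, fun k hk => ?_,
    fun k h1 h2 hk => ?_⟩⟩
  · rw [← hA.residual_eq_ν hLf _ (hwΩ k), hxt, primal_eq hLf, smul_neg, smul_smul,
      mul_one_div_cancel hτ.ne', one_smul, neg_neg]
  · obtain ⟨-, -, -, -, hen⟩ := hdec k
    refine hen.trans ?_
    have h1 := mul_le_of_le_one_left ha0.le (hω1 k)
    have h2 := mul_nonneg (hω0 k) ha0.le
    rcases hδ with ⟨rfl, rfl⟩ | ⟨rfl, rfl⟩ <;> linarith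
  · refine (hstep k).trans (sub_le_sub_left (mul_le_mul_of_nonneg_left ?_ hLf.le) _)
    exact decrease_general hδ
  · have := decrease_of_long_step hδ ha0.le (norm_nonneg _) (hω0 k) (hω1 k) (hw k).2 (hkkt k hk)
    have := mul_le_mul_of_nonneg_left this hLf.le
    linarith [hstep k]
  · have := strong_decrease_of_long_step hδ ha0.le (norm_nonneg _) (hω0 k) h1 h2 (hkkt k hk)
    have := mul_le_mul_of_nonneg_left this hLf.le
    linarith [hstep k]

end Assumptions

end Setup
end PGRPD

/-! ### The first KKT iterate: existence, bounds on its index, and growth of the iterates. -/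

namespace PGRPD

namespace Setup

variable {d n nb : ℕ} {S : Setup d n nb} {P : Params d} {ε : ℝ} {xt : ℕ → Vec (Fin d)}

variable (S P ε) in
/-- `K` is the first outer iteration after which the iterate is an `ε`-KKT point. -/
def FirstKKT (K : ℕ) : Prop :=
  S.IsKKT ε (S.iter P ε K).1 (S.iter P ε K).2 ∧
    ∀ k < K, ¬ S.IsKKT ε (S.iter P ε k).1 (S.iter P ε k).2

theorem Admissible.facts (hLf : 0 < S.Lf) (hε : S.Admissible ε) :
    0 < ε ∧ ε < 1 ∧ ε ^ 2 < 3 * S.Lf := by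
  refine ⟨hε.1, hε.2.trans_le (min_le_right _ _), ?_⟩
  have h := hε.2.trans_le (min_le_left _ _)
  have h2 := pow_lt_pow_left₀ h hε.1.le (two_ne_zero)
  rwa [Real.sq_sqrt (by positivity)] at h2

theorem not_admissible (hLf : S.Lf ≤ 0) : ¬ S.Admissible ε := fun h => by
  have h2 := h.2.trans_le (min_le_left _ _)
  rw [Real.sqrt_eq_zero_of_nonpos (by linarith)] at h2
  exact h2.not_gt h.1

namespace ExactIterates

theorem primalVal_le_of_not_KKT (hx : S.ExactIterates P ε xt) {K : ℕ}
    (hK : ∀ k < K, ¬ S.IsKKT ε (S.iter P ε (k + 1)).1 (S.iter P ε (k + 1)).2) :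
    S.primalVal (xt K) ≤ S.primalVal S.x0 - K * (5 / 1000 * (S.Lf * (ε / S.Lf) ^ 2)) := by
  induction K with
  | zero => simp [hx.zero]
  | succ K ih =>
    have h1 := ih fun k hk => hK k (hk.trans K.lt_succ_self)
    have h2 := hx.descent_of_not_KKT K (hK K K.lt_succ_self)
    push_cast
    linarith

theorem le_of_not_KKT (hLf : 0 < S.Lf) (hε : 0 < ε) (hx : S.ExactIterates P ε xt) {D : ℝ}
    (hD : ∀ k, S.primalVal S.x0 - S.primalVal (xt k) ≤ D) {K : ℕ}
    (hK : ∀ k < K, ¬ S.IsKKT ε (S.iter P ε (k + 1)).1 (S.iter P ε (k + 1)).2) :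
    (K : ℝ) ≤ 200 * (S.Lf * D / ε ^ 2) := by
  have h1 := hx.primalVal_le_of_not_KKT hK
  have h2 : S.Lf * (ε / S.Lf) ^ 2 = ε ^ 2 / S.Lf := by field_simp
  have h3 : K * (5 / 1000 * (ε ^ 2 / S.Lf)) ≤ D := by rw [← h2]; linarith [hD K]
  have h4 : S.Lf * D / ε ^ 2 = D / (ε ^ 2 / S.Lf) := by field_simp
  have h5 : (K : ℝ) * (5 / 1000) ≤ D / (ε ^ 2 / S.Lf) := by
    rw [le_div_iff₀ (by positivity)]; linarith
  rw [h4]; linarith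

theorem exists_firstKKT (hLf : 0 < S.Lf) (hε : 0 < ε) (hx : S.ExactIterates P ε xt) {D : ℝ}
    (hD : ∀ k, S.primalVal S.x0 - S.primalVal (xt k) ≤ D) : ∃ K, S.FirstKKT P ε K := by
  classical
  have h : ∃ K, S.IsKKT ε (S.iter P ε K).1 (S.iter P ε K).2 := by
    by_contra! hc
    obtain ⟨K, hK⟩ := exists_nat_gt (200 * (S.Lf * D / ε ^ 2))
    exact hK.not_ge (hx.le_of_not_KKT hLf hε hD fun k _ => hc (k + 1))
  exact ⟨Nat.find h, Nat.find_spec h, fun k hk => Nat.find_min h hk⟩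

theorem le_of_firstKKT (hLf : 0 < S.Lf) (hε : 0 < ε) (hx : S.ExactIterates P ε xt) {D : ℝ}
    (hD : ∀ k, S.primalVal S.x0 - S.primalVal (xt k) ≤ D) {K k : ℕ} (hK : S.FirstKKT P ε K)
    (hk : k < K) : (k : ℝ) ≤ 200 * (S.Lf * D / ε ^ 2) :=
  hx.le_of_not_KKT hLf hε hD fun i hi => hK.2 (i + 1) (by omega)

/-- Each step is at most `1 + V²`, and the sum of the `V²` is controlled by the total decrease plus
a constant per step, so the exact points grow at most linearly in `k`. This replaces boundedness in
(a) and (b). -/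
theorem norm_le (hLf : 0 < S.Lf) (hε : 0 < ε) (hε1 : ε < 1) (hw : ∀ k, 0 < P.w k ∧ P.w k ≤ 1)
    (hx : S.ExactIterates P ε xt) {D : ℝ}
    (hD : ∀ k, S.primalVal S.x0 - S.primalVal (xt k) ≤ D) (k : ℕ) :
    ‖xt k‖ ≤ ‖S.x0‖ + D / S.Lf + k * (1 + 1 / S.Lf ^ 2) := by
  have hω : ∀ k, lagWeight P k ^ 2 ≤ 1 := by
    rintro (_ | k)
    · simp [lagWeight]
    · exact pow_le_one₀ (hw k).1.le (hw k).2
  have ha : (ε / S.Lf) ^ 2 ≤ 1 / S.Lf ^ 2 := by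
    rw [div_pow]
    gcongr
    exact pow_le_one₀ hε.le hε1.le
  have key : ∀ k : ℕ, ‖xt k‖ ≤ ‖S.x0‖ + (S.primalVal S.x0 - S.primalVal (xt k)) / S.Lf
      + k * (1 + 1 / S.Lf ^ 2) := by
    intro k
    induction k with
    | zero => simp [hx.zero]
    | succ k ih =>
      have h1 := hx.descent k
      have h2 : ‖xt (k + 1)‖ ≤ ‖xt k‖ + ‖xt (k + 1) - xt k‖ := by
        have := norm_add_le (xt k) (xt (k + 1) - xt k)
        rwa [add_sub_cancel] at this
      have h3 : ‖xt (k + 1) - xt k‖ ≤ 1 + ‖xt (k + 1) - xt k‖ ^ 2 := by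
        nlinarith [sq_nonneg (‖xt (k + 1) - xt k‖ - 1), norm_nonneg (xt (k + 1) - xt k)]
      have h4 : lagWeight P k ^ 2 * (ε / S.Lf) ^ 2 ≤ 1 / S.Lf ^ 2 :=
        (mul_le_of_le_one_left (sq_nonneg _) (hω k)).trans ha
      have h5 : ‖xt (k + 1) - xt k‖ ^ 2 - 23 / 1000 * lagWeight P k ^ 2 * (ε / S.Lf) ^ 2
          ≤ (S.primalVal (xt k) - S.primalVal (xt (k + 1))) / S.Lf := by
        rw [le_div_iff₀ hLf]; linarith
      have h6 : 0 ≤ 1 / S.Lf ^ 2 := by positivity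
      rw [sub_div] at h5 ih ⊢
      push_cast
      linarith
  have := key k
  have h7 := div_le_div_of_nonneg_right (hD k) hLf.le
  linarith

end ExactIterates

namespace Assumptions

variable (hA : S.Assumptions)
include hA

theorem F_coe {x : Vec (Fin d)} {y : Vec (Fin nb)} (hy : y ∈ dom S.g) :
    S.F (x, y) = ((S.f₀ x + (S.g y).toReal : ℝ) : EReal) := by
  rw [F, EReal.coe_add, hA.g_convex.coe_toReal hy]

theorem primalVal_x0 : S.primalVal S.x0 = S.f₀ S.x0 + (S.g S.y0).toReal := by
  rw [primalVal, ← hA.y0_feasible]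

theorem sub_le_ΔF (hB : S.BoundedBelow) {x : Vec (Fin d)} {y : Vec (Fin nb)} (hy : y ∈ dom S.g) :
    S.primalVal S.x0 - (S.f₀ x + (S.g y).toReal) ≤ S.ΔF := by
  obtain ⟨m, hm⟩ := hB
  have h1 : (m : EReal) ≤ ⨅ p, S.F p := le_iInf hm
  have h2 : ⨅ p, S.F p ≤ ((S.f₀ x + (S.g y).toReal : ℝ) : EReal) :=
    (iInf_le _ (x, y)).trans_eq (hA.F_coe hy)
  have h3 : ⨅ p, S.F p ≠ ⊥ := fun h => by
    rw [h, le_bot_iff] at h1; exact EReal.coe_ne_bot m h1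
  have h4 := EReal.toReal_le_toReal h2 h3 (EReal.coe_ne_top _)
  rw [EReal.toReal_coe] at h4
  rw [ΔF, hA.F_coe hA.y0_dom, EReal.toReal_coe, hA.primalVal_x0]
  linarith

theorem ΔF_nonneg (hB : S.BoundedBelow) : 0 ≤ S.ΔF := by
  have := hA.sub_le_ΔF hB (x := S.x0) hA.y0_dom
  rwa [hA.primalVal_x0, sub_self] at this

/-- Exact points satisfy both constraints, so a lower bound of `F₀` suffices here even if `F` is
unbounded below. -/
theorem exists_sub_le (hx : S.ExactIterates P ε xt) :
    ∃ D, ∀ k, S.primalVal S.x0 - S.primalVal (xt k) ≤ D := by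
  obtain ⟨m, hm⟩ := hA.inf_F₀
  refine ⟨S.primalVal S.x0 - m, fun k => sub_le_sub_left ?_ _⟩
  have h := hm (xt k)
  have h2 : S.F₀ (xt k) = S.F (xt k, mul S.Abar (xt k) + S.bbar) := rfl
  rw [h2, hA.F_coe (hx.mem_dom k)] at h
  exact EReal.coe_le_coe_iff.1 h

/-- If `Δ_F = 0`, the initial pair minimizes `F` over all pairs, so `∇f₀(x⁰) = 0` and `0 ∈ ∂g(y⁰)`,
and zero multipliers work. -/
theorem isKKT_of_ΔF_eq_zero (hB : S.BoundedBelow) (h0 : S.ΔF = 0) (hε : 0 < ε) :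
    S.IsKKT ε S.x0 S.y0 := by
  have h : ∀ x, ∀ y ∈ dom S.g, S.f₀ S.x0 + (S.g S.y0).toReal ≤ S.f₀ x + (S.g y).toReal := by
    intro x y hy
    have := hA.sub_le_ΔF hB (x := x) hy
    rw [h0, hA.primalVal_x0] at this
    linarith
  have hgrad : gradient S.f₀ S.x0 = 0 := by
    have hmin : IsLocalMin S.f₀ S.x0 := Filter.Eventually.of_forall fun x => by
      linarith [h x _ hA.y0_dom]
    rw [gradient, hmin.fderiv_eq_zero, map_zero]
  refine ⟨0, 0, ?_, ?_, ?_, ?_⟩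
  · have h0 : (0 : Vec (Fin nb)) ∈ (fun ξ => ξ - (0 : Vec (Fin nb))) '' subdiff S.g S.y0 := by
      refine ⟨0, hA.g_convex.mem_subdiff_iff.2 ⟨hA.y0_dom, fun y hy => ?_⟩, sub_zero 0⟩
      rw [inner_zero_left]
      linarith [h S.x0 y hy]
    rw [Metric.infEDist_zero_of_mem h0]
    exact bot_le
  · rw [hgrad, map_zero, map_zero, add_zero, add_zero, norm_zero]; exact hε.le
  · rw [hA.y0_feasible, add_sub_cancel_left, sub_self, norm_zero]; exact hε.le
  · rw [hA.x0_feasible, norm_zero]; exact hε.le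

theorem FirstKKT.eq_zero (hB : S.BoundedBelow) (h0 : S.ΔF = 0) (hε : 0 < ε) {K : ℕ}
    (hK : S.FirstKKT P ε K) : K = 0 := by
  by_contra h
  exact hK.2 0 (Nat.pos_of_ne_zero h) (hA.isKKT_of_ΔF_eq_zero hB h0 hε)

theorem findsKKT (hw : ∀ k, 0 < P.w k ∧ P.w k ≤ 1)
    (hacc : 0 < S.Lf → ∀ ε > 0, ∀ k, S.Accepts (S.iter P ε k).1 (S.mu P ε k (S.iter P ε k).1)
      (S.zNext P ε k (S.iter P ε k).1)) : S.FindsKKT P := by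
  intro ε hε
  rcases le_or_gt S.Lf 0 with hLf | hLf
  · exact absurd hε (not_admissible hLf)
  obtain ⟨xt, hx⟩ := hA.exists_exactIterates hLf hε.1 hw (hacc hLf ε hε.1)
  obtain ⟨D, hD⟩ := hA.exists_sub_le hx
  obtain ⟨K, hK⟩ := hx.exists_firstKKT hLf hε.1 hD
  exact ⟨K, fun k _ => hacc hLf ε hε.1 k, hK.1⟩

end Assumptions

end Setup
end PGRPD

namespace PGRPD

namespace Setup

variable {d n nb : ℕ} {S : Setup d n nb} {P : Params d} {ε : ℝ} {xt : ℕ → Vec (Fin d)}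

/-! ### Growth of the subproblem data in the outer iterate -/

namespace Assumptions

variable (hA : S.Assumptions)
include hA

theorem norm_gradient_le (x : Vec (Fin d)) :
    ‖gradient S.f₀ x‖ ≤ ‖gradient S.f₀ 0‖ + S.Lf * ‖x‖ := by
  have h1 := hA.lipschitz_grad x 0
  have h2 := norm_add_le (gradient S.f₀ 0) (gradient S.f₀ x - gradient S.f₀ 0)
  rw [add_sub_cancel] at h2
  rw [sub_zero] at h1
  linarith

theorem exists_gradient_le (hLf : 0 < S.Lf) :
    ∃ C : ℝ, 1 ≤ C ∧ ∀ x, ‖gradient S.f₀ x‖ ≤ C * (1 + ‖x‖) := by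
  refine ⟨1 + ‖gradient S.f₀ 0‖ + S.Lf, by linarith [norm_nonneg (gradient S.f₀ 0)], fun x => ?_⟩
  have h := hA.norm_gradient_le x
  nlinarith [norm_nonneg x, norm_nonneg (gradient S.f₀ 0),
    mul_nonneg (norm_nonneg (gradient S.f₀ 0)) (norm_nonneg x)]

/-- `𝒟(z^ini)` is at most quadratic in `‖x‖`, and by `le_dualVal` the minimum falls at most
linearly. -/
theorem exists_gap_le (hLf : 0 < S.Lf) (hΩ : ∀ x, (S.Ω x).Nonempty) :
    ∃ C : ℝ, 1 ≤ C ∧ ∀ x, S.gap x ≤ C * (1 + ‖x‖) ^ 2 := by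
  obtain ⟨G, hG1, hG⟩ := hA.exists_gradient_le hLf
  have hτ := τ_pos hLf
  set R := ‖mul S.H.transpose S.zini‖ + G + S.τ with hR
  have hR0 : 0 ≤ R := by positivity
  set E := |⟪fstBlock S.zini, S.bbar⟫_ℝ| + |⟪sndBlock S.zini, S.b⟫_ℝ|
    + |(conj S.g (fstBlock S.zini)).toReal| + S.τ / 2 * ‖S.x0‖ ^ 2 + |(S.g S.y0).toReal| with hE
  have hE0 : 0 ≤ E := by positivity
  refine ⟨1 + 1 / (2 * S.τ) * R ^ 2 + E + (G + S.τ) * ‖S.x0‖, ?_, fun x => ?_⟩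
  · have : 0 ≤ 1 / (2 * S.τ) * R ^ 2 + E + (G + S.τ) * ‖S.x0‖ := by positivity
    linarith
  obtain ⟨w, hw⟩ := hΩ x
  have h1 := hA.le_dualVal hLf x (hA.mem_Ω_iff.1 hw).1
  have hs : 1 ≤ 1 + ‖x‖ := by linarith [norm_nonneg x]
  set s := 1 + ‖x‖
  have hxs : ‖x‖ ≤ s := by simp [s]
  have h2 : ‖gradient S.f₀ x - S.τ • x‖ ≤ (G + S.τ) * s := by
    refine (norm_sub_le _ _).trans ?_
    rw [norm_smul, Real.norm_eq_abs, abs_of_pos hτ, add_mul]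
    gcongr
    exact hG x
  have h3 : ‖S.dualResidual x S.zini‖ ≤ R * s := by
    rw [dualResidual, add_sub_assoc]
    refine (norm_add_le _ _).trans ?_
    have := le_mul_of_one_le_right (norm_nonneg (mul S.H.transpose S.zini)) hs
    rw [hR]
    linarith
  have h4 : ‖S.dualResidual x S.zini‖ ^ 2 ≤ R ^ 2 * s ^ 2 := by
    rw [← mul_pow]; exact pow_le_pow_left₀ (norm_nonneg _) h3 2
  have h5 : ⟪gradient S.f₀ x - S.τ • x, S.x0⟫_ℝ ≤ (G + S.τ) * s * ‖S.x0‖ :=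
    (real_inner_le_norm _ _).trans (mul_le_mul_of_nonneg_right h2 (norm_nonneg _))
  have h6 : 0 ≤ 1 / (2 * S.τ) * ‖S.dualResidual x w + S.τ • S.x0‖ ^ 2 := by positivity
  have h7 : 1 / (2 * S.τ) * ‖S.dualResidual x S.zini‖ ^ 2 ≤ 1 / (2 * S.τ) * (R ^ 2 * s ^ 2) := by
    gcongr
  have hss : s ≤ s ^ 2 := by nlinarith
  have h8 : (G + S.τ) * s * ‖S.x0‖ ≤ (G + S.τ) * ‖S.x0‖ * s ^ 2 := by
    have := mul_le_mul_of_nonneg_left hss (by positivity : 0 ≤ (G + S.τ) * ‖S.x0‖)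
    linarith
  have h9 : E ≤ E * s ^ 2 := le_mul_of_one_le_right hE0 (by linarith)
  have h10 : S.dualVal x S.zini = 1 / (2 * S.τ) * ‖S.dualResidual x S.zini‖ ^ 2
      - ⟪fstBlock S.zini, S.bbar⟫_ℝ - ⟪sndBlock S.zini, S.b⟫_ℝ
      + (conj S.g (fstBlock S.zini)).toReal := rfl
  have h11 := neg_abs_le ⟪fstBlock S.zini, S.bbar⟫_ℝ
  have h12 := neg_abs_le ⟪sndBlock S.zini, S.b⟫_ℝ
  have h13 := le_abs_self (conj S.g (fstBlock S.zini)).toReal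
  have h14 := le_abs_self (S.g S.y0).toReal
  have h15 : (1 + 1 / (2 * S.τ) * R ^ 2 + E + (G + S.τ) * ‖S.x0‖) * s ^ 2 = s ^ 2
      + 1 / (2 * S.τ) * (R ^ 2 * s ^ 2) + E * s ^ 2 + (G + S.τ) * ‖S.x0‖ * s ^ 2 := by ring
  rw [hA.gap_eq hw, h10, h15]
  clear_value s R
  linarith [sq_nonneg s]

/-- `B₃` and `B₄` grow at most linearly in `‖x‖`. A crude polynomial bound is enough because the
accuracy enters the step count only through a logarithm. -/
theorem exists_le_muTilde (hLf : 0 < S.Lf) :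
    ∃ C : ℝ, 1 ≤ C ∧ ∀ ε, 0 < ε → ε ≤ 1 → ∀ x, ε ^ 2 / (C * (1 + ‖x‖)) ≤ S.muTilde ε x := by
  obtain ⟨G, hG1, hG⟩ := hA.exists_gradient_le hLf
  have hτ := τ_pos hLf
  have h1 := specNorm_nonneg S.Abar
  have h2 := specNorm_nonneg S.H
  have hσ := hA.σ_pos
  have hB₁ := hA.B₁_pos hLf
  have hlg := hA.lg_pos
  have hp := pinvNorm_nonneg (S := S)
  have hB₂ : 0 < S.B₂ := by rw [B₂]; positivity
  set β := S.pinvNorm * (G + specNorm S.Abar * S.lg) with hβ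
  have hβ0 : 0 ≤ β := by positivity
  set β' := 1 / S.τ * (G + specNorm S.H * (S.lg + β)) with hβ'
  have hβ'0 : 0 ≤ β' := by positivity
  set c₃ := 12 * S.Lf * S.B₁ * (β + S.σ * specNorm S.Abar * β' + S.lg) with hc₃
  have hc₃0 : 0 < c₃ := by positivity
  set c₄ := 12 * S.Lf * S.B₁ * S.B₂ * (1 + 1 / S.τ * S.σ * specNorm S.Abar * specNorm S.H) with hc₄
  have hc₄0 : 0 < c₄ := by positivity
  have hC : 1 ≤ 1 + S.B₁ * S.σ + S.B₁ + c₃ + c₄ := by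
    have : 0 ≤ S.B₁ * S.σ := by positivity
    linarith
  refine ⟨1 + S.B₁ * S.σ + S.B₁ + c₃ + c₄, hC, fun ε hε hε1 x => ?_⟩
  set C := 1 + S.B₁ * S.σ + S.B₁ + c₃ + c₄ with hCdef
  have hs : 1 ≤ 1 + ‖x‖ := by linarith [norm_nonneg x]
  have hB3 : S.B₃ x ≤ β * (1 + ‖x‖) := by
    rw [B₃, hβ, mul_assoc, add_mul]
    exact mul_le_mul_of_nonneg_left
      (add_le_add (hG x) (le_mul_of_one_le_right (by positivity) hs)) hp
  have hB4 : S.B₄ x ≤ β' * (1 + ‖x‖) := by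
    rw [B₄, hβ', mul_assoc, add_mul, mul_assoc (specNorm S.H), add_mul]
    exact mul_le_mul_of_nonneg_left (add_le_add (hG x) (mul_le_mul_of_nonneg_left
      (add_le_add (le_mul_of_one_le_right hlg.le hs) hB3) h2)) (by positivity)
  have hB30 := hA.B₃_nonneg x
  have hB40 := hA.B₄_nonneg hLf x
  set s := 1 + ‖x‖
  have hs0 : 0 < s := by linarith
  have hC0 : 0 < C := by linarith
  have hBσ : 0 < S.B₁ * S.σ := by positivity
  have hCs : C ≤ C * s := le_mul_of_one_le_right hC0.le hs
  have hεε : ε ^ 2 ≤ ε := by nlinarith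
  have hBc : S.B₁ * S.σ ≤ C ∧ S.B₁ ≤ C ∧ c₃ ≤ C ∧ c₄ ≤ C := by
    refine ⟨?_, ?_, ?_, ?_⟩ <;> linarith
  have e1 : 12 * S.Lf * S.B₁ * (S.B₃ x + S.σ * specNorm S.Abar * S.B₄ x + S.lg) ≤ c₃ * s := by
    have e1 : S.B₃ x + S.σ * specNorm S.Abar * S.B₄ x + S.lg
        ≤ (β + S.σ * specNorm S.Abar * β' + S.lg) * s := by
      have := mul_le_mul_of_nonneg_left hB4 (by positivity : 0 ≤ S.σ * specNorm S.Abar)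
      have := le_mul_of_one_le_right hlg.le hs
      linarith
    have e2 := mul_le_mul_of_nonneg_left e1 (by positivity : 0 ≤ 12 * S.Lf * S.B₁)
    rwa [← mul_assoc] at e2
  have e0 : 0 < 12 * S.Lf * S.B₁ * (S.B₃ x + S.σ * specNorm S.Abar * S.B₄ x + S.lg) := by
    positivity
  have e2 : C ≤ (C * s) ^ 2 := hCs.trans (le_self_pow₀ (hC.trans hCs) two_ne_zero)
  have e3 : (ε ^ 2) ^ 2 ≤ ε ^ 2 :=
    pow_le_of_le_one (sq_nonneg ε) (pow_le_one₀ hε.le hε1) two_ne_zero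
  rw [muTilde, ← hc₄]
  clear_value C c₃ c₄ s β β'
  refine le_min (le_min ?_ ?_) (le_min ?_ ?_)
  · exact div_le_div₀ hε.le hεε hBσ (by linarith)
  · exact div_le_div₀ hε.le hεε hB₁ (by linarith)
  · exact div_le_div₀ (sq_nonneg ε) le_rfl e0
      (e1.trans (mul_le_mul_of_nonneg_right hBc.2.2.1 hs0.le))
  · refine Real.le_sqrt_of_sq_le ?_
    rw [div_pow]
    exact div_le_div₀ (sq_nonneg ε) e3 hc₄0 (hBc.2.2.2.trans e2)

end Assumptions

end Setup
end PGRPD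

namespace PGRPD

namespace Setup

variable {d n nb : ℕ} {S : Setup d n nb} {P : Params d} {ε : ℝ} {xt : ℕ → Vec (Fin d)}

/-! ### Polynomial bounds along a run -/

variable (S P) in
/-- Parameters whose weights decrease at most quadratically and whose cycle lengths and growth
constants are controlled by the dual gap and by `ν`. -/
structure ModerateParams (c : ℝ) : Prop where
  w_mem : ∀ k, 0 < P.w k ∧ P.w k ≤ 1
  one_le_w_mul : ∀ k : ℕ, 1 ≤ P.w k * ((k : ℝ) + 1) ^ 2
  ρ_pos : ∀ x, 0 < P.ρ x
  one_le_ρ_mul : ∀ x, 1 ≤ P.ρ x * (c * (1 + S.gap x + ‖S.ν x‖ ^ 2))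
  j_le : ∀ x, (P.j x : ℝ) ≤ c * (1 + S.gap x + ‖S.ν x‖ ^ 2)
  Ω_nonempty : ∀ x, (S.Ω x).Nonempty
  accepts : ∀ ε > 0, ∀ k, S.Accepts (S.iter P ε k).1 (S.mu P ε k (S.iter P ε k).1)
      (S.zNext P ε k (S.iter P ε k).1)

namespace Assumptions

variable (hA : S.Assumptions)
include hA

/-- Put `t = 1/ε`. Then `k` and `‖x^(k)‖` are `O(t²)`, so the gap, `‖ν‖²` and `1/ρ` are `O(t⁴)`.
Both `1/μ̃` and `1/w_k` are `O(t⁴)`, so `1/μ² = O(t¹⁶)`; altogether `4 + 4 + 16 = 24`. -/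
theorem exists_run_bounds (hLf : 0 < S.Lf) (hB : S.BoundedBelow) {c : ℝ} (hc : 1 ≤ c)
    (hP : S.ModerateParams P c) :
    ∃ C : ℝ, 1 ≤ C ∧ ∀ ε, S.Admissible ε → ∀ xt, S.ExactIterates P ε xt → ∀ k : ℕ,
      (k : ℝ) ≤ 200 * (S.Lf * S.ΔF / ε ^ 2) →
        2 * S.gap (S.iter P ε k).1 / (P.ρ (S.iter P ε k).1 * S.mu P ε k (S.iter P ε k).1 ^ 2)
          ≤ C * (1 / ε) ^ 24 ∧
        (P.j (S.iter P ε k).1 : ℝ) ≤ C * (1 / ε) ^ 4 ∧ (k : ℝ) + 1 ≤ C * (1 / ε) ^ 2 := by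
  obtain ⟨G, hG1, hG⟩ := hA.exists_gap_le hLf hP.Ω_nonempty
  obtain ⟨M, hM1, hM⟩ := hA.exists_le_muTilde hLf
  have hD0 := hA.ΔF_nonneg hB
  have hτ := τ_pos hLf
  obtain ⟨N, hN⟩ : ∃ r, r = 1 + 200 * (S.Lf * S.ΔF) := ⟨_, rfl⟩
  have hN1 : 1 ≤ N := by
    have : 0 ≤ S.Lf * S.ΔF := by positivity
    linarith
  obtain ⟨R₁, hR₁⟩ : ∃ r, r = ‖S.x0‖ + S.ΔF / S.Lf + N * (1 + 1 / S.Lf ^ 2) := ⟨_, rfl⟩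
  have hR₁0 : 0 ≤ R₁ := by rw [hR₁]; positivity
  obtain ⟨R₂, hR₂⟩ : ∃ r, r = 1 + R₁ + 1 / S.Lf := ⟨_, rfl⟩
  have hR₂1 : 1 ≤ R₂ := by
    have : 0 ≤ 1 / S.Lf := by positivity
    linarith
  obtain ⟨V, hV⟩ : ∃ r, r = 1 + G * R₂ ^ 2 + S.τ ^ 2 * R₁ ^ 2 := ⟨_, rfl⟩
  have hV1 : 1 ≤ V := by
    have : 0 ≤ G * R₂ ^ 2 + S.τ ^ 2 * R₁ ^ 2 := by positivity
    linarith
  obtain ⟨T, hT⟩ : ∃ r, r = 2 * (G * R₂ ^ 2) * (c * V) * (N ^ 2 * (M * R₂)) ^ 2 := ⟨_, rfl⟩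
  have hT0 : 0 ≤ T := by rw [hT]; positivity
  have hcV : 0 ≤ c * V := by positivity
  refine ⟨1 + T + c * V + N, by linarith, fun ε hε xt hx k hk => ?_⟩
  obtain ⟨hε0, hε1, -⟩ := hε.facts hLf
  obtain ⟨t, ht⟩ : ∃ r, r = 1 / ε := ⟨_, rfl⟩
  rw [← ht]
  have ht0 : 0 < t := by rw [ht]; positivity
  have ht1 : 1 ≤ t := by rw [ht, le_div_iff₀ hε0]; linarith
  have hp : ∀ m, 1 ≤ t ^ m := fun m => one_le_pow₀ ht1
  have hk1 : (k : ℝ) + 1 ≤ N * t ^ 2 := by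
    have : 200 * (S.Lf * S.ΔF / ε ^ 2) = 200 * (S.Lf * S.ΔF) * t ^ 2 := by rw [ht]; field_simp
    rw [hN, add_mul, one_mul]
    linarith [hp 2]
  have hxk : ∀ i : ℕ, (i : ℝ) ≤ k + 1 → ‖xt i‖ ≤ R₁ * t ^ 2 := by
    intro i hi
    have h1 := hx.norm_le hLf hε0 hε1 hP.w_mem (fun k => hA.sub_le_ΔF hB (hx.mem_dom k)) i
    refine h1.trans ?_
    have h2 : (i : ℝ) * (1 + 1 / S.Lf ^ 2) ≤ N * t ^ 2 * (1 + 1 / S.Lf ^ 2) := by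
      gcongr
      exact hi.trans hk1
    have h3 : ‖S.x0‖ + S.ΔF / S.Lf ≤ (‖S.x0‖ + S.ΔF / S.Lf) * t ^ 2 :=
      le_mul_of_one_le_right (by positivity) (hp 2)
    rw [hR₁]; linarith
  have hx1 : 1 + ‖(S.iter P ε k).1‖ ≤ R₂ * t ^ 2 := by
    have h1 := hxk k (by linarith)
    have h2 := hx.near k
    have h3 := norm_add_le (xt k) ((S.iter P ε k).1 - xt k)
    rw [add_sub_cancel] at h3
    have h4 : ε / S.Lf ≤ 1 / S.Lf := by gcongr
    have h5 : 1 + 1 / S.Lf ≤ (1 + 1 / S.Lf) * t ^ 2 := le_mul_of_one_le_right (by positivity) (hp 2)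
    have h6 : 0 ≤ ε / S.Lf := by positivity
    rw [hR₂]; linarith
  have hs : 1 ≤ 1 + ‖(S.iter P ε k).1‖ := by linarith [norm_nonneg (S.iter P ε k).1]
  have hgap0 := hA.gap_nonneg (hP.Ω_nonempty (S.iter P ε k).1)
  have hgap : S.gap (S.iter P ε k).1 ≤ G * R₂ ^ 2 * t ^ 4 := by
    refine (hG _).trans ?_
    calc G * (1 + ‖(S.iter P ε k).1‖) ^ 2 ≤ G * (R₂ * t ^ 2) ^ 2 := by gcongr
      _ = _ := by ring
  have hν : ‖S.ν (S.iter P ε k).1‖ ^ 2 ≤ S.τ ^ 2 * R₁ ^ 2 * t ^ 4 := by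
    rw [hx.ν_eq, norm_neg, norm_smul, Real.norm_eq_abs, mul_pow, sq_abs]
    have h1 := hxk (k + 1) (by push_cast; exact le_rfl)
    calc S.τ ^ 2 * ‖xt (k + 1)‖ ^ 2 ≤ S.τ ^ 2 * (R₁ * t ^ 2) ^ 2 := by gcongr
      _ = _ := by ring
  have hVt : 1 + S.gap (S.iter P ε k).1 + ‖S.ν (S.iter P ε k).1‖ ^ 2 ≤ V * t ^ 4 := by
    rw [hV]; linarith [hp 4]
  have hcVt := mul_le_mul_of_nonneg_left hVt (by linarith : 0 ≤ c)
  have hmu : 1 ≤ S.mu P ε k (S.iter P ε k).1 * (N ^ 2 * (M * R₂) * t ^ 8) := by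
    have h1 := hM ε hε0 hε1.le (S.iter P ε k).1
    rw [div_le_iff₀ (by positivity)] at h1
    have h2 : 1 ≤ S.muTilde ε (S.iter P ε k).1 * (M * R₂) * t ^ 4 := by
      have hm := hA.muTilde_pos hLf hε0 (S.iter P ε k).1
      calc (1 : ℝ) = ε ^ 2 * t ^ 2 := by rw [ht]; field_simp
        _ ≤ S.muTilde ε (S.iter P ε k).1 * (M * (1 + ‖(S.iter P ε k).1‖)) * t ^ 2 := by gcongr
        _ ≤ S.muTilde ε (S.iter P ε k).1 * (M * (R₂ * t ^ 2)) * t ^ 2 := by gcongr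
        _ = _ := by ring
    have h3 : 1 ≤ P.w k * (N * t ^ 2) ^ 2 := by
      refine (hP.one_le_w_mul k).trans ?_
      have := (hP.w_mem k).1
      gcongr
    calc (1 : ℝ) ≤ P.w k * (N * t ^ 2) ^ 2 * (S.muTilde ε (S.iter P ε k).1 * (M * R₂) * t ^ 4) :=
          one_le_mul_of_one_le_of_one_le h3 h2
      _ = _ := by rw [mu]; ring
  have hmu0 : 0 < S.mu P ε k (S.iter P ε k).1 :=
    mul_pos (hP.w_mem k).1 (hA.muTilde_pos hLf hε0 _)
  have hρ0 := hP.ρ_pos (S.iter P ε k).1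
  refine ⟨?_, ?_, ?_⟩
  · rw [div_le_iff₀ (by positivity)]
    have h1 : 1 ≤ P.ρ (S.iter P ε k).1 * (c * (V * t ^ 4)) :=
      (hP.one_le_ρ_mul _).trans (mul_le_mul_of_nonneg_left hcVt hρ0.le)
    have h2 : 1 ≤ (S.mu P ε k (S.iter P ε k).1 * (N ^ 2 * (M * R₂) * t ^ 8)) ^ 2 := one_le_pow₀ hmu
    calc 2 * S.gap (S.iter P ε k).1 ≤ 2 * (G * R₂ ^ 2 * t ^ 4) := by linarith
      _ ≤ 2 * (G * R₂ ^ 2 * t ^ 4) * (P.ρ (S.iter P ε k).1 * (c * (V * t ^ 4))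
          * (S.mu P ε k (S.iter P ε k).1 * (N ^ 2 * (M * R₂) * t ^ 8)) ^ 2) :=
        le_mul_of_one_le_right (by positivity) (one_le_mul_of_one_le_of_one_le h1 h2)
      _ = T * t ^ 24 * (P.ρ (S.iter P ε k).1 * S.mu P ε k (S.iter P ε k).1 ^ 2) := by rw [hT]; ring
      _ ≤ _ := by
        gcongr
        linarith
  · refine (hP.j_le _).trans (hcVt.trans ?_)
    rw [← mul_assoc]
    gcongr
    linarith
  · refine hk1.trans ?_
    gcongr
    linarith

end Assumptions

end Setup
end PGRPD

/-! ### Counting the APG steps. -/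

namespace PGRPD

theorem ceil_logb_two_le {x y : ℝ} (hx : 0 ≤ x) (hy : 1 ≤ y) (hxy : x ≤ y) :
    (⌈Real.logb 2 x⌉₊ : ℝ) ≤ Real.log y / Real.log 2 + 1 := by
  have h0 : 0 ≤ Real.logb 2 y := Real.logb_nonneg one_lt_two hy
  have h1 : Real.logb 2 x ≤ Real.logb 2 y := by
    rcases hx.eq_or_lt with rfl | hx
    · rwa [Real.logb_zero]
    · exact Real.logb_le_logb_of_le one_lt_two hx hxy
  exact (Nat.cast_le.2 (Nat.ceil_le_ceil h1)).trans (Nat.ceil_lt_add_one h0).le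

/-- The hypothesis says `M ≥ √ε`, hence `M / ε ≥ (1/ε)^(1/2)`. -/
theorem half_log_le {M ε : ℝ} (hM : 0 < M) (hε : 0 < ε) (h : ε ≤ M ^ 2) :
    Real.log (1 / ε) ≤ 2 * Real.log (M / ε) := by
  have h1 := Real.log_le_log hε h
  rw [Real.log_pow] at h1
  rw [Real.log_div hM.ne' hε.ne', Real.log_div one_ne_zero hε.ne', Real.log_one]
  push_cast at h1
  linarith

namespace Setup

variable {d n nb : ℕ} {S : Setup d n nb} {P : Params d} {ε : ℝ}

theorem solvesWithin_of_nonpos (hLf : S.Lf ≤ 0) (cst Q M : ℝ) : S.SolvesWithin P cst Q M :=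
  ⟨1, le_rfl, 1, one_pos, fun _ hε => absurd hε (not_admissible hLf)⟩

theorem totalSteps_le {K : ℕ} {I J : ℝ} (hI : 0 ≤ I)
    (h : ∀ k < K, (S.numCycles P ε k (S.iter P ε k).1 : ℝ) ≤ I ∧ (P.j (S.iter P ε k).1 : ℝ) ≤ J) :
    (S.totalSteps P ε K : ℝ) ≤ K * (I * J) := by
  rw [totalSteps]
  push_cast
  refine (Finset.sum_le_card_nsmul (Finset.range K) _ (I * J) fun k hk => ?_).trans_eq ?_
  · obtain ⟨h1, h2⟩ := h k (Finset.mem_range.1 hk)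
    exact mul_le_mul h1 h2 (Nat.cast_nonneg _) hI
  · rw [Finset.card_range, nsmul_eq_mul]

namespace Assumptions

variable (hA : S.Assumptions)
include hA

theorem ModerateParams.exists_firstKKT (hLf : 0 < S.Lf) (hB : S.BoundedBelow) {c : ℝ}
    (hP : S.ModerateParams P c) (hε : 0 < ε) :
    ∃ xt, S.ExactIterates P ε xt ∧ ∃ K, S.FirstKKT P ε K ∧ S.SolvedAt P ε K ∧
      ∀ k < K, (k : ℝ) ≤ 200 * (S.Lf * S.ΔF / ε ^ 2) := by
  obtain ⟨xt, hx⟩ := hA.exists_exactIterates hLf hε hP.w_mem (hP.accepts ε hε)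
  have hD := fun k => hA.sub_le_ΔF hB (hx.mem_dom k) (x := xt k)
  obtain ⟨K, hK⟩ := hx.exists_firstKKT hLf hε hD
  exact ⟨xt, hx, K, hK, ⟨fun k _ => hP.accepts ε hε k, hK.1⟩,
    fun k hk => hx.le_of_firstKKT hLf hε hD hK hk⟩

/-- The crude polynomial bound serves accuracies above a threshold; the sharp one serves small `ε`,
once the cycle lengths are bounded. -/
theorem exists_steps_bounds (hLf : 0 < S.Lf) (hB : S.BoundedBelow) {c : ℝ} (hc : 1 ≤ c)
    (hP : S.ModerateParams P c) :
    ∃ C : ℝ, 1 ≤ C ∧ ∀ ε, S.Admissible ε → ∃ K, S.FirstKKT P ε K ∧ S.SolvedAt P ε K ∧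
      (S.totalSteps P ε K : ℝ) ≤ C * (1 / ε) ^ 30 ∧
      (ε ≤ 1 / (C + 3) → ε ^ 2 ≤ S.Lf * S.ΔF → ∀ J : ℝ, 0 ≤ J →
        (∀ k < K, (P.j (S.iter P ε k).1 : ℝ) ≤ J) →
        (S.totalSteps P ε K : ℝ)
          ≤ 201 * (S.Lf * S.ΔF / ε ^ 2) * (38 * Real.log (1 / ε) * J)) := by
  obtain ⟨C, hC1, hC⟩ := hA.exists_run_bounds hLf hB hc hP
  have hC0 : 0 < C := by linarith
  have hC3 : C ≤ 3 * C ^ 3 := by nlinarith [pow_le_pow_left₀ zero_le_one hC1 2]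
  -- Crude product: `C t²` iterations, `3 C t²⁴` cycles each, `C t⁴` steps per cycle.
  refine ⟨3 * C ^ 3, hC1.trans hC3, fun ε hε => ?_⟩
  obtain ⟨hε0, hε1, -⟩ := hε.facts hLf
  obtain ⟨xt, hx, K, hK, hS, hKk⟩ := ModerateParams.exists_firstKKT hA hLf hB hP hε0
  have ht1 : 1 ≤ 1 / ε := by rw [le_div_iff₀ hε0]; linarith
  have hcyc : ∀ k < K, (S.numCycles P ε k (S.iter P ε k).1 : ℝ)
      ≤ Real.log (C * (1 / ε) ^ 24) / Real.log 2 + 1 := fun k hk => by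
    refine ceil_logb_two_le ?_ (one_le_mul_of_one_le_of_one_le hC1 (one_le_pow₀ ht1))
      (hC ε hε xt hx k (hKk k hk)).1
    have := hA.gap_nonneg (hP.Ω_nonempty (S.iter P ε k).1)
    have := hP.ρ_pos (S.iter P ε k).1
    positivity
  have hlog2 := Real.log_two_gt_d9
  refine ⟨K, hK, hS, ?_, fun hεC hεL J hJ hj => ?_⟩
  · set t := 1 / ε
    have hY : 1 ≤ C * t ^ 24 := one_le_mul_of_one_le_of_one_le hC1 (one_le_pow₀ ht1)
    have hI : Real.log (C * t ^ 24) / Real.log 2 + 1 ≤ 3 * (C * t ^ 24) := by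
      have h1 := Real.log_le_self (by linarith : 0 ≤ C * t ^ 24)
      have h2 : Real.log (C * t ^ 24) / Real.log 2 ≤ 2 * (C * t ^ 24) := by
        rw [div_le_iff₀ (by linarith)]; nlinarith
      linarith
    have h3 := totalSteps_le (by positivity : 0 ≤ 3 * (C * t ^ 24)) fun k hk =>
      ⟨(hcyc k hk).trans hI, (hC ε hε xt hx k (hKk k hk)).2.1⟩
    have h4 : (K : ℝ) ≤ C * t ^ 2 := by
      rcases K with _ | k
      · rw [Nat.cast_zero]; positivity
      · push_cast
        exact (hC ε hε xt hx k (hKk k k.lt_succ_self)).2.2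
    refine h3.trans ((mul_le_mul_of_nonneg_right h4 (by positivity)).trans_eq ?_)
    ring
  · have ht : 3 * C ^ 3 + 3 ≤ 1 / ε := by
      rw [le_div_iff₀ hε0, mul_comm]
      exact (le_div_iff₀ (by linarith)).1 hεC
    have hlt : 1 ≤ Real.log (1 / ε) := by
      rw [Real.le_log_iff_exp_le (by linarith)]
      have := Real.exp_one_lt_d9
      linarith
    have hlC : Real.log C ≤ Real.log (1 / ε) := Real.log_le_log hC0 (by linarith)
    -- `log C ≤ log (1/ε)` leaves `25 log(1/ε) / log 2 ≤ 37 log(1/ε)`, and the rounding `1` is at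
    -- most `log(1/ε)`.
    have hI : Real.log (C * (1 / ε) ^ 24) / Real.log 2 + 1 ≤ 38 * Real.log (1 / ε) := by
      rw [Real.log_mul (by positivity) (by positivity), Real.log_pow]
      have : (Real.log C + (24 : ℕ) * Real.log (1 / ε)) / Real.log 2 ≤ 37 * Real.log (1 / ε) := by
        rw [div_le_iff₀ (by linarith)]
        push_cast
        nlinarith
      linarith
    have h3 := totalSteps_le (by linarith : 0 ≤ 38 * Real.log (1 / ε)) fun k hk =>
      ⟨(hcyc k hk).trans hI, hj k hk⟩
    have hE : 1 ≤ S.Lf * S.ΔF / ε ^ 2 := by rwa [le_div_iff₀ (by positivity), one_mul]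
    have h4 : (K : ℝ) ≤ 201 * (S.Lf * S.ΔF / ε ^ 2) := by
      rcases K with _ | k
      · rw [Nat.cast_zero]; linarith
      · push_cast
        linarith [hKk k k.lt_succ_self]
    exact h3.trans (mul_le_mul_of_nonneg_right h4 (mul_nonneg (by linarith) hJ))

theorem solvesWithin (hLf : 0 < S.Lf) (hB : S.BoundedBelow) {c : ℝ} (hc : 1 ≤ c)
    (hP : S.ModerateParams P c) {Q M : ℝ} (hQ : 1 ≤ Q)
    (hj : ∀ ε, S.Admissible ε → ε ^ 2 ≤ S.Lf * S.ΔF → ∀ K, S.FirstKKT P ε K →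
      ∀ k < K, (P.j (S.iter P ε k).1 : ℝ) ≤ 4 * Q)
    (hM : 0 < S.ΔF → 0 < M ∨ M = 0 ∧ ∀ ε, S.Admissible ε → ε ^ 2 ≤ S.Lf * S.ΔF → ∀ K,
      S.FirstKKT P ε K → S.totalSteps P ε K = 0) :
    S.SolvesWithin P 62000 Q M := by
  rcases (hA.ΔF_nonneg hB).eq_or_lt with hΔ | hΔ
  · refine ⟨1, le_rfl, 1, one_pos, fun ε hε => ?_⟩
    obtain ⟨-, -, K, hK, hS, -⟩ := ModerateParams.exists_firstKKT hA hLf hB hP hε.1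
    obtain rfl := FirstKKT.eq_zero hA hB hΔ.symm hε.1 hK
    exact ⟨0, hS, by simp [totalSteps, Kε, ← hΔ], fun _ => by simp [totalSteps, ← hΔ]⟩
  obtain ⟨C, hC1, hC⟩ := hA.exists_steps_bounds hLf hB hc hP
  have hL : 0 < S.Lf * S.ΔF := mul_pos hLf hΔ
  -- Below this threshold `log(1/ε)` can be exchanged for `2 log(M/ε)`.
  obtain ⟨ε₁, hε₁0, hε₁M⟩ : ∃ ε₁ > 0, 0 < M → ∀ ε ≤ ε₁, ε ≤ M ^ 2 := by
    rcases lt_or_ge 0 M with h | h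
    · exact ⟨M ^ 2, by positivity, fun _ _ h => h⟩
    · exact ⟨1, one_pos, fun h' => absurd h' h.not_gt⟩
  obtain ⟨ε₀, hε₀⟩ : ∃ r, r = min (1 / (C + 3)) (min (√(S.Lf * S.ΔF)) ε₁) := ⟨_, rfl⟩
  have hε₀0 : 0 < ε₀ := by
    rw [hε₀]
    exact lt_min (by positivity) (lt_min (by positivity) hε₁0)
  -- `B` is chosen after `ε₀`: for `ε > ε₀` the crude bound is at most `C (1/ε₀)^30`, which the
  -- exponential puts below `log (B/ε)`; the summand `|M|` handles `ε ≤ ε₀`.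
  obtain ⟨B, hBdef⟩ : ∃ r, r = 1 + |M| + Real.exp (C * (1 / ε₀) ^ 30) := ⟨_, rfl⟩
  have hB1 : 1 ≤ B := by linarith [abs_nonneg M, Real.exp_pos (C * (1 / ε₀) ^ 30)]
  refine ⟨B, hB1, ε₀, hε₀0, fun ε hε => ?_⟩
  obtain ⟨hε0, hε1, -⟩ := hε.facts hLf
  obtain ⟨K, hK, hS, hcrude, hsharp⟩ := hC ε hε
  have hE0 : 0 < S.Lf * S.ΔF / ε ^ 2 := by positivity
  have hsmall : ε ≤ ε₀ → (S.totalSteps P ε K : ℝ) ≤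
      62000 * Q * Real.log (M / ε) * (S.Lf * S.ΔF / ε ^ 2) := by
    intro h
    rw [hε₀, le_min_iff, le_min_iff] at h
    have hεL : ε ^ 2 ≤ S.Lf * S.ΔF := by
      rw [← Real.sq_sqrt hL.le]
      exact pow_le_pow_left₀ hε0.le h.2.1 2
    rcases hM hΔ with hM0 | ⟨rfl, hz⟩
    · have h1 := hsharp h.1 hεL (4 * Q) (by linarith) (hj ε hε hεL K hK)
      have h2 := half_log_le hM0 hε0 (hε₁M hM0 ε h.2.2)
      have h0 : 0 ≤ Real.log (1 / ε) := Real.log_nonneg (by rw [le_div_iff₀ hε0]; linarith)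
      have h3 : 0 ≤ Q * (S.Lf * S.ΔF / ε ^ 2) := by positivity
      -- Outer count `201`, cycles `38`, cycle length `4 Q` and the exchange of logarithms `2`
      -- multiply to `61104 ≤ 62000`.
      nlinarith [mul_le_mul_of_nonneg_left h2 h3, mul_nonneg h3 h0]
    -- For `M = 0` the claimed bound is zero because `Real.log 0 = 0`, and no step is made.
    · rw [hz ε hε hεL K hK]; simp
  refine ⟨K, hS, ?_, hsmall⟩
  have hKε : 12 * (S.Lf * S.ΔF / ε ^ 2) ≤ S.Kε ε := by
    refine le_trans (le_of_eq ?_) (Nat.le_ceil _)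
    ring
  have hKε1 : (1 : ℝ) ≤ S.Kε ε := by
    have : 0 < S.Kε ε := by
      rw [← Nat.cast_pos (α := ℝ)]; linarith
    exact_mod_cast this
  have hlogB : 0 ≤ Real.log (B / ε) := Real.log_nonneg (by rw [le_div_iff₀ hε0]; linarith)
  rcases le_or_gt ε ε₀ with h | h
  · refine (hsmall h).trans ?_
    have h1 : Real.log (M / ε) ≤ Real.log (B / ε) := by
      rcases eq_or_ne M 0 with rfl | hM0
      · simpa using hlogB
      rw [← Real.log_abs, abs_div, abs_of_pos hε0]
      refine Real.log_le_log (by positivity) ?_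
      gcongr
      linarith [Real.exp_pos (C * (1 / ε₀) ^ 30)]
    calc _ ≤ 62000 * Q * Real.log (B / ε) * (S.Lf * S.ΔF / ε ^ 2) := by gcongr
      _ ≤ _ := by
        gcongr
        linarith
  · have h1 : C * (1 / ε) ^ 30 ≤ C * (1 / ε₀) ^ 30 := by gcongr
    have h2 : C * (1 / ε₀) ^ 30 ≤ Real.log (B / ε) := by
      rw [Real.le_log_iff_exp_le (by positivity), le_div_iff₀ hε0]
      have := mul_le_of_le_one_right (Real.exp_pos (C * (1 / ε₀) ^ 30)).le hε1.le
      linarith [abs_nonneg M]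
    have h3 : Real.log (B / ε) ≤ 62000 * Q * Real.log (B / ε) :=
      le_mul_of_one_le_left hlogB (by linarith)
    have h4 : 62000 * Q * Real.log (B / ε) ≤ 62000 * Q * Real.log (B / ε) * S.Kε ε :=
      le_mul_of_one_le_right (hlogB.trans h3) hKε1
    linarith

end Assumptions

end Setup
end PGRPD

/-! ### The parameter choices of (a) and of the polyhedral cases. -/

namespace PGRPD

/-- The length of a restart cycle, up to a factor. -/
theorem ceil_two_mul_sqrt_le {a Q : ℝ} (hQ : 1 ≤ Q) (h : √a ≤ Q) :
    (⌈2 * √(2 * a)⌉₊ : ℝ) ≤ 4 * Q := by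
  rw [Real.sqrt_mul zero_le_two]
  have h0 := Real.sqrt_nonneg a
  have h1 := (Nat.ceil_lt_add_one (by positivity : 0 ≤ 2 * (√2 * √a))).le
  have h2 : √2 ≤ 3 / 2 := Real.sqrt_le_iff.2 (by norm_num)
  have h3 : √2 * √a ≤ 3 / 2 * Q := mul_le_mul h2 h h0 (by norm_num)
  linarith

namespace Setup

variable {d n nb : ℕ} {S : Setup d n nb} {P : Params d} {ε : ℝ}

namespace Assumptions

variable (hA : S.Assumptions)
include hA

theorem accepts_fullRankParams (hH : S.H ≠ 0) (hR : FullRowRank S.H) (hLf : 0 < S.Lf) :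
    ∀ ε > 0, ∀ k, S.Accepts (S.iter S.fullRankParams ε k).1
      (S.mu S.fullRankParams ε k (S.iter S.fullRankParams ε k).1)
      (S.zNext S.fullRankParams ε k (S.iter S.fullRankParams ε k).1) := fun _ hε _ =>
  hA.accepts_fullRowRank hLf hH hR _ (mul_pos one_pos (hA.muTilde_pos hLf hε _))

theorem exists_moderate_fullRankParams (hLf : 0 < S.Lf) (hH : S.H ≠ 0) (hR : FullRowRank S.H) :
    ∃ c, 1 ≤ c ∧ S.ModerateParams S.fullRankParams c := by
  have hτ := τ_pos hLf
  have hρ : 0 < lamMinPos S.H / S.τ := div_pos (hR.lamMinPos_pos hH) hτ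
  set j : ℕ := ⌈2 * √2 * condNumber S.H⌉₊ with hj
  have hj0 : (0 : ℝ) ≤ j := Nat.cast_nonneg _
  have hρ' : 0 < 1 / (lamMinPos S.H / S.τ) := by positivity
  have hΩ := hA.Ω_nonempty_of_fullRowRank hLf hH hR
  have hc : 1 ≤ 1 + j + 1 / (lamMinPos S.H / S.τ) := by linarith
  have hW : ∀ x, 1 + j + 1 / (lamMinPos S.H / S.τ)
      ≤ (1 + j + 1 / (lamMinPos S.H / S.τ)) * (1 + S.gap x + ‖S.ν x‖ ^ 2) := fun x =>
    le_mul_of_one_le_right (by linarith) (by linarith [hA.gap_nonneg (hΩ x), sq_nonneg ‖S.ν x‖])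
  refine ⟨1 + j + 1 / (lamMinPos S.H / S.τ), hc, fun _ => ⟨one_pos, le_rfl⟩, fun k => ?_,
    fun _ => hρ, fun x => ?_, fun x => ?_, hΩ, hA.accepts_fullRankParams hH hR hLf⟩
  · exact one_le_mul_of_one_le_of_one_le le_rfl (one_le_pow₀ (by simp))
  · calc (1 : ℝ) = lamMinPos S.H / S.τ * (1 / (lamMinPos S.H / S.τ)) :=
          (mul_one_div_cancel hρ.ne').symm
      _ ≤ _ := mul_le_mul_of_nonneg_left (le_trans (by linarith) (hW x)) hρ.le
  · refine le_trans ?_ (hW x)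
    show (j : ℝ) ≤ _
    linarith

theorem solvesWithin_fullRank (hB : S.BoundedBelow) (hH : S.H ≠ 0) (hR : FullRowRank S.H) :
    S.SolvesWithin S.fullRankParams 62000 (condNumber S.H) 1 := by
  rcases le_or_gt S.Lf 0 with hLf | hLf
  · exact solvesWithin_of_nonpos hLf _ _ _
  obtain ⟨c, hc, hP⟩ := hA.exists_moderate_fullRankParams hLf hH hR
  have hκ := hR.one_le_condNumber hH
  refine hA.solvesWithin hLf hB hc hP hκ (fun ε _ _ K _ k _ => ?_) fun _ => Or.inl one_pos
  show (⌈2 * √2 * condNumber S.H⌉₊ : ℝ) ≤ _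
  have h1 := ceil_two_mul_sqrt_le (a := condNumber S.H ^ 2) hκ (Real.sqrt_sq (by linarith)).le
  rwa [Real.sqrt_mul zero_le_two, Real.sqrt_sq (by linarith), ← mul_assoc] at h1

/-! ### The polyhedral case -/

theorem LD_div_ρPoly_le (hLf : 0 < S.Lf) (hH : S.H ≠ 0) (θ : ℝ) {x : Vec (Fin d)}
    (hΩ : (S.Ω x).Nonempty) :
    S.LD / S.ρPoly θ x
      ≤ lamMax S.H * θ ^ 2 * (1 + S.gap x / S.τ + 2 * ‖S.ν x‖ ^ 2 / S.τ ^ 2) := by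
  have hτ := τ_pos hLf
  have hg := hA.gap_nonneg hΩ
  have hl := lamMax_pos hH
  rw [ρPoly, LD]
  split_ifs
  · rw [div_inv_eq_mul]
    calc lamMax S.H / S.τ * (θ ^ 2 * S.τ) = lamMax S.H * θ ^ 2 * (1 + 0 + 0) := by
          field_simp; ring
      _ ≤ _ := by gcongr <;> positivity
  · rw [div_inv_eq_mul]
    refine le_of_eq ?_
    field_simp

theorem exists_moderate_polyParams (hLf : 0 < S.Lf) (hH : S.H ≠ 0) {θ : ℝ} (hθ : 0 < θ)
    {w : ℕ → ℝ} (hw : ∀ k, 0 < w k ∧ w k ≤ 1) (hw' : ∀ k : ℕ, 1 ≤ w k * ((k : ℝ) + 1) ^ 2)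
    (hΩ : ∀ x, (S.Ω x).Nonempty)
    (hacc : ∀ ε > 0, ∀ k, S.Accepts (S.iter (S.polyParams θ w) ε k).1
      (S.mu (S.polyParams θ w) ε k (S.iter (S.polyParams θ w) ε k).1)
      (S.zNext (S.polyParams θ w) ε k (S.iter (S.polyParams θ w) ε k).1)) :
    ∃ c, 1 ≤ c ∧ S.ModerateParams (S.polyParams θ w) c := by
  have hτ := τ_pos hLf
  have hl := lamMax_pos hH
  have hL := LD_pos hLf hH
  obtain ⟨e, he⟩ : ∃ r, r = lamMax S.H * θ ^ 2 * (1 + 1 / S.τ + 2 / S.τ ^ 2) := ⟨_, rfl⟩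
  have he0 : 0 < e := by rw [he]; positivity
  have hW1 : ∀ x, 1 ≤ 1 + S.gap x + ‖S.ν x‖ ^ 2 := fun x => by
    linarith [hA.gap_nonneg (hΩ x), sq_nonneg ‖S.ν x‖]
  have hbound : ∀ x, S.LD / S.ρPoly θ x ≤ e * (1 + S.gap x + ‖S.ν x‖ ^ 2) := by
    intro x
    have hg := hA.gap_nonneg (hΩ x)
    refine (hA.LD_div_ρPoly_le hLf hH θ (hΩ x)).trans ?_
    rw [he, mul_assoc (lamMax S.H * θ ^ 2) (1 + 1 / S.τ + 2 / S.τ ^ 2)]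
    refine mul_le_mul_of_nonneg_left ?_ (by positivity)
    have h1 : 0 ≤ 1 / S.τ := by positivity
    have h2 : 0 ≤ 2 / S.τ ^ 2 := by positivity
    have h3 : S.gap x / S.τ = 1 / S.τ * S.gap x := by ring
    have h4 : 2 * ‖S.ν x‖ ^ 2 / S.τ ^ 2 = 2 / S.τ ^ 2 * ‖S.ν x‖ ^ 2 := by ring
    rw [h3, h4]
    nlinarith [mul_nonneg h1 (sq_nonneg ‖S.ν x‖), mul_nonneg h2 hg, sq_nonneg ‖S.ν x‖]
  have heL : 0 < e / S.LD := by positivity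
  refine ⟨4 * (1 + e) + e / S.LD, by linarith only [he0, heL], hw, hw', fun x => hA.ρPoly_pos hLf hθ x (hΩ x),
    fun x => ?_, fun x => ?_, hΩ, hacc⟩
  · have hρ := hA.ρPoly_pos hLf hθ x (hΩ x)
    have h1 := hbound x
    rw [div_le_iff₀ hρ] at h1
    show 1 ≤ S.ρPoly θ x * _
    refine le_trans ((one_le_div hL).2 h1) ?_
    rw [mul_comm (S.ρPoly θ x), mul_div_right_comm, mul_div_right_comm]
    refine mul_le_mul_of_nonneg_right (mul_le_mul_of_nonneg_right ?_ (by linarith [hW1 x])) hρ.le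
    linarith
  · have hW := hW1 x
    show (⌈2 * √(2 * S.LD / S.ρPoly θ x)⌉₊ : ℝ) ≤ _
    rw [mul_div_assoc]
    refine (ceil_two_mul_sqrt_le (Q := 1 + e * (1 + S.gap x + ‖S.ν x‖ ^ 2)) ?_ ?_).trans ?_
    · have := mul_nonneg he0.le (zero_le_one.trans hW); linarith
    · refine (Real.sqrt_le_sqrt (hbound x)).trans (Real.sqrt_le_iff.2 ⟨by positivity, ?_⟩)
      nlinarith [mul_nonneg he0.le (zero_le_one.trans hW)]
    · nlinarith [mul_nonneg heL.le (zero_le_one.trans hW)]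

section

variable {m : ℕ} {C : Matrix (Fin m) (Fin nb) ℝ} {c : Vec (Fin m)} (hP : S.IsPolyhedral C c)
include hP

theorem accepts_polyParams_homogeneous (hH : S.H ≠ 0) (hb : S.bbar = 0 ∧ S.b = 0) {θ : ℝ}
    (hθ : S.IsHoffman C θ) (hLf : 0 < S.Lf) {w : ℕ → ℝ} (hw : ∀ k, 0 < w k ∧ w k ≤ 1) :
    ∀ ε > 0, ∀ k, S.Accepts (S.iter (S.polyParams θ w) ε k).1
      (S.mu (S.polyParams θ w) ε k (S.iter (S.polyParams θ w) ε k).1)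
      (S.zNext (S.polyParams θ w) ε k (S.iter (S.polyParams θ w) ε k).1) := fun _ hε k =>
  hA.accepts_homogeneous hP hLf hH hb (fun _ => rfl) hθ (hθ.pos hH).1 _
    (mul_pos (hw k).1 (hA.muTilde_pos hLf hε _))

theorem accepts_polyParams_affine (hH : S.H ≠ 0) {θ : ℝ} (hθ : S.IsHoffmanAffine C θ)
    (hLf : 0 < S.Lf) {w : ℕ → ℝ} (hw : ∀ k, 0 < w k ∧ w k ≤ 1) :
    ∀ ε > 0, ∀ k, S.Accepts (S.iter (S.polyParams θ w) ε k).1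
      (S.mu (S.polyParams θ w) ε k (S.iter (S.polyParams θ w) ε k).1)
      (S.zNext (S.polyParams θ w) ε k (S.iter (S.polyParams θ w) ε k).1) := fun _ hε k =>
  hA.accepts_affine hP hLf hH hθ (hθ.pos hH) _ (mul_pos (hw k).1 (hA.muTilde_pos hLf hε _))

theorem solvesWithin_homogeneous (hB : S.BoundedBelow) (hH : S.H ≠ 0) (hb : S.bbar = 0 ∧ S.b = 0)
    {θ : ℝ} (hθ : S.IsHoffman C θ) :
    S.SolvesWithin (S.polyParams θ fun _ => 1) 62000 (√(lamMax S.H * θ ^ 2)) 1 := by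
  rcases le_or_gt S.Lf 0 with hLf | hLf
  · exact solvesWithin_of_nonpos hLf _ _ _
  have hτ := τ_pos hLf
  have hθ0 := hθ.pos hH
  obtain ⟨c, hc, hM⟩ := hA.exists_moderate_polyParams hLf hH hθ0.1 (w := fun _ => 1)
    (fun _ => ⟨one_pos, le_rfl⟩)
    (fun k => one_le_mul_of_one_le_of_one_le le_rfl (one_le_pow₀ (by simp)))
    (hA.Ω_nonempty_of_polyhedral hP hLf)
    (hA.accepts_polyParams_homogeneous hP hH hb hθ hLf fun _ => ⟨one_pos, le_rfl⟩)
  have hQ := Real.one_le_sqrt.2 hθ0.2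
  refine hA.solvesWithin hLf hB hc hM hQ (fun ε _ _ K _ k _ => ?_) fun _ => Or.inl one_pos
  show (⌈2 * √(2 * S.LD / S.ρPoly θ _)⌉₊ : ℝ) ≤ _
  rw [mul_div_assoc]
  refine ceil_two_mul_sqrt_le hQ (Real.sqrt_le_sqrt (le_of_eq ?_))
  rw [ρPoly, if_pos hb, LD, div_inv_eq_mul]
  field_simp

end

end Assumptions

end Setup
end PGRPD

/-! ### Compact level sets and the weights `1/(k+1)²`. -/

namespace PGRPD

namespace Setup

variable {d n nb : ℕ} {S : Setup d n nb} {P : Params d} {ε : ℝ} {xt : ℕ → Vec (Fin d)}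

/-- The weights `1 / (k + 1)²`. -/
noncomputable abbrev sqWeight (k : ℕ) : ℝ := 1 / ((k : ℝ) + 1) ^ 2

theorem sqWeight_mem (k : ℕ) : 0 < sqWeight k ∧ sqWeight k ≤ 1 :=
  ⟨by positivity, div_le_one_of_le₀ (one_le_pow₀ (by simp)) (by positivity)⟩

theorem one_le_sqWeight_mul (k : ℕ) : 1 ≤ sqWeight k * ((k : ℝ) + 1) ^ 2 :=
  (div_mul_cancel₀ 1 (by positivity)).ge

theorem sqWeight_le {k : ℕ} (hk : 3 ≤ k) : sqWeight k ≤ 1 / 16 := by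
  have : (3 : ℝ) ≤ k := by exact_mod_cast hk
  refine one_div_le_one_div_of_le (by norm_num) ?_
  nlinarith

namespace ExactIterates

/-- With the weights `1 / (k + 1)²` the objective exceeds its initial value by less than one. -/
theorem primalVal_le_add_one (hLf : 0 < S.Lf) (hε : S.Admissible ε) (hP : P.w = sqWeight)
    (hx : S.ExactIterates P ε xt) (k : ℕ) : S.primalVal (xt k) ≤ S.primalVal S.x0 + 1 := by
  obtain ⟨hε0, hε1, hε2⟩ := hε.facts hLf
  have ha : S.Lf * (ε / S.Lf) ^ 2 ≤ 3 := by
    have : S.Lf * (ε / S.Lf) ^ 2 = ε ^ 2 / S.Lf := by field_simp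
    rw [this, div_le_iff₀ hLf]; exact hε2.le
  have key : ∀ k : ℕ, S.primalVal (xt (k + 1)) ≤ S.primalVal S.x0
      -- Per step the increase is at most `23/1000 · 3 · w_k² ≤ w_k / 14`, where `3` bounds `ε² /
      -- L_f` for admissible `ε`, and `1/(k+1)² ≤ 2/(k+1) - 2/(k+2)` telescopes.
      + 1 / 14 * (2 - 2 / ((k : ℝ) + 1)) := by
    intro k
    induction k with
    | zero =>
      have h1 := hx.descent 0
      rw [hx.zero] at h1
      have h2 : 0 ≤ S.Lf * ‖xt (0 + 1) - S.x0‖ ^ 2 := by positivity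
      simp only [lagWeight] at h1
      norm_num at h1 h2 ⊢
      linarith
    | succ k ih =>
      have h1 := hx.descent (k + 1)
      have h2 : 0 ≤ S.Lf * ‖xt (k + 1 + 1) - xt (k + 1)‖ ^ 2 := by positivity
      have h3 : lagWeight P (k + 1) = sqWeight k := by rw [lagWeight, hP]
      rw [h3] at h1
      have h4 := sqWeight_mem k
      have h5 : sqWeight k ^ 2 ≤ sqWeight k := by nlinarith
      have h6 : sqWeight k ≤ 2 / ((k : ℝ) + 1) - 2 / ((k : ℝ) + 2) := by
        rw [sqWeight, div_sub_div _ _ (by positivity) (by positivity),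
          div_le_div_iff₀ (by positivity) (by positivity)]
        nlinarith [Nat.cast_nonneg (α := ℝ) k]
      have h7 : sqWeight k ^ 2 * (S.Lf * (ε / S.Lf) ^ 2) ≤ sqWeight k * 3 :=
        mul_le_mul h5 ha (by positivity) h4.1.le
      have h8 : ((k + 1 : ℕ) : ℝ) + 1 = (k : ℝ) + 2 := by push_cast; ring
      rw [h8]
      linarith
  rcases k with _ | k
  · rw [hx.zero]; linarith
  · have : 0 ≤ 2 / ((k : ℝ) + 1) := by positivity
    linarith [key k]

/-- With the weights `1 / (k + 1)²` a solution is reached within `K_ε` outer iterations. -/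
theorem firstKKT_le_Kε (hLf : 0 < S.Lf) (hε : S.Admissible ε) (hP : P.w = sqWeight)
    (hx : S.ExactIterates P ε xt) (hD : ∀ k, S.primalVal S.x0 - S.primalVal (xt k) ≤ S.ΔF)
    (hεL : ε ^ 2 ≤ S.Lf * S.ΔF) {K : ℕ} (hK : S.FirstKKT P ε K) : K ≤ S.Kε ε := by
  obtain ⟨hε0, -, -⟩ := hε.facts hLf
  by_contra! hlt
  have hq : S.Lf * (ε / S.Lf) ^ 2 = ε ^ 2 / S.Lf := by field_simp
  have hq0 : 0 < ε ^ 2 / S.Lf := by positivity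
  have hE : 12 * (S.Lf * S.ΔF / ε ^ 2) ≤ S.Kε ε := le_trans (le_of_eq (by ring)) (Nat.le_ceil _)
  have hE1 : 1 ≤ S.Lf * S.ΔF / ε ^ 2 := by rwa [le_div_iff₀ (by positivity), one_mul]
  have hE' : S.ΔF = S.Lf * S.ΔF / ε ^ 2 * (ε ^ 2 / S.Lf) := by field_simp
  have h12 : 12 ≤ S.Kε ε := by
    have : (12 : ℝ) ≤ S.Kε ε := by linarith
    exact_mod_cast this
  -- The first four steps are only used not to increase the objective: step `4` is the first whose
  -- weights `w 3` and `w 4` are both at most `1/16`.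
  have h4 : S.primalVal (xt 4) ≤ S.primalVal S.x0 := by
    have := hx.primalVal_le_of_not_KKT (K := 4) fun k hk => hK.2 (k + 1) (by omega)
    rw [hq] at this
    push_cast at this
    linarith
  have key : ∀ i : ℕ, 4 + i ≤ S.Kε ε →
      S.primalVal (xt (4 + i)) ≤ S.primalVal S.x0 - i * (15 / 100 * (ε ^ 2 / S.Lf)) := by
    intro i
    induction i with
    | zero => intro _; simpa using h4
    | succ i ih =>
      intro hi
      have h1 := ih (by omega)
      have h2 := hx.strong_descent_of_not_KKT (4 + i)
        (by
          rw [show 4 + i = (3 + i) + 1 by ring, lagWeight, hP]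
          exact sqWeight_le (by omega))
        (by rw [hP]; exact sqWeight_le (by omega)) (hK.2 (4 + i + 1) (by omega))
      rw [hq] at h2
      rw [← add_assoc]
      push_cast
      linarith
  obtain ⟨i, hi⟩ := Nat.exists_eq_add_of_le (by omega : 4 ≤ S.Kε ε)
  have h1 := key i hi.ge
  have h2 := hD (4 + i)
  -- With `E = L_f Δ_F / ε²`, the remaining `i ≥ 12 E - 4` steps give `0.15 (12 E - 4) ≤ E`, hence
  -- `E ≤ 3/4`, against `E ≥ 1`.
  have h3 : (i : ℝ) * (15 / 100) * (ε ^ 2 / S.Lf) ≤ S.Lf * S.ΔF / ε ^ 2 * (ε ^ 2 / S.Lf) := by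
    rw [← hE']; linarith
  have h5 := le_of_mul_le_mul_right h3 hq0
  rw [hi] at hE
  push_cast at hE
  linarith

end ExactIterates

namespace Assumptions

variable (hA : S.Assumptions)
include hA

/-- On the bounded level set `f₀` is bounded by continuity and `g` has a minorant of linear growth;
off it `F` exceeds its initial value plus one. -/
theorem boundedBelow_of_isCompact
    (hK : IsCompact {p : Vec (Fin d) × Vec (Fin nb) | S.F p ≤ S.F (S.x0, S.y0) + 1}) :
    S.BoundedBelow := by
  obtain ⟨R, hR⟩ := hK.isBounded.exists_norm_le
  obtain ⟨a, b, ha, hb, hg⟩ := hA.g_lower_bound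
  obtain ⟨m, hm⟩ := (isCompact_closedBall (0 : Vec (Fin d)) R).bddBelow_image
    hA.differentiable.continuous.continuousOn
  have hF0 : S.F (S.x0, S.y0) + 1 = ((S.primalVal S.x0 + 1 : ℝ) : EReal) := by
    rw [hA.F_coe hA.y0_dom, hA.primalVal_x0, EReal.coe_add _ 1]; rfl
  refine ⟨min (m - (a + b * R)) (S.primalVal S.x0 + 1), fun p => ?_⟩
  by_cases hp : S.F p ≤ S.F (S.x0, S.y0) + 1
  · have hpR := hR p hp
    have hy : p.2 ∈ dom S.g := fun h => by
      rw [hF0, F, h, EReal.coe_add_top, top_le_iff] at hp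
      exact EReal.coe_ne_top _ hp
    rw [show p = (p.1, p.2) from rfl, hA.F_coe hy, EReal.coe_le_coe_iff]
    refine (min_le_left _ _).trans ?_
    have h1 : m ≤ S.f₀ p.1 := hm ⟨p.1, by
      rw [mem_closedBall_zero_iff]; exact (norm_fst_le p).trans hpR, rfl⟩
    have h2 := hg _ hy
    have h3 := mul_le_mul_of_nonneg_left ((norm_snd_le p).trans hpR) hb
    linarith
  · refine le_trans ?_ (not_le.1 hp).le
    rw [hF0, EReal.coe_le_coe_iff]
    exact min_le_right _ _

theorem exists_norm_le_of_isCompact (hLf : 0 < S.Lf)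
    (hK : IsCompact {p : Vec (Fin d) × Vec (Fin nb) | S.F p ≤ S.F (S.x0, S.y0) + 1})
    (hP : P.w = sqWeight) :
    ∃ R, ∀ ε, S.Admissible ε → ∀ xt, S.ExactIterates P ε xt → ∀ k, ‖xt k‖ ≤ R := by
  obtain ⟨R, hR⟩ := hK.isBounded.exists_norm_le
  refine ⟨R, fun ε hε xt hx k => ?_⟩
  refine (norm_fst_le (xt k, mul S.Abar (xt k) + S.bbar)).trans (hR _ ?_)
  have h := hx.primalVal_le_add_one hLf hε hP k
  rw [Set.mem_ofPred_eq, hA.F_coe (hx.mem_dom k), hA.F_coe hA.y0_dom, ← hA.primalVal_x0]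
  exact (EReal.coe_le_coe_iff.2 h).trans_eq (EReal.coe_add _ 1)

section

variable {m : ℕ} {C : Matrix (Fin m) (Fin nb) ℝ} {c : Vec (Fin m)} (hP : S.IsPolyhedral C c)
include hP

/-- All exact points lie in the compact level set and the iterates are near them; `ν = -τ • xt (k +
1)`, and the gap is bounded on bounded sets. -/
theorem exists_boundsRun (hLf : 0 < S.Lf) (hH : S.H ≠ 0)
    (hK : IsCompact {p : Vec (Fin d) × Vec (Fin nb) | S.F p ≤ S.F (S.x0, S.y0) + 1})
    {θ : ℝ} (hθ : S.IsHoffmanAffine C θ) :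
    ∃ B₅ B₆, S.BoundsRun (S.polyParams θ sqWeight) B₅ B₆ := by
  have hacc := hA.accepts_polyParams_affine hP hH hθ hLf sqWeight_mem
  obtain ⟨R, hR⟩ := hA.exists_norm_le_of_isCompact (P := S.polyParams θ sqWeight) hLf hK rfl
  obtain ⟨G, hG1, hG⟩ := hA.exists_gap_le hLf (hA.Ω_nonempty_of_polyhedral hP hLf)
  have hτ := τ_pos hLf
  refine ⟨(S.τ * R) ^ 2, G * (1 + (R + 1 / S.Lf)) ^ 2, fun ε hε k _ => ?_⟩
  obtain ⟨hε0, hε1, -⟩ := hε.facts hLf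
  obtain ⟨xt, hx⟩ := hA.exists_exactIterates hLf hε0 (P := S.polyParams θ sqWeight) sqWeight_mem
    (hacc ε hε0)
  constructor
  · rw [hx.ν_eq, norm_neg, norm_smul, Real.norm_eq_abs, abs_of_pos hτ]
    gcongr
    exact hR ε hε xt hx _
  · refine (hG _).trans ?_
    have h1 := norm_add_le (xt k) ((S.iter (S.polyParams θ sqWeight) ε k).1 - xt k)
    rw [add_sub_cancel] at h1
    have h2 := hx.near k
    have h3 : ε / S.Lf ≤ 1 / S.Lf := by gcongr
    have h4 : 0 ≤ ε / S.Lf := by positivity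
    have h5 := hR ε hε xt hx k
    gcongr
    linarith

theorem solvesWithin_affine (hLf : 0 < S.Lf) (hH : S.H ≠ 0)
    (hK : IsCompact {p : Vec (Fin d) × Vec (Fin nb) | S.F p ≤ S.F (S.x0, S.y0) + 1})
    {θ : ℝ} (hθ : S.IsHoffmanAffine C θ) {B₅ B₆ Q : ℝ}
    (hbd : S.BoundsRun (S.polyParams θ sqWeight) B₅ B₆) (hQ : 1 ≤ Q)
    (hQ' : √(lamMax S.H * θ ^ 2 * (1 + B₆ / S.τ + 2 * B₅ / S.τ ^ 2)) ≤ Q) :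
    S.SolvesWithin (S.polyParams θ sqWeight) 62000 Q B₆ := by
  have hτ := τ_pos hLf
  have hl := lamMax_pos hH
  have hB := hA.boundedBelow_of_isCompact hK
  have hacc := hA.accepts_polyParams_affine hP hH hθ hLf sqWeight_mem
  have hΩ := hA.Ω_nonempty_of_polyhedral hP hLf
  obtain ⟨c, hc, hM⟩ := hA.exists_moderate_polyParams hLf hH (hθ.pos hH) sqWeight_mem
    one_le_sqWeight_mul hΩ hacc
  have hle : ∀ ε, S.Admissible ε → ε ^ 2 ≤ S.Lf * S.ΔF → ∀ K,
      S.FirstKKT (S.polyParams θ sqWeight) ε K → K ≤ S.Kε ε := by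
    intro ε hε hεL K hK'
    obtain ⟨xt, hx⟩ := hA.exists_exactIterates hLf hε.1 (P := S.polyParams θ sqWeight) sqWeight_mem
      (hacc ε hε.1)
    exact hx.firstKKT_le_Kε hLf hε rfl (fun k => hA.sub_le_ΔF hB (hx.mem_dom k)) hεL hK'
  refine hA.solvesWithin hLf hB hc hM hQ (fun ε hε hεL K hK' k hk => ?_) fun hΔ => ?_
  · obtain ⟨h5, h6⟩ := hbd ε hε k (hk.trans_le (hle ε hε hεL K hK'))
    show (⌈2 * √(2 * S.LD / S.ρPoly θ _)⌉₊ : ℝ) ≤ _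
    rw [mul_div_assoc]
    refine ceil_two_mul_sqrt_le hQ ((Real.sqrt_le_sqrt ?_).trans hQ')
    refine (hA.LD_div_ρPoly_le hLf hH θ (hΩ _)).trans ?_
    gcongr
  -- `K_ε > 0` makes the bounds apply at `k = 0`, so `B₆ ≥ 0`. If `B₆ = 0`, every gap vanishes and
  -- so do all cycle numbers, since `Real.logb 2 0 = 0`.
  · have hpos : ∀ ε, S.Admissible ε → 0 < S.Kε ε := fun ε hε => by
      have := hε.1
      exact Nat.ceil_pos.2 (by positivity)
    obtain ⟨ε₁, hε₁⟩ : ∃ ε, S.Admissible ε := by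
      have h : 0 < min (√(3 * S.Lf)) 1 := lt_min (by positivity) one_pos
      exact ⟨_, half_pos h, half_lt_self h⟩
    have h6 := (hA.gap_nonneg (hΩ _)).trans (hbd ε₁ hε₁ 0 (hpos ε₁ hε₁)).2
    rcases h6.eq_or_lt with h0 | h0
    · refine Or.inr ⟨h0.symm, fun ε hε hεL K hK' => ?_⟩
      refine Finset.sum_eq_zero fun k hk => ?_
      have hk' := (Finset.mem_range.1 hk).trans_le (hle ε hε hεL K hK')
      have hg := le_antisymm ((hbd ε hε k hk').2.trans_eq h0.symm) (hA.gap_nonneg (hΩ _))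
      rw [numCycles, hg, mul_zero, zero_div, Real.logb_zero, Nat.ceil_zero, zero_mul]
    · exact Or.inl h0

theorem exists_boundsRun_solvesWithin (hH : S.H ≠ 0)
    (hK : IsCompact {p : Vec (Fin d) × Vec (Fin nb) | S.F p ≤ S.F (S.x0, S.y0) + 1})
    {θ : ℝ} (hθ : S.IsHoffmanAffine C θ) :
    ∃ B₅ B₆ : ℝ, S.BoundsRun (S.polyParams θ sqWeight) B₅ B₆ ∧
      S.SolvesWithin (S.polyParams θ sqWeight) 62000
        (√(lamMax S.H * θ ^ 2 * (1 + B₆ / S.τ + 2 * B₅))) B₆ := by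
  rcases le_or_gt S.Lf 0 with hLf | hLf
  · exact ⟨0, 0, fun ε hε => absurd hε (not_admissible hLf), solvesWithin_of_nonpos hLf _ _ _⟩
  have hτ := τ_pos hLf
  have hl := lamMax_pos hH
  have hθ0 := hθ.pos hH
  obtain ⟨b₅, b₆, hb⟩ := hA.exists_boundsRun hP hLf hH hK hθ
  -- Enlarging `B₆` to at least `τ / (λ_max θ²)` makes the complexity factor at least `1`, without
  -- the maximum of the second claim.
  obtain ⟨B₆, hB₆⟩ : ∃ r, r = max (max b₆ 0) (S.τ / (lamMax S.H * θ ^ 2)) := ⟨_, rfl⟩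
  have hB₆' : max b₆ 0 ≤ B₆ := hB₆ ▸ le_max_left _ _
  have hB₆'' : S.τ / (lamMax S.H * θ ^ 2) ≤ B₆ := hB₆ ▸ le_max_right _ _
  have hmono : ∀ B, b₅ ≤ B → S.BoundsRun (S.polyParams θ sqWeight) B B₆ := fun B hB ε hε k hk =>
    ⟨(hb ε hε k hk).1.trans hB, (hb ε hε k hk).2.trans ((le_max_left _ _).trans hB₆')⟩
  obtain ⟨B, hBdef⟩ : ∃ r, r = max b₅ 0 := ⟨_, rfl⟩
  have hB0 : 0 ≤ B := hBdef ▸ le_max_right _ _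
  have hB5 : b₅ ≤ B := hBdef ▸ le_max_left _ _
  have hm0 : 0 ≤ max B (B / S.τ ^ 2) := hB0.trans (le_max_left _ _)
  have hB60 : 0 ≤ B₆ := (le_max_right _ _).trans hB₆'
  -- The step count needs `2 B / τ²`; announcing `B₅ = max B (B / τ²)` makes it at most the stated
  -- `2 B₅`, whatever the size of `τ`.
  refine ⟨max B (B / S.τ ^ 2), B₆, hmono _ (hB5.trans (le_max_left _ _)),
    hA.solvesWithin_affine hP hLf hH hK hθ (hmono _ hB5) ?_ ?_⟩
  · rw [Real.one_le_sqrt]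
    rw [div_le_iff₀ (by positivity)] at hB₆''
    have h1 : 1 ≤ lamMax S.H * θ ^ 2 * (B₆ / S.τ) := by
      rw [← mul_div_assoc, one_le_div hτ]; linarith
    refine h1.trans ?_
    gcongr
    linarith
  · refine Real.sqrt_le_sqrt ?_
    gcongr
    rw [mul_div_assoc]
    gcongr
    exact le_max_right _ _

end

end Assumptions

end Setup
end PGRPD

theorem mainTheorem2 :
    ∃ cst : ℝ, 0 < cst ∧ ∀ (d n nb : ℕ) (S : PGRPD.Setup d n nb), S.Assumptions → S.H ≠ 0 →
      -- (a) `[Ā; A]` has full row rank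
      (PGRPD.FullRowRank S.H →
        S.FindsKKT S.fullRankParams ∧
        (S.BoundedBelow →
          S.SolvesWithin S.fullRankParams cst (PGRPD.condNumber S.H) 1)) ∧
      -- (b) polyhedral `g`, homogeneous constraints
      (∀ (m : ℕ) (C : Matrix (Fin m) (Fin nb) ℝ) (c : PGRPD.Vec (Fin m)),
        S.IsPolyhedral C c → S.bbar = 0 → S.b = 0 →
        (∃ θ, S.IsHoffman C θ) ∧
        ∀ θ, S.IsHoffman C θ →
          S.FindsKKT (S.polyParams θ fun _ => 1) ∧
          (S.BoundedBelow →
            S.SolvesWithin (S.polyParams θ fun _ => 1) cst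
              (√(PGRPD.lamMax S.H * θ ^ 2)) 1)) ∧
      -- (c) polyhedral `g`, compact level set
      (∀ (m : ℕ) (C : Matrix (Fin m) (Fin nb) ℝ) (c : PGRPD.Vec (Fin m)),
        S.IsPolyhedral C c →
        IsCompact {p : PGRPD.Vec (Fin d) × PGRPD.Vec (Fin nb) | S.F p ≤ S.F (S.x0, S.y0) + 1} →
        (∃ θ, S.IsHoffmanAffine C θ) ∧
        ∀ θ, S.IsHoffmanAffine C θ →
          (∃ B₅ B₆ : ℝ,
            S.BoundsRun (S.polyParams θ fun k => 1 / ((k : ℝ) + 1) ^ 2) B₅ B₆ ∧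
            S.SolvesWithin (S.polyParams θ fun k => 1 / ((k : ℝ) + 1) ^ 2) cst
              (√(PGRPD.lamMax S.H * θ ^ 2 * (1 + B₆ / S.τ + 2 * B₅))) B₆) ∧
          (∀ B₅ B₆ : ℝ,
            S.BoundsRun (S.polyParams θ fun k => 1 / ((k : ℝ) + 1) ^ 2) B₅ B₆ →
            S.SolvesWithin (S.polyParams θ fun k => 1 / ((k : ℝ) + 1) ^ 2) cst
              (max 1 (√(PGRPD.lamMax S.H * θ ^ 2 * (1 + B₆ / S.τ + 2 * B₅ / S.τ ^ 2)))) B₆)) := by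
  refine ⟨62000, by norm_num, fun d n nb S hA hH => ⟨fun hR => ⟨?_, fun hB => ?_⟩,
    fun m C c hP hbbar hb => ⟨PGRPD.exists_isHoffmanConstant _ _, fun θ hθ => ⟨?_, fun hB => ?_⟩⟩,
    fun m C c hP hK => ⟨PGRPD.exists_isHoffmanConstant _ _, fun θ hθ => ⟨?_, fun B₅ B₆ hbd => ?_⟩⟩⟩⟩
  · exact hA.findsKKT (fun _ => ⟨one_pos, le_rfl⟩) (hA.accepts_fullRankParams hH hR)
  · exact hA.solvesWithin_fullRank hB hH hR
  · exact hA.findsKKT (P := S.polyParams θ fun _ => 1) (fun _ => ⟨one_pos, le_rfl⟩) fun hLf =>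
      hA.accepts_polyParams_homogeneous hP hH ⟨hbbar, hb⟩ hθ hLf fun _ => ⟨one_pos, le_rfl⟩
  · exact hA.solvesWithin_homogeneous hP hB hH ⟨hbbar, hb⟩ hθ
  · exact hA.exists_boundsRun_solvesWithin hP hH hK hθ
  · rcases le_or_gt S.Lf 0 with hLf | hLf
    · exact PGRPD.Setup.solvesWithin_of_nonpos hLf _ _ _
    · exact hA.solvesWithin_affine hP hLf hH hK hθ hbd (le_max_left _ _) (le_max_right _ _)
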